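/- **Batch updates of a graph stored as a tree of $C$-trees.** *Setting.* Let $n\ge 2$, let $b\ge 1$ (the chunking parameter) be a constant, and let $h:\{0,\dots,n-1\}\to\{1,\dots,N\}$, $N\ge b$, be a uniformly random hash function. A vertex $e$ is a *head* if $h(e)\bmod b=0$. The *$C$-tree* of a set $S$ of vertices consists of a balanced (AVL) purely functional search tree whose keys are the heads in $S$, where the value (the *tail*) of a head $e$ is the increasing array of the elements of $S$ between $e$ and the next head in $S$, and of a *prefix*, the increasing array of the elements of $S$ in front of the first head. A directed graph $G$ with vertices $0,\dots,n-1$ and edge set $E$ is represented by a *tree of $C$-trees*: a balanced (AVL) purely functional search tree over the vertices (the vertex-tree), in which the value of $u$ is a $C$-tree of $\{v : (u,v)\in E\}$ (the edge-tree of $u$), augmented by the number of edges in each subtree. (An undirected edge is stored and updated as two directed edges.) All edge-trees use the same $h$; the graph and the batch do not depend on $h$. *Algorithm.* InsertEdges and DeleteEdges take such a representation and a batch $A$, a sequence of $k=|A|$ pairs of vertices, possibly with repetitions. They sort $A$ by a comparison sort (parallel merge sort), drop repetitions, build in parallel for each source $u$ in $A$ a $C$-tree of the targets of the edges of $A$ with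 source $u$, build a tree over these pairs, and MultiInsert it into the vertex-tree, that is, form the union of the two trees by recursive Split and Join, where the old and the new edge-tree of a common vertex are combined by the $C$-tree operation Union (for InsertEdges) or Difference (for DeleteEdges). Work is the number of operations, and depth the length of the longest chain of dependent operations, in the fork-join work-depth model with constant-time comparisons, hash evaluations, tree-node operations and array accesses. *Claim.* For all constants $b\ge1$ and $a,c\in\mathbb N$ there is a constant $C>0$ such that for all $n\ge2$, all $N\ge b$, every edge set $E$, every batch $A$ with $1\le k\le n^a$, and every choice, for each $h$, of a tree of $C$-trees $T_h$ that represents $(\{0,\dots,n-1\},E)$: 1. For every $h$, InsertEdges$(T_h,A)$ returns a tree of $C$-trees that represents the graph with edge set $E\cup A$, and DeleteEdges$(T_h,A)$ one that represents the graph with edge set $E\setminus A$. 2. For each of the two operations, the expected work is at most $C\,k\log n$. 3. For each of the two operations, with probability at least $1-n^{-c}$ over $h$, the work is at most $C\,k\log n$ and the depth is at most $C\log^3 n$. -/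

import Mathlib

open Finset

namespace CTreeGraph

/-! ## The work-depth model

A `Cost α` is the result of running a fork-join computation: its value, the number of operations
performed (work) and the length of the longest chain of dependent operations (depth).

Machine conventions. Comparing two keys, evaluating the hash function, building or inspecting one
tree node, and reading the length or one entry of an array take constant time and are paid for by an
explicit `charge` in the routine that does it.  Arrays are modelled by lists.  A slice (`take`,
`drop`) of an array is a pointer with a length.  A routine that returns an array writes it, entry by
entry, to a destination chosen by its caller; two forked tasks whose outputs stand next to each
other write to adjacent parts of one destination, so that `++` of their outputs needs no copying.
Every other concatenation is charged for. -/

structure Cost (α : Type) where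
  val : α
  work : ℕ
  depth : ℕ

namespace Cost

variable {α β : Type}

/-- `m` sequential elementary operations. -/
def charge (m : ℕ) : Cost Unit := ⟨(), m, m⟩

/-- `pure` is free, and sequential composition adds work and adds depth. -/
instance : Monad Cost where
  pure a := ⟨a, 0, 0⟩
  bind x f := ⟨(f x.val).val, x.work + (f x.val).work, x.depth + (f x.val).depth⟩

/-- Binary fork: work adds up, depth is the maximum, and the fork itself costs one operation. -/
def par (x : Cost α) (y : Cost β) : Cost (α × β) :=
  ⟨(x.val, y.val), x.work + y.work + 1, max x.depth y.depth + 1⟩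

/-- Parallel loop over an array: the iterations are the leaves of a balanced binary tree of forks. -/
def parMap (f : α → Cost β) (l : List α) : Cost (List β) :=
  ⟨l.map fun x => (f x).val,
   (l.map fun x => (f x).work + 2).sum,
   (l.map fun x => (f x).depth).foldr max 0 + Nat.size l.length + 1⟩

end Cost

open Cost

/-! ## Parallel routines on arrays -/

section Arrays

variable {α : Type}

/-- Parallel pack: keeps the entries `x` with `keep p x`, where `p` is the entry in front of `x`
(`none` or a given value for the first one).  The two units charged per fork pay for the two sweeps:
one that counts the entries that stay, and one that hands down their offsets. -/
def pack (keep : Option α → α → Bool) (p : Option α) (l : List α) : Cost (List α) :=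
  if l.length ≤ 1 then do
    charge 2
    pure (l.filter (keep p))
  else do
    charge 2
    let q ← par (pack keep p (l.take (l.length / 2)))
      (pack keep l[l.length / 2 - 1]? (l.drop (l.length / 2)))
    pure (q.1 ++ q.2)
termination_by l.length
decreasing_by
  · simp only [List.length_take]; omega
  · simp only [List.length_drop]; omega

/-- Parallel filter. -/
def filterPar (keep : α → Bool) (l : List α) : Cost (List α) :=
  pack (fun _ x => keep x) none l

/-- Removes repetitions from a sorted array. -/
def dedupPar [DecidableEq α] (l : List α) : Cost (List α) :=
  pack (fun p x => decide (p ≠ some x)) none l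

/-- Binary search: the number of entries with `q`, in an array in which they come first. -/
def search (q : α → Bool) (l : List α) : Cost ℕ :=
  match hd : l.drop (l.length / 2) with
  | [] => do
    charge 1
    pure 0
  | x :: r => do
    charge 1
    if q x then do
      let j ← search q r
      pure (l.length / 2 + 1 + j)
    else
      search q (l.take (l.length / 2))
termination_by l.length
decreasing_by
  · have := congrArg List.length hd
    simp only [List.length_drop, List.length_cons] at this; omega
  · have := congrArg List.length hd
    simp only [List.length_drop, List.length_cons] at this
    simp only [List.length_take]; omega

variable [LinearOrder α]

/-- Parallel merge of two sorted arrays: the longer one is cut at its middle entry, the other one at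
the place of that entry, which is found by binary search. -/
def merge (a b : List α) : Cost (List α) :=
  if a.length < b.length then
    if b.length ≤ 1 then do
      charge 1
      pure b
    else
      match b.drop (b.length / 2) with
      | [] => pure []
      | x :: _ => do
        charge 1
        let j ← search (fun y => decide (y < x)) a
        let q ← par (merge (b.take (b.length / 2)) (a.take j))
          (merge (b.drop (b.length / 2)) (a.drop j))
        pure (q.1 ++ q.2)
  else
    if a.length ≤ 1 then do
      charge 1
      match a, b with
      | [x], [y] => pure (if x ≤ y then [x, y] else [y, x])
      | a, _ => pure a
    else
      match a.drop (a.length / 2) with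
      | [] => pure []
      | x :: _ => do
        charge 1
        let j ← search (fun y => decide (y < x)) b
        let q ← par (merge (a.take (a.length / 2)) (b.take j))
          (merge (a.drop (a.length / 2)) (b.drop j))
        pure (q.1 ++ q.2)
termination_by a.length + b.length
decreasing_by all_goals simp only [List.length_take, List.length_drop]; omega

/-- Parallel merge sort. -/
def mergeSort (l : List α) : Cost (List α) :=
  if l.length ≤ 1 then do
    charge 1
    pure l
  else do
    let q ← par (mergeSort (l.take (l.length / 2))) (mergeSort (l.drop (l.length / 2)))
    merge q.1 q.2
termination_by l.length
decreasing_by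
  · simp only [List.length_take]; omega
  · simp only [List.length_drop]; omega

end Arrays

/-! ## Augmented, balanced, purely functional search trees (AVL trees with `join`) -/

/-- The weight that a value contributes to the augmented sums. -/
class Weight (V : Type) where
  wt : V → ℕ

/-- A binary search tree with key-value pairs at its nodes.  A node also stores the height `h` of its
subtree and the sum `s` of the weights in it. -/
inductive Tree (K V : Type) : Type
  | leaf : Tree K V
  | node (h s : ℕ) (l : Tree K V) (k : K) (v : V) (r : Tree K V) : Tree K V

namespace Tree

variable {K V : Type}

/-- The stored height. -/
def height : Tree K V → ℕ
  | leaf => 0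
  | node h _ _ _ _ _ => h

/-- The stored augmented sum. -/
def aug : Tree K V → ℕ
  | leaf => 0
  | node _ s _ _ _ _ => s

def isLeaf : Tree K V → Bool
  | leaf => true
  | node _ _ _ _ _ _ => false

/-- The entries in order. -/
def toList : Tree K V → List (K × V)
  | leaf => []
  | node _ _ l k v r => l.toList ++ (k, v) :: r.toList

def keys (t : Tree K V) : List K := t.toList.map Prod.fst

variable [Weight V]

/-- The stored fields are right and the tree is height-balanced. -/
def Balanced : Tree K V → Prop
  | leaf => True
  | node h s l _ v r =>
    h = max l.height r.height + 1 ∧ s = l.aug + Weight.wt v + r.aug ∧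
    l.height ≤ r.height + 1 ∧ r.height ≤ l.height + 1 ∧ l.Balanced ∧ r.Balanced

/-- Allocates a node. -/
def mk (l : Tree K V) (k : K) (v : V) (r : Tree K V) : Cost (Tree K V) := do
  charge 1
  pure (node (max l.height r.height + 1) (l.aug + Weight.wt v + r.aug) l k v r)

def rotateLeft : Tree K V → Cost (Tree K V)
  | node _ _ l k v (node _ _ rl rk rv rr) => do
    let t ← mk l k v rl
    mk t rk rv rr
  | t => pure t

def rotateRight : Tree K V → Cost (Tree K V)
  | node _ _ (node _ _ ll lk lv lr) k v r => do
    let t ← mk lr k v r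
    mk ll lk lv t
  | t => pure t

/-- `join` when the left tree is the higher one. -/
def joinRight : Tree K V → K → V → Tree K V → Cost (Tree K V)
  | leaf, k, v, r => mk leaf k v r
  | node _ _ l k' v' c, k, v, r => do
    charge 1
    if c.height ≤ r.height + 1 then do
      let t ← mk c k v r
      if t.height ≤ l.height + 1 then
        mk l k' v' t
      else do
        let t1 ← rotateRight t
        let t2 ← mk l k' v' t1
        rotateLeft t2
    else do
      let t ← joinRight c k v r
      let t1 ← mk l k' v' t
      if t.height ≤ l.height + 1 then pure t1 else rotateLeft t1

/-- `join` when the right tree is the higher one. -/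
def joinLeft (l : Tree K V) (k : K) (v : V) : Tree K V → Cost (Tree K V)
  | leaf => mk l k v leaf
  | node _ _ c k' v' r => do
    charge 1
    if c.height ≤ l.height + 1 then do
      let t ← mk l k v c
      if t.height ≤ r.height + 1 then
        mk t k' v' r
      else do
        let t1 ← rotateLeft t
        let t2 ← mk t1 k' v' r
        rotateRight t2
    else do
      let t ← joinLeft l k v c
      let t1 ← mk t k' v' r
      if t.height ≤ r.height + 1 then pure t1 else rotateRight t1

/-- Joins `l`, the entry `(k, v)` and `r`, in this order of keys, to a balanced tree. -/
def join (l : Tree K V) (k : K) (v : V) (r : Tree K V) : Cost (Tree K V) := do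
  charge 1
  if r.height + 1 < l.height then joinRight l k v r
  else if l.height + 1 < r.height then joinLeft l k v r
  else mk l k v r

/-- Detaches the last entry of the tree with root entry `(k, v)` and subtrees `l`, `r`. -/
def splitLast (l : Tree K V) (k : K) (v : V) : Tree K V → Cost (Tree K V × K × V)
  | leaf => do
    charge 1
    pure (l, k, v)
  | node _ _ rl rk rv rr => do
    charge 1
    let q ← splitLast rl rk rv rr
    let t ← join l k v q.1
    pure (t, q.2)

/-- Builds a tree from an array that is sorted by key. -/
def build (l : List (K × V)) : Cost (Tree K V) :=
  match hd : l.drop (l.length / 2) with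
  | [] => do
    charge 1
    pure leaf
  | x :: r => do
    charge 1
    let q ← par (build (l.take (l.length / 2))) (build r)
    mk q.1 x.1 x.2 q.2
termination_by l.length
decreasing_by
  · have := congrArg List.length hd
    simp only [List.length_drop, List.length_cons] at this
    simp only [List.length_take]; omega
  · have := congrArg List.length hd
    simp only [List.length_drop, List.length_cons] at this; omega

/-- The smallest key (`best` if there is none). -/
def smallest (best : Option K) : Tree K V → Cost (Option K)
  | leaf => do
    charge 1
    pure best
  | node _ _ l k _ _ => do
    charge 1
    smallest (some k) l

variable [LinearOrder K]

/-- The entry with the largest key `≤ x` (`best` if there is none). -/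
def findLE (x : K) (best : Option (K × V)) : Tree K V → Cost (Option (K × V))
  | leaf => do
    charge 1
    pure best
  | node _ _ l k v r => do
    charge 1
    if x < k then findLE x best l else findLE x (some (k, v)) r

/-- The entries below `x`, the value at `x` if there is one, and the entries above `x`. -/
def split (x : K) : Tree K V → Cost (Tree K V × Option V × Tree K V)
  | leaf => do
    charge 1
    pure (leaf, none, leaf)
  | node _ _ l k v r => do
    charge 1
    if x < k then do
      let q ← split x l
      let t ← join q.2.2 k v r
      pure (q.1, q.2.1, t)
    else if k < x then do
      let q ← split x r
      let t ← join l k v q.1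
      pure (t, q.2.1, q.2.2)
    else
      pure (l, some v, r)

/-- Union; the values `old` and `new` of a common key are combined to `f old new`. -/
def unionWith (f : V → V → Cost V) (t : Tree K V) : Tree K V → Cost (Tree K V)
  | leaf => do
    charge 1
    pure t
  | node h s l k v r => do
    charge 1
    if t.isLeaf then
      pure (node h s l k v r)
    else do
      let p ← split k t
      let w ← match p.2.1 with
        | none => pure v
        | some old => f old v
      let q ← par (unionWith f p.1 l) (unionWith f p.2.2 r)
      join q.1 k w q.2

/-- Inserts an array of entries, sorted by key, into `t`: builds a tree over the array and takes the
union. -/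
def multiInsert (f : V → V → Cost V) (t : Tree K V) (l : List (K × V)) : Cost (Tree K V) := do
  let t2 ← build l
  unionWith f t t2

end Tree

/-! ## C-trees -/

/-- A node of the tree of a C-tree stands for its head and the elements of its tail. -/
instance (K : Type) : Weight (List K) := ⟨fun l => l.length + 1⟩

/-- A C-tree: a tree that maps heads to their tails, and a chunk `pre` with the elements in front of
the first head. -/
structure CTree (K : Type) where
  tree : Tree K (List K)
  pre : List K

/-- The weight of a C-tree is the number of its elements. -/
instance (K : Type) : Weight (CTree K) := ⟨fun c => c.tree.aug + c.pre.length⟩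

namespace CTree

variable {K : Type}

/-- The elements, in order. -/
def elems (c : CTree K) : List K :=
  c.pre ++ c.tree.toList.flatMap fun p => p.1 :: p.2

variable [LinearOrder K]

/-- `c` is a C-tree over the set `S` for the given choice of heads.  As the sequence of elements is
increasing, keys are heads and chunks contain none, the keys are exactly the heads in `S`, the tail
of `e` consists of the elements between `e` and the next head, and `pre` of the elements in front of
the first head. -/
structure Represents (isHead : K → Bool) (c : CTree K) (S : Finset K) : Prop where
  balanced : c.tree.Balanced
  increasing : c.elems.Pairwise (· < ·)
  elems_eq : c.elems.toFinset = S
  heads : ∀ p ∈ c.tree.toList, isHead p.1 = true ∧ ∀ x ∈ p.2, isHead x = false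
  pre_tail : ∀ x ∈ c.pre, isHead x = false

/-! ### Chunks (processed sequentially) -/

/-- The elements in front of the first head. -/
def scanTail (isHead : K → Bool) : List K → Cost (List K)
  | [] => do
    charge 1
    pure []
  | x :: l => do
    charge 1
    if isHead x then pure []
    else do
      let t ← scanTail isHead l
      pure (x :: t)

/-- The elements below and the elements above `k`. -/
def splitChunk (k : K) : List K → Cost (List K × List K)
  | [] => do
    charge 1
    pure ([], [])
  | x :: l => do
    charge 1
    if x < k then do
      let q ← splitChunk k l
      pure (x :: q.1, q.2)
    else if x = k then pure ([], l)
    else pure ([], x :: l)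

/-- `splitChunk` at `k`, where `none` is larger than all elements. -/
def splitChunkAt : Option K → List K → Cost (List K × List K)
  | none, l => do
    charge 1
    pure (l, [])
  | some k, l => splitChunk k l

def unionChunk : List K → List K → Cost (List K)
  | [], b => do
    charge (b.length + 1)
    pure b
  | x :: a, [] => do
    charge (a.length + 2)
    pure (x :: a)
  | x :: a, y :: b => do
    charge 1
    if x < y then do
      let l ← unionChunk a (y :: b)
      pure (x :: l)
    else if y < x then do
      let l ← unionChunk (x :: a) b
      pure (y :: l)
    else do
      let l ← unionChunk a b
      pure (x :: l)
termination_by a b => a.length + b.length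

/-- The elements of the first chunk that are not in the second one. -/
def diffChunk : List K → List K → Cost (List K)
  | [], _ => do
    charge 1
    pure []
  | x :: a, [] => do
    charge (a.length + 2)
    pure (x :: a)
  | x :: a, y :: b => do
    charge 1
    if x < y then do
      let l ← diffChunk a (y :: b)
      pure (x :: l)
    else if y < x then
      diffChunk (x :: a) b
    else
      diffChunk a b
termination_by a b => a.length + b.length

def appendChunk (a b : List K) : Cost (List K) := do
  charge (a.length + b.length + 1)
  pure (a ++ b)

/-! ### Operations on C-trees -/

/-- Builds a C-tree from an increasing array. -/
def build (isHead : K → Bool) (l : List K) : Cost (CTree K) := do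
  let ix ← parMap (fun p => pure p) l.zipIdx
  let hs ← filterPar (fun p => isHead p.1) ix
  let entries ← parMap (fun p => do
    let t ← scanTail isHead (l.drop (p.2 + 1))
    pure (p.1, t)) hs
  let pre ← scanTail isHead l
  let t ← Tree.build entries
  pure ⟨t, pre⟩

/-- `split` for C-trees without `pre`.  The last entry of a tail is read in constant time. -/
def splitTree (k : K) : Tree K (List K) → Cost (CTree K × CTree K)
  | .leaf => do
    charge 1
    pure (⟨.leaf, []⟩, ⟨.leaf, []⟩)
  | .node _ _ l h v r => do
    charge 1
    if k < h then do
      let q ← splitTree k l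
      let t ← Tree.join q.2.tree h v r
      pure (q.1, ⟨t, q.2.pre⟩)
    else if h < k then
      if v.getLast?.any (fun e => decide (k ≤ e)) then do
        let w ← splitChunk k v
        let t ← Tree.join l h w.1 .leaf
        pure (⟨t, []⟩, ⟨r, w.2⟩)
      else do
        let q ← splitTree k r
        let t ← Tree.join l h v q.1.tree
        pure (⟨t, q.1.pre⟩, q.2)
    else
      pure (⟨l, []⟩, ⟨r, v⟩)

/-- C-trees with the elements of `c` below `k` and above `k`. -/
def split (c : CTree K) (k : K) : Cost (CTree K × CTree K) := do
  charge 1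
  if c.pre.getLast?.any (fun e => decide (k ≤ e)) then do
    let w ← splitChunk k c.pre
    pure (⟨.leaf, w.1⟩, ⟨c.tree, w.2⟩)
  else do
    let q ← splitTree k c.tree
    pure (⟨q.1.tree, c.pre⟩, q.2)

/-- Cuts an increasing sequence of elements, each of them given with its head and the tail of this
head, into the ranges of elements with the same head. -/
def keyRanges : List (Option (K × List K) × K) → Cost (List ((K × List K) × List K))
  | [] => do
    charge 1
    pure []
  | (none, _) :: l => do
    charge 1
    keyRanges l
  | (some h, e) :: l => do
    charge 1
    let rs ← keyRanges l
    match rs with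
    | [] => pure [(h, [e])]
    | (g, es) :: rest =>
      if h.1 = g.1 then pure ((h, e :: es) :: rest) else pure ((h, [e]) :: (g, es) :: rest)

/-- Applies a chunk `p` without heads to `c`, where `op` is union or difference of chunks: every
element of `p` is sent to the chunk of `c` that it belongs to, and the chunks concerned are updated
by `op`. -/
def updateBC (op : List K → List K → Cost (List K)) (p : List K) (c : CTree K) :
    Cost (CTree K) := do
  let s ← Tree.smallest none c.tree
  let q ← splitChunkAt s p
  let keyed ← parMap (fun e => do
    let h ← Tree.findLE e none c.tree
    pure (h, e)) q.2
  let ranges ← keyRanges keyed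
  let updates ← parMap (fun r => do
    let v ← op r.1.2 r.2
    pure (r.1.1, v)) ranges
  let t ← Tree.multiInsert (fun _ v => pure v) c.tree updates
  let pre ← op c.pre q.1
  pure ⟨t, pre⟩

/-- The union of a chunk without heads and a C-tree. -/
def unionBC (p : List K) (c : CTree K) : Cost (CTree K) := do
  charge 1
  if p.isEmpty then pure c else updateBC unionChunk p c

/-- The difference of a C-tree and a chunk without heads. -/
def diffBC (c : CTree K) (p : List K) : Cost (CTree K) := do
  charge 1
  if p.isEmpty then pure c else updateBC diffChunk p c

/-- The union of `c` and the C-tree with the tree and `pre` given by the last two arguments. -/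
def unionAux (c : CTree K) : Tree K (List K) → List K → Cost (CTree K)
  | .leaf, p2 => do
    charge 1
    if c.tree.isLeaf then unionBC c.pre ⟨.leaf, p2⟩ else unionBC p2 c
  | .node h s l2 k2 v2 r2, p2 => do
    charge 1
    if c.tree.isLeaf then
      unionBC c.pre ⟨.node h s l2 k2 v2 r2, p2⟩
    else do
      let b ← split c k2
      let sb ← Tree.smallest none b.2.tree
      let v ← splitChunkAt sb v2
      let sr ← Tree.smallest none r2
      let p ← splitChunkAt sr b.2.pre
      let w ← unionChunk v.1 p.1
      let q ← par (unionAux b.1 l2 p2) (unionAux ⟨b.2.tree, p.2⟩ r2 v.2)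
      let t ← Tree.join q.1.tree k2 w q.2.tree
      pure ⟨t, q.1.pre⟩

def union (c1 c2 : CTree K) : Cost (CTree K) := unionAux c1 c2.tree c2.pre

/-- Concatenates two C-trees if all elements of `c1` are smaller than all elements of `c2`. -/
def join2 (c1 c2 : CTree K) : Cost (CTree K) :=
  match c1.tree with
  | .leaf => do
    let p ← appendChunk c1.pre c2.pre
    pure ⟨c2.tree, p⟩
  | .node _ _ l k v r => do
    let q ← Tree.splitLast l k v r
    let w ← appendChunk q.2.2 c2.pre
    let t ← Tree.join q.1 q.2.1 w c2.tree
    pure ⟨t, c1.pre⟩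

/-- The difference of `c` and the C-tree with the tree and `pre` given by the last two arguments. -/
def diffAux (c : CTree K) : Tree K (List K) → List K → Cost (CTree K)
  | .leaf, p2 => diffBC c p2
  | .node _ _ l2 k2 v2 r2, p2 => do
    charge 1
    if c.tree.isLeaf && c.pre.isEmpty then
      pure c
    else do
      let b ← split c k2
      let q ← par (diffAux b.1 l2 p2) (diffAux b.2 r2 v2)
      join2 q.1 q.2

def diff (c1 c2 : CTree K) : Cost (CTree K) := diffAux c1 c2.tree c2.pre

end CTree

/-! ## Graphs as trees of C-trees -/

/-- A vertex-tree over the vertices `0, …, n - 1`; the value of a vertex is its edge-tree. The weights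
make it store the numbers of edges in its subtrees. -/
abbrev GraphTree (n : ℕ) : Type := Tree (Fin n) (CTree (Fin n))

/-- `t` is a tree of C-trees for the graph with vertices `0, …, n - 1` and directed edges `E`. -/
structure GraphTree.Represents {n : ℕ} (isHead : Fin n → Bool) (t : GraphTree n)
    (E : Finset (Fin n × Fin n)) : Prop where
  balanced : Tree.Balanced t
  increasing : (Tree.keys t).Pairwise (· < ·)
  vertices : ∀ u, u ∈ Tree.keys t
  edges : ∀ p ∈ Tree.toList t, p.2.Represents isHead {v | (p.1, v) ∈ E}

/-- Sorts the batch, drops repetitions, and builds, for each source in the batch, a C-tree over the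
targets of its edges in the batch. -/
def batchTrees {n : ℕ} (isHead : Fin n → Bool) (A : List (Fin n × Fin n)) :
    Cost (List (Fin n × CTree (Fin n))) := do
  let lex ← parMap (fun e => pure (toLex e)) A
  let sorted ← mergeSort lex
  let batch ← dedupPar sorted
  let sources ← parMap (fun e => pure (ofLex e).1) batch
  let ids ← dedupPar sources
  parMap (fun u => do
    let i ← search (fun e => decide ((ofLex e).1 < u)) batch
    let j ← search (fun e => decide ((ofLex e).1 ≤ u)) batch
    let targets ← parMap (fun e => pure (ofLex e).2) ((batch.drop i).take (j - i))
    let c ← CTree.build isHead targets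
    pure (u, c)) ids

/-- Inserts a batch of directed edges. -/
def insertEdges {n : ℕ} (isHead : Fin n → Bool) (t : GraphTree n) (A : List (Fin n × Fin n)) :
    Cost (GraphTree n) := do
  let upd ← batchTrees isHead A
  Tree.multiInsert CTree.union t upd

/-- Deletes a batch of directed edges; vertices are kept. -/
def deleteEdges {n : ℕ} (isHead : Fin n → Bool) (t : GraphTree n) (A : List (Fin n × Fin n)) :
    Cost (GraphTree n) := do
  let upd ← batchTrees isHead A
  Tree.multiInsert CTree.diff t upd

/-! ## Random hash functions -/

/-- Hash functions on the vertices, with range `{1, …, N}`. -/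
abbrev Hash (n N : ℕ) : Type := Fin n → Finset.Icc 1 N

/-- The heads that a hash function selects, for the chunking parameter `b`. -/
def Hash.isHead {n N : ℕ} (b : ℕ) (h : Hash n N) (v : Fin n) : Bool :=
  decide ((h v : ℕ) % b = 0)

open Classical in
/-- The probability of an event for a uniformly random hash function. -/
noncomputable def hashProb {n N : ℕ} (P : Hash n N → Prop) : ℝ :=
  (#{h : Hash n N | P h} : ℝ) / Fintype.card (Hash n N)

/-- The expectation of a random variable for a uniformly random hash function. -/
noncomputable def hashExp {n N : ℕ} (X : Hash n N → ℝ) : ℝ :=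
  (∑ h : Hash n N, X h) / Fintype.card (Hash n N)

/-- The cost `R h` of an update of a batch of size `k` is within the bounds: expected work at most
`C * k * log n` and, with probability at least `1 - 1 / n ^ c`, both work at most `C * k * log n` and
depth at most `C * (log n) ^ 3`. -/
def WithinBounds {n N : ℕ} {α : Type} (C : ℝ) (c k : ℕ) (R : Hash n N → Cost α) : Prop :=
  hashExp (fun h => ((R h).work : ℝ)) ≤ C * (k * Real.log n) ∧
  1 - 1 / (n : ℝ) ^ c ≤ hashProb fun h =>
    ((R h).work : ℝ) ≤ C * (k * Real.log n) ∧ ((R h).depth : ℝ) ≤ C * Real.log n ^ 3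

end CTreeGraph

/-!
# Batch updates of a tree of C-trees

**Correctness** is independent of the choice of heads. `Tree.unionWith_spec` describes the entries of
a union of balanced search trees, and `CTree.unionAux_spec`, `CTree.diffAux_spec` show that union and
difference of C-trees yield C-trees over the union and the difference of the sets; together they give
`represents_insertEdges` and `represents_deleteEdges`.

**Cost.** Let `H` be the maximal height of a balanced search tree over the vertices, `H = O(log n)`.
All operations on trees reduce to `join`, whose work is proportional to the difference of two heights
(`Tree.work_join_le`); by telescoping, `split` costs `O(H)`. If all chunks have at most `L` elements,
then union and difference of C-trees have work `O((L + H) * m)`, where `m` is the size of the *second*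
C-tree, and depth `O(H * (L + H))`. For the work, every recursive call is charged to
`CTree.potential`, which is additive along the recursion with one unit left per node, and which is
linear in the number of elements. Summing over the sources of a batch of `k` edges, and adding the
costs of sorting and of the vertex-tree, gives work `O(k * (L + H + log k))` (`workBound`) and depth
`O((log k)^3 + log k * H * (L + H))` (`depthBound`).

Difference concatenates chunks, so its intermediate chunks need not be parts of the given ones. They
are however runs of elements that are not heads in the *result* (`CTree.chunksLE_of_runsLE`).
Therefore it suffices that in each of the sets `E_u`, `A_u` and `E_u \ A_u` of targets of `u` no more
than `L` elements in a row fail to be heads (`ShortRuns`).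

**Probability.** A vertex is a head with probability at least `1 / (2 * b)`, independently of the
others, so `m` given vertices all fail to be heads with probability at most `exp (-m / (2 * b))`
(`hashProb_nonheads_le_exp`). A union bound over the `3 * n` sets and the `n * n` intervals shows that
`L = O(log n)` suffices with probability at least `1 - n ^ (-(c + 1))`
(`hashProb_not_shortRuns_runBound_le`). Since `L = n` always suffices, the exceptional hash functions
contribute only `O(k)` to the expected work (`withinBounds_of_shortRuns`).
-/

namespace CTreeGraph

open Cost

/-! ### Costs -/

namespace Cost

variable {α β : Type}

@[simp] theorem val_pure (a : α) : (pure a : Cost α).val = a := rfl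
@[simp] theorem work_pure (a : α) : (pure a : Cost α).work = 0 := rfl
@[simp] theorem depth_pure (a : α) : (pure a : Cost α).depth = 0 := rfl
@[simp] theorem val_bind (x : Cost α) (f : α → Cost β) : (x >>= f).val = (f x.val).val := rfl
@[simp] theorem work_bind (x : Cost α) (f : α → Cost β) :
    (x >>= f).work = x.work + (f x.val).work := rfl
@[simp] theorem depth_bind (x : Cost α) (f : α → Cost β) :
    (x >>= f).depth = x.depth + (f x.val).depth := rfl
@[simp] theorem work_charge (m : ℕ) : (charge m).work = m := rfl
@[simp] theorem depth_charge (m : ℕ) : (charge m).depth = m := rfl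
@[simp] theorem val_par (x : Cost α) (y : Cost β) : (par x y).val = (x.val, y.val) := rfl
@[simp] theorem work_par (x : Cost α) (y : Cost β) : (par x y).work = x.work + y.work + 1 := rfl
@[simp] theorem depth_par (x : Cost α) (y : Cost β) :
    (par x y).depth = max x.depth y.depth + 1 := rfl
@[simp] theorem val_parMap (f : α → Cost β) (l : List α) :
    (parMap f l).val = l.map fun x => (f x).val := rfl
@[simp] theorem work_parMap (f : α → Cost β) (l : List α) :
    (parMap f l).work = (l.map fun x => (f x).work + 2).sum := rfl

theorem work_parMap_le {f : α → Cost β} {l : List α} {m : ℕ} (h : ∀ x ∈ l, (f x).work ≤ m) :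
    (parMap f l).work ≤ l.length * (m + 2) := by
  have := List.sum_le_card_nsmul (l.map fun x => (f x).work + 2) (m + 2) (by
    intro y hy
    obtain ⟨x, hx, rfl⟩ := List.mem_map.1 hy
    have := h x hx
    omega)
  simpa using this

theorem depth_parMap_le {f : α → Cost β} {l : List α} {m : ℕ} (h : ∀ x ∈ l, (f x).depth ≤ m) :
    (parMap f l).depth ≤ m + Nat.size l.length + 1 := by
  have : (l.map fun x => (f x).depth).foldr max 0 ≤ m := by
    induction l with
    | nil => simp
    | cons a l ih =>
      simp only [List.map_cons, List.foldr_cons]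
      exact max_le (h a (by simp)) (ih fun x hx => h x (by simp [hx]))
  simp only [parMap]
  omega

end Cost

/-! ### Binary logarithms -/

/-- Halving a number shortens its binary expansion. -/
theorem size_le_of_two_mul_le {m l : ℕ} (hl : 0 < l) (h : 2 * m ≤ l) : m.size + 1 ≤ l.size := by
  rw [Nat.succ_le_iff, Nat.lt_size]
  rcases Nat.eq_zero_or_pos m with rfl | hm
  · simpa [Nat.lt_iff_add_one_le] using hl
  · have : 2 ^ (m.size - 1) ≤ m := Nat.lt_size.1 (by have := Nat.size_pos.2 hm; omega)
    have h2 : 2 ^ m.size = 2 * 2 ^ (m.size - 1) := by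
      have := Nat.size_pos.2 hm
      conv_lhs => rw [show m.size = (m.size - 1) + 1 by omega, pow_succ]
      ring
    omega

theorem size_le_self (m : ℕ) : m.size ≤ m := Nat.size_le.2 Nat.lt_two_pow_self

theorem clog_half_lt {m l : ℕ} (hl : 2 ≤ l) (h : m ≤ l - l / 2) :
    Nat.clog 2 m + 1 ≤ Nat.clog 2 l := by
  rw [Nat.clog_of_two_le (by norm_num) hl]
  have := Nat.clog_mono_right 2 (show m ≤ (l + 2 - 1) / 2 by omega)
  omega

theorem clog_le_size (m : ℕ) : Nat.clog 2 m ≤ m.size :=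
  Nat.clog_le_of_le_pow (Nat.lt_size_self m).le

theorem size_le_of_le_pow {k n a : ℕ} (h : k ≤ n ^ a) : k.size ≤ a * n.size + 1 := by
  rw [Nat.size_le]
  calc k ≤ n ^ a := h
    _ ≤ (2 ^ n.size) ^ a := Nat.pow_le_pow_left (Nat.lt_size_self n).le a
    _ = 2 ^ (a * n.size) := by rw [← pow_mul, mul_comm]
    _ < 2 ^ (a * n.size + 1) := Nat.pow_lt_pow_right (by norm_num) (by omega)

/-! ### Arrays -/

section Arrays

variable {α : Type}

/-- The value of `pack`, computed from left to right. -/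
def packList (keep : Option α → α → Bool) : Option α → List α → List α
  | _, [] => []
  | p, x :: l => if keep p x then x :: packList keep (some x) l else packList keep (some x) l

theorem packList_append (keep : Option α → α → Bool) (a b : List α) (p : Option α) :
    packList keep p (a ++ b) = packList keep p a ++ packList keep (a.getLast?.or p) b := by
  induction a generalizing p with
  | nil => simp [packList]
  | cons x a ih =>
    have : ((x :: a).getLast?.or p) = a.getLast?.or (some x) := by
      rw [List.getLast?_cons]; cases a.getLast? <;> simp
    rw [this, List.cons_append, packList, packList, ih]
    split_ifs <;> simp

theorem val_pack (keep : Option α → α → Bool) (p : Option α) (l : List α) :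
    (pack keep p l).val = packList keep p l := by
  fun_induction pack keep p l with
  | case1 p l h =>
    match l, h with
    | [], _ => simp [packList]
    | [x], _ => simp [packList, List.filter]; split <;> simp_all
  | case2 p l h ih1 ih2 =>
    simp only [val_bind, val_par, val_pure, ih1, ih2]
    conv_rhs => rw [← List.take_append_drop (l.length / 2) l, packList_append]
    have h1 : (l.take (l.length / 2)).getLast? = l[l.length / 2 - 1]? := by
      rw [List.getLast?_eq_getElem?, List.length_take, List.getElem?_take_of_lt (by omega),
        min_eq_left (by omega)]
    rw [h1, List.getElem?_eq_getElem (by omega)]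
    simp

theorem work_pack_le (keep : Option α → α → Bool) (p : Option α) (l : List α) :
    (pack keep p l).work ≤ 5 * l.length + 2 := by
  -- an array with an entry leaves three units to spare, and these pay for the next fork
  have : (pack keep p l).work + 3 * min l.length 1 ≤ 5 * l.length + 2 * (1 - min l.length 1) := by
    fun_induction pack keep p l with
    | case1 p l h => simp only [work_bind, work_charge, work_pure]; omega
    | case2 p l h ih1 ih2 =>
      simp only [List.length_take, List.length_drop] at ih1 ih2
      simp only [work_bind, work_charge, work_pure, work_par]
      omega
  omega

theorem depth_pack_le (keep : Option α → α → Bool) (p : Option α) (l : List α) :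
    (pack keep p l).depth ≤ 3 * Nat.clog 2 l.length + 2 := by
  fun_induction pack keep p l with
  | case1 p l h => simp only [depth_bind, depth_charge, depth_pure]; omega
  | case2 p l h ih1 ih2 =>
    simp only [List.length_take, List.length_drop] at ih1 ih2
    simp only [depth_bind, depth_charge, depth_pure, depth_par]
    have h1 := clog_half_lt (m := min (l.length / 2) l.length) (l := l.length) (by omega) (by omega)
    have h2 := clog_half_lt (m := l.length - l.length / 2) (l := l.length) (by omega) (by omega)
    omega

theorem val_filterPar (keep : α → Bool) (l : List α) :
    (filterPar keep l).val = l.filter keep := by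
  rw [filterPar, val_pack]
  generalize (none : Option α) = p
  induction l generalizing p with
  | nil => rfl
  | cons x l ih => simp [packList, List.filter_cons, ih]

theorem mem_dedupPar [DecidableEq α] {l : List α} {x : α} : x ∈ (dedupPar l).val ↔ x ∈ l := by
  rw [dedupPar, val_pack]
  suffices ∀ p : Option α, (x ∈ packList (fun p x => decide (p ≠ some x)) p l ∨ p = some x ↔
      x ∈ l ∨ p = some x) by simpa using this none
  induction l with
  | nil => simp [packList]
  | cons y l ih =>
    intro p
    have := ih (some y)
    simp only [packList, List.mem_cons]
    split_ifs <;> grind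

theorem pairwise_dedupPar [LinearOrder α] {l : List α} (h : l.Pairwise (· ≤ ·)) :
    (dedupPar l).val.Pairwise (· < ·) := by
  rw [dedupPar, val_pack]
  suffices ∀ p : Option α, (∀ y ∈ p, ∀ x ∈ l, y ≤ x) →
      (packList (fun p x => decide (p ≠ some x)) p l).Pairwise (· < ·) ∧
      ∀ x ∈ packList (fun p x => decide (p ≠ some x)) p l, x ∈ l ∧ ∀ y ∈ p, y < x from
    (this none (by simp)).1
  induction l with
  | nil => simp [packList]
  | cons y l ih =>
    intro p hp
    rw [List.pairwise_cons] at h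
    obtain ⟨h1, h2⟩ := ih h.2 (some y) (by simpa using h.1)
    simp only [packList]
    split_ifs with hy
    · refine ⟨List.pairwise_cons.2 ⟨fun x hx => (h2 x hx).2 y rfl, h1⟩, ?_⟩
      intro x hx
      rcases List.mem_cons.1 hx with rfl | hx
      · refine ⟨by simp, fun z hz => lt_of_le_of_ne (hp z hz x (by simp)) ?_⟩
        rintro rfl
        simp_all
      · refine ⟨by simp [(h2 x hx).1], fun z hz => ?_⟩
        exact (hp z hz y (by simp)).trans_lt ((h2 x hx).2 y rfl)
    · refine ⟨h1, fun x hx => ⟨by simp [(h2 x hx).1], fun z hz => ?_⟩⟩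
      exact (hp z hz y (by simp)).trans_lt ((h2 x hx).2 y rfl)

theorem length_packList_le (keep : Option α → α → Bool) (p : Option α) (l : List α) :
    (packList keep p l).length ≤ l.length := by
  induction l generalizing p with
  | nil => simp [packList]
  | cons x l ih =>
    have := ih (some x)
    simp only [packList]
    split_ifs <;> simp <;> omega

theorem depth_search (q : α → Bool) (l : List α) : (search q l).depth = (search q l).work := by
  fun_induction search q l with
  | case1 l hd => simp
  | case2 l x r hd ih1 ih2 =>
    simp only [work_bind, depth_bind]
    split_ifs <;> simp_all

theorem work_search_le (q : α → Bool) (l : List α) : (search q l).work ≤ l.length.size + 1 := by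
  fun_induction search q l with
  | case1 l hd => simp
  | case2 l x r hd ih1 ih2 =>
    have := congrArg List.length hd
    simp only [List.length_drop, List.length_cons] at this
    have h1 := size_le_of_two_mul_le (m := r.length) (l := l.length) (by omega) (by omega)
    have h2 := size_le_of_two_mul_le (m := (l.take (l.length / 2)).length) (l := l.length)
      (by omega) (by simp; omega)
    simp only [work_bind, work_charge]
    split_ifs
    · simp only [work_bind, work_pure]; omega
    · omega

theorem val_search {q : α → Bool} {l : List α} (h : l.Pairwise fun x y => q y → q x) :
    (search q l).val = (l.takeWhile q).length := by
  fun_induction search q l with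
  | case1 l hd =>
    have := congrArg List.length hd
    simp only [List.length_drop, List.length_nil] at this
    have : l = [] := List.length_eq_zero_iff.1 (by omega)
    simp [this]
  | case2 l x r hd ih2 ih1 =>
    have hl : l = l.take (l.length / 2) ++ x :: r := by rw [← hd, List.take_append_drop]
    rw [hl, List.pairwise_append, List.pairwise_cons] at h
    have hlen := congrArg List.length hd
    simp only [List.length_drop, List.length_cons] at hlen
    simp only [val_bind]
    split_ifs with hq
    · have h1 : (l.take (l.length / 2)).takeWhile q = l.take (l.length / 2) :=
        List.takeWhile_eq_self_iff.2 fun y hy => h.2.2 y hy x (by simp) hq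
      simp only [val_bind, val_pure, ih2 h.2.1.2]
      conv_rhs => rw [hl, List.takeWhile_append, h1]
      simp [hq]
      omega
    · rw [ih1 h.1]
      conv_rhs => rw [hl, List.takeWhile_append]
      split_ifs with h2
      · simp [hq, h2]
      · rfl

/-- Binary search cuts an array behind the entries with `q` if these come first. -/
theorem take_search {q : α → Bool} {l : List α} (h : l.Pairwise fun x y => q y → q x) :
    l.take (search q l).val = l.filter q ∧ l.drop (search q l).val = l.filter (fun x => !q x) := by
  rw [val_search h]
  induction l with
  | nil => simp
  | cons x l ih =>
    rw [List.pairwise_cons] at h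
    by_cases hx : q x
    · simpa [hx] using ih h.2
    · have : ∀ y ∈ l, q y = false := fun y hy => by
        by_contra hy'
        exact hx (h.1 y hy (by simpa using hy'))
      simp [hx]
      exact ⟨this, Eq.symm (List.filter_eq_self.2 (by simpa using this))⟩

end Arrays

/-! ### Parallel merging and sorting -/

section Sorting

variable {α : Type} [LinearOrder α]

omit [LinearOrder α] in
theorem perm_take_drop (a b : List α) (i j : ℕ) :
    ((a.take i ++ b.take j) ++ (a.drop i ++ b.drop j)).Perm (a ++ b) := by
  conv_rhs => rw [← List.take_append_drop i a, ← List.take_append_drop j b]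
  simp only [List.append_assoc]
  refine List.Perm.append_left _ ?_
  simp only [← List.append_assoc]
  exact List.Perm.append_right _ List.perm_append_comm

theorem perm_merge (a b : List α) : (merge a b).val.Perm (a ++ b) := by
  fun_induction merge a b with
  | case1 a b h1 h2 =>
    obtain rfl : a = [] := List.length_eq_zero_iff.1 (by omega)
    simp
  | case2 a b h1 h2 hd =>
    have := congrArg List.length hd
    simp only [List.length_drop, List.length_nil] at this
    omega
  | case3 a b h1 h2 x r hd ih1 ih2 =>
    simp only [val_bind, val_par, val_pure]
    exact ((ih1 _).append (ih2 _)).trans ((perm_take_drop b a _ _).trans List.perm_append_comm)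
  | case4 a b h1 h2 =>
    simp only [val_bind]
    split
    · simp only [val_pure]
      split_ifs
      · rfl
      · exact List.Perm.swap _ _ _
    · rename_i hab
      have : b = [] := by
        match a, b with
        | _, [] => rfl
        | [], y :: b => simp at h1
        | [x], [y] => exact absurd rfl (hab x y rfl)
        | [x], _ :: _ :: _ => simp at h1
        | _ :: _ :: _, _ => simp at h2
      simp [this]
  | case5 a b h1 h2 hd =>
    have := congrArg List.length hd
    simp only [List.length_drop, List.length_nil] at this
    omega
  | case6 a b h1 h2 x r hd ih1 ih2 =>
    simp only [val_bind, val_par, val_pure]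
    exact ((ih1 _).append (ih2 _)).trans (perm_take_drop a b _ _)

/-- The two halves of a merge step can be concatenated: `x` separates them. -/
theorem pairwise_merge_halves {a b l r : List α} {x : α} {i : ℕ} {s : List α}
    (ha : a.Pairwise (· ≤ ·)) (hb : b.Pairwise (· ≤ ·)) (hd : a.drop i = x :: s)
    (hl : l.Perm (a.take i ++ b.take (search (fun y => decide (y < x)) b).val))
    (hr : r.Perm (a.drop i ++ b.drop (search (fun y => decide (y < x)) b).val))
    (hl' : l.Pairwise (· ≤ ·)) (hr' : r.Pairwise (· ≤ ·)) : (l ++ r).Pairwise (· ≤ ·) := by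
  have hs := take_search (q := fun y => decide (y < x)) (l := b) (hb.imp fun {y z} hyz => by
    simpa using fun hz : z < x => hyz.trans_lt hz)
  rw [hs.1] at hl
  rw [hs.2, hd] at hr
  rw [← List.take_append_drop i a, hd, List.pairwise_append] at ha
  rw [List.pairwise_append]
  refine ⟨hl', hr', fun y hy z hz => ?_⟩
  have h1 : y ≤ x := by
    rcases List.mem_append.1 (hl.mem_iff.1 hy) with hy | hy
    · exact ha.2.2 y hy x (by simp)
    · exact (by simpa using (List.mem_filter.1 hy).2 : y < x).le
  have h2 : x ≤ z := by
    rcases List.mem_append.1 (hr.mem_iff.1 hz) with hz | hz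
    · rcases List.mem_cons.1 hz with rfl | hz
      · rfl
      · exact (List.pairwise_cons.1 ha.2.1).1 z hz
    · simpa using (List.mem_filter.1 hz).2
  exact h1.trans h2

theorem pairwise_merge {a b : List α} (ha : a.Pairwise (· ≤ ·)) (hb : b.Pairwise (· ≤ ·)) :
    (merge a b).val.Pairwise (· ≤ ·) := by
  fun_induction merge a b with
  | case1 a b h1 h2 => simpa using hb
  | case2 a b h1 h2 hd => simp
  | case3 a b h1 h2 x r hd ih1 ih2 =>
    simp only [val_bind, val_par, val_pure]
    exact pairwise_merge_halves hb ha hd (perm_merge _ _) (perm_merge _ _)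
      (ih1 _ (hb.sublist (List.take_sublist _ _)) (ha.sublist (List.take_sublist _ _)))
      (ih2 _ (hb.sublist (List.drop_sublist _ _)) (ha.sublist (List.drop_sublist _ _)))
  | case4 a b h1 h2 =>
    simp only [val_bind]
    split
    · simp only [val_pure]
      split_ifs with h
      · simpa using h
      · simpa using (not_le.1 h).le
    · simpa using ha
  | case5 a b h1 h2 hd => simp
  | case6 a b h1 h2 x r hd ih1 ih2 =>
    simp only [val_bind, val_par, val_pure]
    exact pairwise_merge_halves ha hb hd (perm_merge _ _) (perm_merge _ _)
      (ih1 _ (ha.sublist (List.take_sublist _ _)) (hb.sublist (List.take_sublist _ _)))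
      (ih2 _ (ha.sublist (List.drop_sublist _ _)) (hb.sublist (List.drop_sublist _ _)))

theorem size_le_size_add_three {m n : ℕ} (h : n ≤ 6 * m) : n.size ≤ m.size + 3 := by
  rw [Nat.size_le, pow_add]
  have := Nat.lt_size_self m
  omega

/-- One step of the recurrence for the work of `merge`.  The logarithmic cost of the binary search is
paid by the potential `-size m`: both halves have at least a sixth of the `m` entries. -/
theorem merge_work_step {w1 w2 s p q j : ℕ} (hp : 2 ≤ p) (hq : q ≤ p) (hj : s ≤ q.size + 1)
    (h1 : w1 + (p / 2 + min j q).size + 9 ≤ 12 * (p / 2 + min j q))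
    (h2 : w2 + (p - p / 2 + (q - j)).size + 9 ≤ 12 * (p - p / 2 + (q - j))) :
    1 + (s + (w1 + w2 + 1)) + (p + q).size + 9 ≤ 12 * (p + q) := by
  have e1 := size_le_size_add_three (m := p / 2 + min j q) (n := p + q) (by omega)
  have e2 := size_le_size_add_three (m := p - p / 2 + (q - j)) (n := p + q) (by omega)
  have e3 := Nat.size_le_size (show q ≤ p + q by omega)
  omega

theorem work_merge_le (a b : List α) : (merge a b).work ≤ 12 * (a.length + b.length) + 1 := by
  rcases Nat.eq_zero_or_pos (a.length + b.length) with h | h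
  · have ha : a = [] := List.length_eq_zero_iff.1 (by omega)
    have hb : b = [] := List.length_eq_zero_iff.1 (by omega)
    subst ha hb
    unfold merge
    simp
  suffices (merge a b).work + (a.length + b.length).size + 9 ≤ 12 * (a.length + b.length) by omega
  have small : ∀ m : ℕ, 0 < m → m ≤ 2 → 1 + m.size + 9 ≤ 12 * m := fun m h1 h2 => by
    have := Nat.size_le_size h2
    have : Nat.size 2 = 2 := by decide
    omega
  fun_induction merge a b with
  | case1 a b h1 h2 =>
    simpa using small _ h (by omega)
  | case2 a b h1 h2 hd =>
    have := congrArg List.length hd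
    simp only [List.length_drop, List.length_nil] at this
    omega
  | case3 a b h1 h2 x r hd ih1 ih2 =>
    have e1 := ih1 (search (fun y => decide (y < x)) a).val (by simp; omega)
    have e2 := ih2 (search (fun y => decide (y < x)) a).val (by simp; omega)
    simp only [List.length_take, List.length_drop, min_eq_left (show b.length / 2 ≤ b.length by omega)]
      at e1 e2
    simp only [work_bind, work_charge, work_par, work_pure, add_zero]
    rw [add_comm a.length]
    exact merge_work_step (by omega) h1.le (work_search_le _ _) e1 e2
  | case4 a b h1 h2 =>
    have := small _ h (by omega)
    simp only [work_bind, work_charge]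
    split <;> simpa using this
  | case5 a b h1 h2 hd =>
    have := congrArg List.length hd
    simp only [List.length_drop, List.length_nil] at this
    omega
  | case6 a b h1 h2 x r hd ih1 ih2 =>
    have e1 := ih1 (search (fun y => decide (y < x)) b).val (by simp; omega)
    have e2 := ih2 (search (fun y => decide (y < x)) b).val (by simp; omega)
    simp only [List.length_take, List.length_drop, min_eq_left (show a.length / 2 ≤ a.length by omega)]
      at e1 e2
    simp only [work_bind, work_charge, work_par, work_pure, add_zero]
    exact merge_work_step (by omega) (by omega) (work_search_le _ _) e1 e2

/-- One step of the recurrence for the depth of `merge`: the longer array is halved, and the other one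
does not grow, so that the sum of the two logarithms drops. -/
theorem merge_depth_step {d1 d2 s p q j M : ℕ} (hp : 2 ≤ p) (hqM : q ≤ M)
    (hj : s ≤ q.size + 1)
    (h1 : d1 ≤ (Nat.clog 2 (p / 2) + Nat.clog 2 (min j q)) * (M.size + 3) + 1)
    (h2 : d2 ≤ (Nat.clog 2 (p - p / 2) + Nat.clog 2 (q - j)) * (M.size + 3) + 1) :
    1 + (s + (max d1 d2 + 1)) ≤ (Nat.clog 2 p + Nat.clog 2 q) * (M.size + 3) + 1 := by
  have e1 := clog_half_lt (m := p / 2) hp (by omega)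
  have e2 := clog_half_lt (m := p - p / 2) hp le_rfl
  have e3 := Nat.clog_mono_right 2 (show min j q ≤ q by omega)
  have e4 := Nat.clog_mono_right 2 (show q - j ≤ q by omega)
  have e5 := Nat.size_le_size hqM
  have e6 : max d1 d2 ≤ (Nat.clog 2 p + Nat.clog 2 q - 1) * (M.size + 3) + 1 :=
    max_le (h1.trans (by gcongr; omega)) (h2.trans (by gcongr; omega))
  obtain ⟨c, hc⟩ : ∃ c, Nat.clog 2 p + Nat.clog 2 q = c + 1 := ⟨_, (Nat.sub_add_cancel (by omega)).symm⟩
  rw [hc] at e6 ⊢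
  rw [Nat.add_sub_cancel] at e6
  rw [add_mul, one_mul]
  omega

theorem depth_merge_le {a b : List α} {M : ℕ} (ha : a.length ≤ M) (hb : b.length ≤ M) :
    (merge a b).depth ≤
      (Nat.clog 2 a.length + Nat.clog 2 b.length) * (M.size + 3) + 1 := by
  fun_induction merge a b with
  | case1 a b h1 h2 => simp
  | case2 a b h1 h2 hd => simp
  | case3 a b h1 h2 x r hd ih1 ih2 =>
    have e1 := ih1 (search (fun y => decide (y < x)) a).val (by simp; omega) (by simp; omega)
    have e2 := ih2 (search (fun y => decide (y < x)) a).val (by simp; omega) (by simp; omega)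
    simp only [List.length_take, List.length_drop, min_eq_left (show b.length / 2 ≤ b.length by omega)]
      at e1 e2
    simp only [depth_bind, depth_charge, depth_par, depth_pure, add_zero, depth_search]
    rw [add_comm (Nat.clog 2 a.length)]
    exact merge_depth_step (by omega) ha (work_search_le _ _) e1 e2
  | case4 a b h1 h2 =>
    simp only [depth_bind, depth_charge]
    split <;> simp
  | case5 a b h1 h2 hd => simp
  | case6 a b h1 h2 x r hd ih1 ih2 =>
    have e1 := ih1 (search (fun y => decide (y < x)) b).val (by simp; omega) (by simp; omega)
    have e2 := ih2 (search (fun y => decide (y < x)) b).val (by simp; omega) (by simp; omega)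
    simp only [List.length_take, List.length_drop, min_eq_left (show a.length / 2 ≤ a.length by omega)]
      at e1 e2
    simp only [depth_bind, depth_charge, depth_par, depth_pure, add_zero, depth_search]
    exact merge_depth_step (by omega) hb (work_search_le _ _) e1 e2

theorem perm_mergeSort (l : List α) : (mergeSort l).val.Perm l := by
  fun_induction mergeSort l with
  | case1 l h => simp
  | case2 l h ih1 ih2 =>
    simp only [val_bind, val_par]
    refine (perm_merge _ _).trans ((ih1.append ih2).trans ?_)
    rw [List.take_append_drop]

theorem pairwise_mergeSort (l : List α) : (mergeSort l).val.Pairwise (· ≤ ·) := by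
  fun_induction mergeSort l with
  | case1 l h =>
    match l, h with
    | [], _ => simp
    | [x], _ => simp
  | case2 l h ih1 ih2 => exact pairwise_merge ih1 ih2

theorem work_mergeSort_le (l : List α) :
    (mergeSort l).work ≤ 15 * (l.length * (Nat.clog 2 l.length + 1)) + 1 := by
  suffices (mergeSort l).work ≤ l.length * (15 * Nat.clog 2 l.length + 3) + 1 - 3 * min l.length 1 by
    have h : l.length * (15 * Nat.clog 2 l.length + 3) ≤
        15 * (l.length * (Nat.clog 2 l.length + 1)) := by
      rw [mul_left_comm]; gcongr; omega
    omega
  fun_induction mergeSort l with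
  | case1 l h =>
    simp only [work_bind, work_charge, work_pure]
    have : l.length = 0 ∨ l.length = 1 := by omega
    rcases this with h | h <;> simp [h]
  | case2 l h ih1 ih2 =>
    have hp1 := (perm_mergeSort (l.take (l.length / 2))).length_eq
    have hp2 := (perm_mergeSort (l.drop (l.length / 2))).length_eq
    have hm := work_merge_le (mergeSort (l.take (l.length / 2))).val
      (mergeSort (l.drop (l.length / 2))).val
    simp only [List.length_take, List.length_drop, min_eq_left (show l.length / 2 ≤ l.length by omega)]
      at ih1 ih2 hp1 hp2
    rw [hp1, hp2] at hm
    simp only [work_bind, work_par, val_par]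
    have e1 := clog_half_lt (m := l.length / 2) (l := l.length) (by omega) (by omega)
    have e2 := clog_half_lt (m := l.length - l.length / 2) (l := l.length) (by omega) le_rfl
    obtain ⟨c, hc⟩ : ∃ c, Nat.clog 2 l.length = c + 1 := ⟨_, (Nat.sub_add_cancel (by omega)).symm⟩
    rw [hc] at e1 e2 ⊢
    have f1 : l.length / 2 * (15 * Nat.clog 2 (l.length / 2) + 3) ≤ l.length / 2 * (15 * c + 3) := by
      gcongr; omega
    have f2 : (l.length - l.length / 2) * (15 * Nat.clog 2 (l.length - l.length / 2) + 3) ≤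
        (l.length - l.length / 2) * (15 * c + 3) := by
      gcongr; omega
    have f3 : l.length / 2 * (15 * c + 3) + (l.length - l.length / 2) * (15 * c + 3) =
        l.length * (15 * c + 3) := by
      rw [← add_mul]; congr 1; omega
    have f4 : l.length * (15 * (c + 1) + 3) = l.length * (15 * c + 3) + 15 * l.length := by ring
    omega

theorem depth_mergeSort_le (l : List α) :
    (mergeSort l).depth ≤
      Nat.clog 2 l.length * (2 * l.length.size * (l.length.size + 3) + 2) + 1 := by
  suffices ∀ M, l.length ≤ M → (mergeSort l).depth ≤
      Nat.clog 2 l.length * (2 * M.size * (M.size + 3) + 2) + 1 from this _ le_rfl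
  -- the bound for the merges is kept fixed along the recursion
  intro M hM
  fun_induction mergeSort l with
  | case1 l h => simp
  | case2 l h ih1 ih2 =>
    have hp1 := (perm_mergeSort (l.take (l.length / 2))).length_eq
    have hp2 := (perm_mergeSort (l.drop (l.length / 2))).length_eq
    simp only [List.length_take, List.length_drop, min_eq_left (show l.length / 2 ≤ l.length by omega)]
      at ih1 ih2 hp1 hp2
    have hm := depth_merge_le (a := (mergeSort (l.take (l.length / 2))).val)
      (b := (mergeSort (l.drop (l.length / 2))).val) (M := M) (by omega) (by omega)
    rw [hp1, hp2] at hm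
    have g1 := clog_le_size (l.length / 2)
    have g2 := clog_le_size (l.length - l.length / 2)
    have g3 := Nat.size_le_size (show l.length / 2 ≤ M by omega)
    have g4 := Nat.size_le_size (show l.length - l.length / 2 ≤ M by omega)
    have e1 := clog_half_lt (m := l.length / 2) (l := l.length) (by omega) (by omega)
    have e2 := clog_half_lt (m := l.length - l.length / 2) (l := l.length) (by omega) le_rfl
    obtain ⟨c, hc⟩ : ∃ c, Nat.clog 2 l.length = c + 1 := ⟨_, (Nat.sub_add_cancel (by omega)).symm⟩
    rw [hc] at e1 e2 ⊢
    simp only [depth_bind, depth_par, val_par]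
    have f1 := (ih2 (by omega)).trans (show _ ≤ c * (2 * M.size * (M.size + 3) + 2) + 1 by
      gcongr; omega)
    have f2 := (ih1 (by omega)).trans (show _ ≤ c * (2 * M.size * (M.size + 3) + 2) + 1 by
      gcongr; omega)
    have f3 := hm.trans (show _ ≤ 2 * M.size * (M.size + 3) + 1 by gcongr; omega)
    have f4 : (c + 1) * (2 * M.size * (M.size + 3) + 2) =
      c * (2 * M.size * (M.size + 3) + 2) + (2 * M.size * (M.size + 3) + 2) := by ring
    have := max_le f1 f2
    omega

end Sorting

namespace Tree

variable {K V : Type}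

@[simp] theorem toList_leaf : (leaf : Tree K V).toList = [] := rfl
@[simp] theorem toList_node (h s : ℕ) (l : Tree K V) (k : K) (v : V) (r : Tree K V) :
    (node h s l k v r).toList = l.toList ++ (k, v) :: r.toList := rfl
@[simp] theorem height_leaf : (leaf : Tree K V).height = 0 := rfl
@[simp] theorem height_node (h s : ℕ) (l : Tree K V) (k : K) (v : V) (r : Tree K V) :
    (node h s l k v r).height = h := rfl

theorem isLeaf_iff {t : Tree K V} : t.isLeaf = true ↔ t = leaf := by
  cases t <;> simp [isLeaf]

variable [Weight V]

theorem balanced_leaf : (leaf : Tree K V).Balanced := trivial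

theorem balanced_node {h s : ℕ} {l : Tree K V} {k : K} {v : V} {r : Tree K V} :
    (node h s l k v r).Balanced ↔
    h = max l.height r.height + 1 ∧ s = l.aug + Weight.wt v + r.aug ∧
    l.height ≤ r.height + 1 ∧ r.height ≤ l.height + 1 ∧ l.Balanced ∧ r.Balanced := Iff.rfl

/-- An AVL tree of height `h` has at least `2 ^ (h / 2) - 1` entries. -/
theorem Balanced.two_pow_height_le {t : Tree K V} (h : t.Balanced) :
    2 ^ t.height ≤ (t.toList.length + 1) ^ 2 := by
  induction t with
  | leaf => simp
  | node m s l k v r ihl ihr =>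
    obtain ⟨rfl, -, h1, h2, hl, hr⟩ := h
    have el := ihl hl
    have er := ihr hr
    simp only [height_node, toList_node, List.length_append, List.length_cons]
    set x := l.toList.length + 1
    set y := r.toList.length + 1
    rw [show l.toList.length + (r.toList.length + 1) + 1 = x + y by omega]
    rcases le_total l.height r.height with h | h
    · rw [max_eq_right h, pow_succ]
      have : 2 ^ r.height ≤ 2 * 2 ^ l.height := by
        rw [← pow_succ']; exact Nat.pow_le_pow_right (by norm_num) h2
      rcases le_total x y with hxy | hxy <;> nlinarith
    · rw [max_eq_left h, pow_succ]
      have : 2 ^ l.height ≤ 2 * 2 ^ r.height := by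
        rw [← pow_succ']; exact Nat.pow_le_pow_right (by norm_num) h1
      rcases le_total x y with hxy | hxy <;> nlinarith

theorem Balanced.height_le_length {t : Tree K V} (h : t.Balanced) :
    t.height ≤ t.toList.length := by
  induction t with
  | leaf => simp
  | node m s l k v r ihl ihr =>
    obtain ⟨rfl, -, h1, h2, hl, hr⟩ := h
    have el := ihl hl
    have er := ihr hr
    simp only [height_node, toList_node, List.length_append, List.length_cons]
    omega

/-! ### Joining trees -/

@[simp] theorem val_mk (l : Tree K V) (k : K) (v : V) (r : Tree K V) :
    (mk l k v r).val =
      node (max l.height r.height + 1) (l.aug + Weight.wt v + r.aug) l k v r := rfl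
@[simp] theorem work_mk (l : Tree K V) (k : K) (v : V) (r : Tree K V) : (mk l k v r).work = 1 := rfl
@[simp] theorem depth_mk (l : Tree K V) (k : K) (v : V) (r : Tree K V) :
    (mk l k v r).depth = 1 := rfl

theorem toList_rotateLeft (t : Tree K V) : (rotateLeft t).val.toList = t.toList := by
  unfold rotateLeft; split <;> simp

theorem toList_rotateRight (t : Tree K V) : (rotateRight t).val.toList = t.toList := by
  unfold rotateRight; split <;> simp

theorem work_rotateLeft_le (t : Tree K V) : (rotateLeft t).work ≤ 2 := by
  unfold rotateLeft; split <;> simp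

theorem work_rotateRight_le (t : Tree K V) : (rotateRight t).work ≤ 2 := by
  unfold rotateRight; split <;> simp

theorem depth_rotateLeft (t : Tree K V) : (rotateLeft t).depth = (rotateLeft t).work := by
  unfold rotateLeft; split <;> simp

theorem depth_rotateRight (t : Tree K V) : (rotateRight t).depth = (rotateRight t).work := by
  unfold rotateRight; split <;> simp

theorem toList_joinRight (l : Tree K V) (k : K) (v : V) (r : Tree K V) :
    (joinRight l k v r).val.toList = l.toList ++ (k, v) :: r.toList := by
  induction l with
  | leaf => simp [joinRight]
  | node h s l k' v' c ihl ihc =>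
    simp only [joinRight, val_bind]
    split_ifs <;> simp only [val_bind] <;> split_ifs <;>
      simp [toList_rotateLeft, toList_rotateRight, ihc]

theorem toList_joinLeft (l : Tree K V) (k : K) (v : V) (r : Tree K V) :
    (joinLeft l k v r).val.toList = l.toList ++ (k, v) :: r.toList := by
  induction r with
  | leaf => simp [joinLeft]
  | node h s c k' v' r ihc ihr =>
    simp only [joinLeft, val_bind]
    split_ifs <;> simp only [val_bind] <;> split_ifs <;>
      simp [toList_rotateLeft, toList_rotateRight, ihc]

theorem depth_joinRight (l : Tree K V) (k : K) (v : V) (r : Tree K V) :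
    (joinRight l k v r).depth = (joinRight l k v r).work := by
  induction l with
  | leaf => simp [joinRight]
  | node h s l k' v' c ihl ihc =>
    simp only [joinRight, work_bind, depth_bind]
    split_ifs <;> simp only [work_bind, depth_bind] <;> split_ifs <;>
      simp [depth_rotateLeft, depth_rotateRight, ihc]

theorem depth_joinLeft (l : Tree K V) (k : K) (v : V) (r : Tree K V) :
    (joinLeft l k v r).depth = (joinLeft l k v r).work := by
  induction r with
  | leaf => simp [joinLeft]
  | node h s c k' v' r ihc ihr =>
    simp only [joinLeft, work_bind, depth_bind]
    split_ifs <;> simp only [work_bind, depth_bind] <;> split_ifs <;>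
      simp [depth_rotateLeft, depth_rotateRight, ihc]

theorem work_joinRight_le {l : Tree K V} (hl : l.Balanced) (k : K) (v : V) (r : Tree K V)
    (hr : r.height ≤ l.height) :
    (joinRight l k v r).work + 4 * r.height ≤ 4 * l.height + 7 := by
  induction l with
  | leaf => simp at hr; simp [joinRight, hr]
  | node h s l k' v' c ihl ihc =>
    obtain ⟨rfl, -, h1, h2, hl, hc⟩ := hl
    simp only [height_node] at hr ⊢
    have e1 := fun t : Tree K V => work_rotateLeft_le t
    have e2 := fun t : Tree K V => work_rotateRight_le t
    simp only [joinRight, work_bind, work_charge]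
    split_ifs with h3
    · simp only [work_bind, work_mk]
      split_ifs
      · simp only [work_mk]; omega
      · simp only [work_bind, work_mk]
        have := e1 (mk l k' v' (rotateRight (mk c k v r).val).val).val
        have := e2 (mk c k v r).val
        omega
    · have := ihc hc (by omega)
      simp only [work_bind, work_mk]
      split_ifs
      · simp only [work_pure]; omega
      · have := e1 (mk l k' v' (joinRight c k v r).val).val
        omega

theorem work_joinLeft_le (l : Tree K V) (k : K) (v : V) {r : Tree K V} (hr : r.Balanced)
    (hl : l.height ≤ r.height) :
    (joinLeft l k v r).work + 4 * l.height ≤ 4 * r.height + 7 := by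
  induction r with
  | leaf => simp at hl; simp [joinLeft, hl]
  | node h s c k' v' r ihc ihr =>
    obtain ⟨rfl, -, h1, h2, hc, hr⟩ := hr
    simp only [height_node] at hl ⊢
    have e1 := fun t : Tree K V => work_rotateLeft_le t
    have e2 := fun t : Tree K V => work_rotateRight_le t
    simp only [joinLeft, work_bind, work_charge]
    split_ifs with h3
    · simp only [work_bind, work_mk]
      split_ifs
      · simp only [work_mk]; omega
      · simp only [work_bind, work_mk]
        have := e2 (mk (rotateLeft (mk l k v c).val).val k' v' r).val
        have := e1 (mk l k v c).val
        omega
    · have := ihc hc (by omega)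
      simp only [work_bind, work_mk]
      split_ifs
      · simp only [work_pure]; omega
      · have := e2 (mk (joinLeft l k v c).val k' v' r).val
        omega

/-- If `joinRight` makes the higher tree grow, then the root of the result leans to the right; so a
single rotation repairs the balance one level up. -/
theorem balanced_joinRight {l : Tree K V} (hl : l.Balanced) (k : K) (v : V) {r : Tree K V}
    (hr : r.Balanced) (hlr : r.height + 1 < l.height) :
    ∃ h s l' k' v' r', (joinRight l k v r).val = node h s l' k' v' r' ∧
      (node h s l' k' v' r').Balanced ∧
      (h = l.height ∨ h = l.height + 1 ∧ r'.height = l'.height + 1) := by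
  induction l with
  | leaf => simp at hlr
  | node h s l k' v' c ihl ihc =>
    obtain ⟨rfl, rfl, h1, h2, hl, hc⟩ := hl
    simp only [height_node] at hlr ⊢
    simp only [joinRight, val_bind]
    split_ifs with h3
    · simp only [val_bind]
      split_ifs with h4 <;> simp only [val_mk, height_node] at h4
      · simp only [val_mk]
        refine ⟨_, _, _, _, _, _, rfl, ?_, ?_⟩
        · simp only [balanced_node, height_node, hl, hr, hc, true_and, and_true, Tree.aug]
          omega
        · simp only [height_node]; omega
      · obtain _ | ⟨ch, cs, cl, ck, cv, cr⟩ := c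
        · simp at h4 hlr h3; omega
        · obtain ⟨rfl, rfl, h5, h6, hcl, hcr⟩ := hc
          simp only [height_node] at *
          simp only [val_bind, rotateRight, rotateLeft, val_mk, height_node]
          refine ⟨_, _, _, _, _, _, rfl, ?_, ?_⟩
          · simp only [balanced_node, height_node, hl, hr, hcl, hcr, true_and, and_true, Tree.aug]
            omega
          · simp only [height_node]; omega
    · obtain ⟨th, ts, tl, tk, tv, tr, ht, hb, hgrow⟩ := ihc hc (by omega)
      simp only [val_bind, ht, val_mk, height_node]
      have hb' := hb
      obtain ⟨rfl, rfl, h5, h6, htl, htr⟩ := hb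
      split_ifs with h4
      · refine ⟨_, _, _, _, _, _, rfl, ?_, ?_⟩
        · simp only [balanced_node, height_node, hl, htl, htr, true_and, and_true, Tree.aug]
          omega
        · simp only [height_node]; omega
      · simp only [rotateLeft, val_bind, val_mk, height_node]
        refine ⟨_, _, _, _, _, _, rfl, ?_, ?_⟩
        · simp only [balanced_node, height_node, hl, htl, htr, true_and, and_true, Tree.aug]
          omega
        · simp only [height_node]; omega

theorem balanced_joinLeft {l : Tree K V} (hl : l.Balanced) (k : K) (v : V) {r : Tree K V}
    (hr : r.Balanced) (hlr : l.height + 1 < r.height) :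
    ∃ h s l' k' v' r', (joinLeft l k v r).val = node h s l' k' v' r' ∧
      (node h s l' k' v' r').Balanced ∧
      (h = r.height ∨ h = r.height + 1 ∧ l'.height = r'.height + 1) := by
  induction r with
  | leaf => simp at hlr
  | node h s c k' v' r ihc ihr =>
    obtain ⟨rfl, rfl, h1, h2, hc, hr⟩ := hr
    simp only [height_node] at hlr ⊢
    simp only [joinLeft, val_bind]
    split_ifs with h3
    · simp only [val_bind]
      split_ifs with h4 <;> simp only [val_mk, height_node] at h4
      · simp only [val_mk]
        refine ⟨_, _, _, _, _, _, rfl, ?_, ?_⟩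
        · simp only [balanced_node, height_node, hl, hr, hc, true_and, and_true, Tree.aug]
          omega
        · simp only [height_node]; omega
      · obtain _ | ⟨ch, cs, cl, ck, cv, cr⟩ := c
        · simp at h4 hlr h3; omega
        · obtain ⟨rfl, rfl, h5, h6, hcl, hcr⟩ := hc
          simp only [height_node] at *
          simp only [val_bind, rotateRight, rotateLeft, val_mk, height_node]
          refine ⟨_, _, _, _, _, _, rfl, ?_, ?_⟩
          · simp only [balanced_node, height_node, hl, hr, hcl, hcr, true_and, and_true, Tree.aug]
            omega
          · simp only [height_node]; omega
    · obtain ⟨th, ts, tl, tk, tv, tr, ht, hb, hgrow⟩ := ihc hc (by omega)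
      simp only [val_bind, ht, val_mk, height_node]
      have hb' := hb
      obtain ⟨rfl, rfl, h5, h6, htl, htr⟩ := hb
      split_ifs with h4
      · refine ⟨_, _, _, _, _, _, rfl, ?_, ?_⟩
        · simp only [balanced_node, height_node, hr, htl, htr, true_and, and_true, Tree.aug]
          omega
        · simp only [height_node]; omega
      · simp only [rotateRight, val_bind, val_mk, height_node]
        refine ⟨_, _, _, _, _, _, rfl, ?_, ?_⟩
        · simp only [balanced_node, height_node, hr, htl, htr, true_and, and_true, Tree.aug]
          omega
        · simp only [height_node]; omega

@[simp] theorem toList_join (l : Tree K V) (k : K) (v : V) (r : Tree K V) :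
    (join l k v r).val.toList = l.toList ++ (k, v) :: r.toList := by
  simp only [join, val_bind]
  split_ifs
  · exact toList_joinRight l k v r
  · exact toList_joinLeft l k v r
  · simp

theorem depth_join (l : Tree K V) (k : K) (v : V) (r : Tree K V) :
    (join l k v r).depth = (join l k v r).work := by
  simp only [join, work_bind, depth_bind, work_charge, depth_charge]
  split_ifs
  · rw [depth_joinRight]
  · rw [depth_joinLeft]
  · simp

theorem balanced_join {l : Tree K V} (hl : l.Balanced) (k : K) (v : V) {r : Tree K V}
    (hr : r.Balanced) :
    (join l k v r).val.Balanced ∧ max l.height r.height ≤ (join l k v r).val.height ∧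
      (join l k v r).val.height ≤ max l.height r.height + 1 := by
  simp only [join, val_bind]
  split_ifs
  · obtain ⟨h, s, l', k', v', r', e, hb, hh⟩ := balanced_joinRight hl k v hr (by omega)
    rw [e]
    refine ⟨hb, ?_⟩
    simp only [height_node]; omega
  · obtain ⟨h, s, l', k', v', r', e, hb, hh⟩ := balanced_joinLeft hl k v hr (by omega)
    rw [e]
    refine ⟨hb, ?_⟩
    simp only [height_node]; omega
  · simp only [val_mk, balanced_node, height_node]
    refine ⟨⟨trivial, trivial, ?_, ?_, hl, hr⟩, ?_⟩ <;> omega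

/-- The work of `join` is proportional to the difference of the heights.  Sums of such differences
telescope, which is what makes the operations built from successive joins logarithmic. -/
theorem work_join_le {l : Tree K V} (hl : l.Balanced) (k : K) (v : V) {r : Tree K V}
    (hr : r.Balanced) :
    (join l k v r).work + 4 * min l.height r.height ≤ 4 * max l.height r.height + 8 := by
  simp only [join, work_bind, work_charge]
  split_ifs
  · have := work_joinRight_le hl k v r (by omega)
    omega
  · have := work_joinLeft_le l k v hr (by omega)
    omega
  · simp only [work_mk]; omega

/-- The bound on the work telescopes: each join is paid by the height of its outcome. -/
theorem balanced_splitLast {l : Tree K V} (k : K) (v : V) {r : Tree K V} (hl : l.Balanced)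
    (hr : r.Balanced) (h : r.height ≤ l.height + 1) :
    (splitLast l k v r).val.1.Balanced ∧
    (splitLast l k v r).val.1.height ≤ max l.height r.height + 1 ∧
    (splitLast l k v r).work ≤
      13 * (max l.height r.height + 1) + 4 * (splitLast l k v r).val.1.height := by
  induction r generalizing l k v with
  | leaf =>
    simp only [splitLast, val_bind, val_pure, work_bind, work_charge, work_pure, height_leaf]
    refine ⟨hl, ?_, ?_⟩ <;> omega
  | node m s rl rk rv rr _ ih =>
    obtain ⟨rfl, rfl, h1, h2, hrl, hrr⟩ := hr
    simp only [height_node] at *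
    obtain ⟨i1, i2, i3⟩ := ih rk rv hrl hrr h2
    simp only [splitLast, val_bind, val_pure, work_bind, work_charge, work_pure]
    set q := (splitLast rl rk rv rr).val.1
    obtain ⟨j1, j2, j3⟩ := balanced_join hl k v i1
    have j4 := work_join_le hl k v i1
    refine ⟨j1, ?_, ?_⟩ <;> omega

theorem depth_splitLast (l : Tree K V) (k : K) (v : V) (r : Tree K V) :
    (splitLast l k v r).depth = (splitLast l k v r).work := by
  induction r generalizing l k v with
  | leaf => simp [splitLast]
  | node m s rl rk rv rr _ ih => simp [splitLast, ih, depth_join]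

theorem toList_splitLast (l : Tree K V) (k : K) (v : V) (r : Tree K V) :
    (splitLast l k v r).val.1.toList ++ [(splitLast l k v r).val.2] =
      l.toList ++ (k, v) :: r.toList := by
  induction r generalizing l k v with
  | leaf => simp [splitLast]
  | node m s rl rk rv rr _ ih =>
    simp only [splitLast, val_bind, val_pure, toList_join, toList_node]
    rw [List.append_assoc, List.cons_append, ih]

/-! ### Building trees -/

/-- A tree built from an array of `m` entries has exactly the height `Nat.size m`: the two halves of an
array differ by at most one in length, hence by at most one in `Nat.size`. -/
theorem build_spec (l : List (K × V)) :
    (build l).val.toList = l ∧ (build l).val.Balanced ∧ (build l).val.height = l.length.size ∧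
    (build l).work ≤ 4 * l.length + 1 ∧ (build l).depth ≤ 3 * l.length.size + 1 := by
  fun_induction build l with
  | case1 l hd =>
    have := congrArg List.length hd
    simp only [List.length_drop, List.length_nil] at this
    obtain rfl : l = [] := List.length_eq_zero_iff.1 (by omega)
    simp [Tree.Balanced]
  | case2 l x r hd ih1 ih2 =>
    obtain ⟨a1, a2, a3, a4, a5⟩ := ih1
    obtain ⟨b1, b2, b3, b4, b5⟩ := ih2
    have hlen := congrArg List.length hd
    simp only [List.length_drop, List.length_cons] at hlen
    have ht : (l.take (l.length / 2)).length = l.length / 2 := by simp; omega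
    rw [ht] at a3 a4 a5
    have e1 := size_le_of_two_mul_le (m := l.length / 2) (l := l.length) (by omega) (by omega)
    have e2 : l.length.size ≤ (l.length / 2).size + 1 := by
      rw [Nat.size_le, pow_succ]
      have := Nat.lt_size_self (l.length / 2)
      omega
    have e3 := Nat.size_le_size (show r.length ≤ l.length / 2 by omega)
    have e4 : (l.length / 2).size ≤ r.length.size + 1 := by
      rw [Nat.size_le, pow_succ]
      have := Nat.lt_size_self r.length
      have : 0 < 2 ^ r.length.size := by positivity
      omega
    refine ⟨?_, ?_, ?_, ?_, ?_⟩
    · simp only [val_bind, val_par, val_mk, toList_node, a1, b1]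
      conv_rhs => rw [← List.take_append_drop (l.length / 2) l, hd]
    · simp only [val_bind, val_par, val_mk, balanced_node, a2, b2, a3, b3, and_true, true_and]
      omega
    · simp only [val_bind, val_par, val_mk, height_node, a3, b3]
      omega
    · simp only [work_bind, work_charge, work_par, work_mk]
      omega
    · simp only [depth_bind, depth_charge, depth_par, depth_mk]
      omega

end Tree

namespace Tree

variable {K V : Type}

/-! ### Searching and splitting trees -/

theorem val_smallest (best : Option K) (t : Tree K V) :
    (smallest best t).val = (t.toList.head?.map Prod.fst).or best := by
  induction t generalizing best with
  | leaf => simp [smallest]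
  | node h s l k v r ihl ihr =>
    simp only [smallest, val_bind, ihl, toList_node]
    cases l.toList <;> simp

theorem depth_smallest (best : Option K) (t : Tree K V) :
    (smallest best t).depth = (smallest best t).work := by
  induction t generalizing best with
  | leaf => simp [smallest]
  | node h s l k v r ihl ihr => simp [smallest, ihl]

theorem work_smallest_le [Weight V] (best : Option K) {t : Tree K V} (ht : t.Balanced) :
    (smallest best t).work ≤ t.height + 1 := by
  induction t generalizing best with
  | leaf => simp [smallest]
  | node h s l k v r ihl ihr =>
    obtain ⟨rfl, rfl, h1, h2, hl, hr⟩ := ht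
    have := ihl (some k) hl
    simp only [smallest, work_bind, work_charge, height_node]
    omega

variable [LinearOrder K]

/-- The keys of the tree increase from left to right. -/
def Ordered (t : Tree K V) : Prop := t.toList.Pairwise fun p q => p.1 < q.1

theorem ordered_node {h s : ℕ} {l : Tree K V} {k : K} {v : V} {r : Tree K V} :
    (node h s l k v r).Ordered ↔
      l.Ordered ∧ r.Ordered ∧ (∀ p ∈ l.toList, p.1 < k) ∧ ∀ p ∈ r.toList, k < p.1 := by
  simp only [Ordered, toList_node, List.pairwise_append, List.pairwise_cons, List.mem_cons]
  constructor
  · rintro ⟨h1, ⟨h2, h3⟩, h4⟩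
    exact ⟨h1, h3, fun p hp => h4 p hp _ (.inl rfl), h2⟩
  · rintro ⟨h1, h2, h3, h4⟩
    refine ⟨h1, ⟨h4, h2⟩, fun p hp q hq => ?_⟩
    rcases hq with rfl | hq
    · exact h3 p hp
    · exact (h3 p hp).trans (h4 q hq)

theorem Ordered.value_unique {t : Tree K V} (h : t.Ordered) {k : K} {u v : V}
    (hu : (k, u) ∈ t.toList) (hv : (k, v) ∈ t.toList) : u = v := by
  have hinj := List.inj_on_of_nodup_map (f := Prod.fst) (l := t.toList)
    ((List.pairwise_map.2 h).imp ne_of_lt)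
  simpa using hinj hu hv rfl

/-- The height of every balanced search tree over `K` is at most this number. -/
def maxHeight (K : Type) [Fintype K] : ℕ := 2 * (Fintype.card K).size

theorem Ordered.length_le_card [Fintype K] {t : Tree K V} (ho : t.Ordered) :
    t.toList.length ≤ Fintype.card K := by
  have : (t.toList.map Prod.fst).Nodup := (List.pairwise_map.2 ho).imp ne_of_lt
  simpa using this.length_le_card

theorem height_le_maxHeight [Fintype K] [Weight V] {t : Tree K V} (hb : t.Balanced)
    (ho : t.Ordered) : t.height ≤ maxHeight K := by
  have h1 := ho.length_le_card
  have h2 := hb.two_pow_height_le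
  have h3 : (t.toList.length + 1) ^ 2 ≤ (2 ^ (Fintype.card K).size) ^ 2 :=
    Nat.pow_le_pow_left (by have := Nat.lt_size_self (Fintype.card K); omega) 2
  rw [← pow_mul] at h3
  have := (Nat.pow_le_pow_iff_right (a := 2) (by norm_num)).1 (h2.trans h3)
  rw [maxHeight]
  omega

theorem val_findLE (x : K) (best : Option (K × V)) {t : Tree K V} (ht : t.Ordered) :
    (findLE x best t).val = (t.toList.filter (fun p => p.1 ≤ x)).getLast?.or best := by
  induction t generalizing best with
  | leaf => simp [findLE]
  | node h s l k v r ihl ihr =>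
    obtain ⟨hl, hr, hlk, hkr⟩ := ordered_node.1 ht
    simp only [findLE, val_bind, toList_node, List.filter_append, List.filter_cons]
    split_ifs with hx h2 h2
    · simp at h2; exact absurd hx (not_lt.2 h2)
    · have : r.toList.filter (fun p => p.1 ≤ x) = [] := by
        simp only [List.filter_eq_nil_iff, decide_eq_true_eq, not_le]
        exact fun p hp => hx.trans (hkr p hp)
      rw [ihl _ hl, this, List.append_nil]
    · rw [ihr _ hr, List.getLast?_append, List.getLast?_cons]
      cases (r.toList.filter (fun p => p.1 ≤ x)).getLast? <;> simp
    · simp at h2; exact absurd h2 hx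

theorem depth_findLE (x : K) (best : Option (K × V)) (t : Tree K V) :
    (findLE x best t).depth = (findLE x best t).work := by
  induction t generalizing best with
  | leaf => simp [findLE]
  | node h s l k v r ihl ihr =>
    simp only [findLE, work_bind, depth_bind]
    split_ifs <;> simp [ihl, ihr]

theorem work_findLE_le [Weight V] (x : K) (best : Option (K × V)) {t : Tree K V}
    (ht : t.Balanced) : (findLE x best t).work ≤ t.height + 1 := by
  induction t generalizing best with
  | leaf => simp [findLE]
  | node h s l k v r ihl ihr =>
    obtain ⟨rfl, rfl, h1, h2, hl, hr⟩ := ht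
    have e1 := ihl best hl
    have e2 := ihr (some (k, v)) hr
    simp only [findLE, work_bind, work_charge, height_node]
    split_ifs <;> omega

variable [Weight V]

theorem toList_split (x : K) {t : Tree K V} (ht : t.Ordered) :
    (split x t).val.1.toList = t.toList.filter (fun p => p.1 < x) ∧
    (split x t).val.2.2.toList = t.toList.filter (fun p => x < p.1) ∧
    ∀ v, (split x t).val.2.1 = some v ↔ (x, v) ∈ t.toList := by
  induction t with
  | leaf => simp [split]
  | node h s l k v r ihl ihr =>
    obtain ⟨hl, hr, hlk, hkr⟩ := ordered_node.1 ht
    obtain ⟨l1, l2, l3⟩ := ihl hl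
    obtain ⟨r1, r2, r3⟩ := ihr hr
    simp only [split, val_bind, toList_node, List.filter_append]
    have el (h : x ≤ k) : r.toList.filter (fun p => p.1 < x) = [] ∧
        r.toList.filter (fun p => x < p.1) = r.toList := by
      simp only [List.filter_eq_nil_iff, List.filter_eq_self, decide_eq_true_eq, not_lt]
      exact ⟨fun p hp => (h.trans_lt (hkr p hp)).le, fun p hp => h.trans_lt (hkr p hp)⟩
    have er (h : k ≤ x) : l.toList.filter (fun p => x < p.1) = [] ∧
        l.toList.filter (fun p => p.1 < x) = l.toList := by
      simp only [List.filter_eq_nil_iff, List.filter_eq_self, decide_eq_true_eq, not_lt]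
      exact ⟨fun p hp => ((hlk p hp).trans_le h).le, fun p hp => (hlk p hp).trans_le h⟩
    split_ifs with h1 h2
    · simp only [val_bind, val_pure, toList_join, l1, l2, l3, List.filter_cons, el h1.le]
      refine ⟨by simp [h1.le.not_gt], by simp [h1], fun w => ?_⟩
      have : (x, w) ∉ r.toList := fun h => (hkr _ h).not_gt h1
      simp [this, h1.ne]
    · simp only [val_bind, val_pure, toList_join, r1, r2, r3, List.filter_cons, er h2.le]
      refine ⟨by simp [h2], by simp [h2.le.not_gt], fun w => ?_⟩
      have : (x, w) ∉ l.toList := fun h => (hlk _ h).not_gt h2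
      simp [this, h2.ne']
    · obtain rfl : x = k := le_antisymm (not_lt.1 h2) (not_lt.1 h1)
      simp only [val_pure, List.filter_cons, el le_rfl, er le_rfl]
      refine ⟨by simp, by simp, fun w => ?_⟩
      have e1 : (x, w) ∉ l.toList := fun h => (hlk _ h).ne rfl
      have e2 : (x, w) ∉ r.toList := fun h => (hkr _ h).ne rfl
      simp [e1, e2, eq_comm]

theorem depth_split (x : K) (t : Tree K V) : (split x t).depth = (split x t).work := by
  induction t with
  | leaf => simp [split]
  | node h s l k v r ihl ihr =>
    simp only [split, work_bind, depth_bind]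
    split_ifs <;> simp [ihl, ihr, depth_join]

/-- The bound on the work telescopes: joining a tree `r` to the outcome `t` of the split of a subtree
costs the difference of their heights, and that is the growth from `t` to the joined tree unless `t`
is the higher one, in which case the difference is at most one. -/
theorem balanced_split (x : K) {t : Tree K V} (ht : t.Balanced) :
    (split x t).val.1.Balanced ∧ (split x t).val.2.2.Balanced ∧
    (split x t).val.1.height ≤ t.height ∧ (split x t).val.2.2.height ≤ t.height ∧
    (split x t).work ≤
      13 * t.height + 4 * ((split x t).val.1.height + (split x t).val.2.2.height) + 1 := by
  induction t with
  | leaf => simp [split, balanced_leaf]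
  | node h s l k v r ihl ihr =>
    obtain ⟨rfl, rfl, h1, h2, hl, hr⟩ := ht
    obtain ⟨l1, l2, l3, l4, l5⟩ := ihl hl
    obtain ⟨r1, r2, r3, r4, r5⟩ := ihr hr
    simp only [split, val_bind, work_bind, work_charge, height_node]
    split_ifs
    · obtain ⟨j1, j2, j3⟩ := balanced_join l2 k v hr
      have j4 := work_join_le l2 k v hr
      simp only [val_bind, val_pure, work_bind, work_pure]
      refine ⟨l1, j1, ?_, ?_, ?_⟩ <;> omega
    · obtain ⟨j1, j2, j3⟩ := balanced_join hl k v r1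
      have j4 := work_join_le hl k v r1
      simp only [val_bind, val_pure, work_bind, work_pure]
      refine ⟨j1, r2, ?_, ?_, ?_⟩ <;> omega
    · simp only [val_pure, work_pure]
      refine ⟨hl, hr, ?_, ?_, ?_⟩ <;> omega

/-! ### The union of trees -/

/-- The value that `unionWith` puts at a key of its second tree. -/
def combine (f : V → V → Cost V) (new : V) : Option V → Cost V
  | none => pure new
  | some old => f old new

theorem unionWith_leaf (f : V → V → Cost V) (h s : ℕ) (l : Tree K V) (k : K)
    (v : V) (r : Tree K V) :
    unionWith f leaf (node h s l k v r) = ⟨node h s l k v r, 1, 1⟩ := rfl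

/-- The recursive case of `unionWith` in monadic form, with the choice of the value named. -/
theorem unionWith_node (f : V → V → Cost V) {t : Tree K V} (ht : t ≠ leaf) (h s : ℕ)
    (l : Tree K V) (k : K) (v : V) (r : Tree K V) :
    unionWith f t (node h s l k v r) = (do
      charge 1
      let p ← split k t
      let w ← combine f v p.2.1
      let q ← par (unionWith f p.1 l) (unionWith f p.2.2 r)
      join q.1 k w q.2) := by
  have ht : ¬ t.isLeaf = true := mt isLeaf_iff.1 ht
  simp only [unionWith, if_neg ht]
  refine congrArg (Bind.bind _) (funext fun _ => congrArg (Bind.bind _) (funext fun p => ?_))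
  rcases p with ⟨a, _ | old, b⟩ <;> rfl

theorem unionWith_spec (f : V → V → Cost V) {t t2 : Tree K V} (hb : t.Balanced) (ho : t.Ordered)
    (hb2 : t2.Balanced) (ho2 : t2.Ordered) :
    (unionWith f t t2).val.Balanced ∧ (unionWith f t t2).val.Ordered ∧
    ∀ k w, (k, w) ∈ (unionWith f t t2).val.toList ↔
      ((k, w) ∈ t.toList ∧ ∀ v, (k, v) ∉ t2.toList) ∨
      ((k, w) ∈ t2.toList ∧ ∀ v, (k, v) ∉ t.toList) ∨
      ∃ u v, (k, u) ∈ t.toList ∧ (k, v) ∈ t2.toList ∧ w = (f u v).val := by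
  induction t2 generalizing t with
  | leaf => simpa [unionWith] using ⟨hb, ho⟩
  | node h s l k v r ihl ihr =>
    by_cases ht : t = leaf
    · subst ht
      simpa [unionWith_leaf] using ⟨hb2, ho2⟩
    rw [unionWith_node f ht]
    have hb2' := hb2
    obtain ⟨rfl, rfl, -, -, hbl, hbr⟩ := hb2'
    obtain ⟨hol, hor, hlk, hkr⟩ := ordered_node.1 ho2
    obtain ⟨s1, s2, s3⟩ := toList_split k ho
    obtain ⟨b1, b2, -⟩ := balanced_split k hb
    have o1 : (split k t).val.1.Ordered := by rw [Ordered, s1]; exact ho.filter _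
    have o2 : (split k t).val.2.2.Ordered := by rw [Ordered, s2]; exact ho.filter _
    obtain ⟨bl, ol, ml⟩ := ihl b1 o1 hbl hol
    obtain ⟨br, or, mr⟩ := ihr b2 o2 hbr hor
    simp only [val_bind, val_par]
    set w := (combine f v (split k t).val.2.1).val with hw
    clear_value w
    refine ⟨(balanced_join bl k w br).1, ?_, ?_⟩
    all_goals
      rw [s1] at ml
      rw [s2] at mr
    · rw [Ordered, toList_join]
      refine ordered_node (h := 0) (s := 0).2 ⟨ol, or, ?_, ?_⟩
      · rintro ⟨x, y⟩ hx
        rcases (ml x y).1 hx with h | h | ⟨u, u', h, -⟩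
        · simpa using (List.mem_filter.1 h.1).2
        · exact hlk _ h.1
        · simpa using (List.mem_filter.1 h).2
      · rintro ⟨x, y⟩ hx
        rcases (mr x y).1 hx with h | h | ⟨u, u', h, -⟩
        · simpa using (List.mem_filter.1 h.1).2
        · exact hkr _ h.1
        · simpa using (List.mem_filter.1 h).2
    · intro x y
      have hlk' : ∀ z, (x, z) ∈ l.toList → x < k := fun z hz => hlk _ hz
      have hkr' : ∀ z, (x, z) ∈ r.toList → k < x := fun z hz => hkr _ hz
      simp only [toList_join, List.mem_append, List.mem_cons, toList_node, ml, mr, List.mem_filter,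
        decide_eq_true_eq, Prod.mk.injEq]
      rcases lt_trichotomy x k with h | rfl | h
      · have e1 : ¬ k < x := h.not_gt
        have e2 : ¬ x = k := h.ne
        have e3 : ∀ z, (x, z) ∉ r.toList := fun z hz => e1 (hkr' z hz)
        simp [h, e1, e2, e3]
      · have e1 : ∀ z, (x, z) ∉ l.toList := fun z hz => (hlk' z hz).false
        have e2 : ∀ z, (x, z) ∉ r.toList := fun z hz => (hkr' z hz).false
        simp only [lt_irrefl, and_false, e1, e2, false_and, exists_false, or_false, false_or,
          true_and, not_false_eq_true, false_or]
        cases hs : (split x t).val.2.1 with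
        | none =>
          have e3 : ∀ z, (x, z) ∉ t.toList := fun z hz => by simp [(s3 z).2 hz] at hs
          simp [hw, hs, combine, e3]
        | some old =>
          have e3 := (s3 old).1 hs
          have e4 : ∀ z, (x, z) ∈ t.toList ↔ z = old :=
            fun z => ⟨fun hz => ho.value_unique hz e3, fun hz => hz ▸ e3⟩
          simp [hw, hs, combine, e4]
      · have e1 : ¬ x < k := h.not_gt
        have e2 : ¬ x = k := h.ne'
        have e3 : ∀ z, (x, z) ∉ l.toList := fun z hz => e1 (hlk' z hz)
        simp [h, e1, e2, e3]

/-- The cost of a union.  Every entry of the second tree costs one split and one join of logarithmic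
work, and the work `W` for the combination of two values; on a path of the recursion the depths of
these add up. -/
theorem unionWith_cost [Fintype K] (f : V → V → Cost V) (W : K → ℕ) (D : ℕ) {t t2 : Tree K V}
    (hb : t.Balanced) (ho : t.Ordered) (hb2 : t2.Balanced) (ho2 : t2.Ordered)
    (hW : ∀ k u v, (k, u) ∈ t.toList → (k, v) ∈ t2.toList → (f u v).work ≤ W k ∧ (f u v).depth ≤ D) :
    (unionWith f t t2).work ≤
      (t2.toList.map fun p => W p.1 + (25 * maxHeight K + 12)).sum + 1 ∧
    (unionWith f t t2).depth ≤ t2.height * (25 * maxHeight K + 11 + D) + 1 := by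
  induction t2 generalizing t with
  | leaf => simp [unionWith]
  | node h s l k v r ihl ihr =>
    obtain ⟨rfl, rfl, -, -, hbl, hbr⟩ := hb2
    obtain ⟨hol, hor, hlk, hkr⟩ := ordered_node.1 ho2
    simp only [toList_node, List.map_append, List.map_cons, List.sum_append, List.sum_cons,
      height_node]
    by_cases ht : t = leaf
    · subst ht
      rw [unionWith_leaf]
      exact ⟨by simp only; omega, by simp only; omega⟩
    rw [unionWith_node f ht]
    obtain ⟨s1, s2, s3⟩ := toList_split k ho
    obtain ⟨b1, b2, h1, h2, hw⟩ := balanced_split k hb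
    have o1 : (split k t).val.1.Ordered := by rw [Ordered, s1]; exact ho.filter _
    have o2 : (split k t).val.2.2.Ordered := by rw [Ordered, s2]; exact ho.filter _
    obtain ⟨bl, ol, -⟩ := unionWith_spec f b1 o1 hbl hol
    obtain ⟨br, or, -⟩ := unionWith_spec f b2 o2 hbr hor
    obtain ⟨wl, dl⟩ := ihl b1 o1 hbl hol fun k' u v hu hv =>
      hW k' u v (by rw [s1] at hu; exact (List.mem_filter.1 hu).1) (by simp [hv])
    obtain ⟨wr, dr⟩ := ihr b2 o2 hbr hor fun k' u v hu hv =>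
      hW k' u v (by rw [s2] at hu; exact (List.mem_filter.1 hu).1) (by simp [hv])
    have hh := height_le_maxHeight hb ho
    have hm : (combine f v (split k t).val.2.1).work ≤ W k ∧
        (combine f v (split k t).val.2.1).depth ≤ D := by
      cases hs : (split k t).val.2.1 with
      | none => simp [combine]
      | some old => exact hW k old v ((s3 old).1 hs) (by simp)
    simp only [work_bind, depth_bind, work_par, depth_par, val_par, depth_split, depth_join,
      work_charge, depth_charge]
    set w := combine f v (split k t).val.2.1
    have hj := work_join_le bl k w.val br
    have hl' := height_le_maxHeight bl ol
    have hr' := height_le_maxHeight br or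
    refine ⟨by omega, ?_⟩
    have e1 : l.height * (25 * maxHeight K + 11 + D) ≤
        max l.height r.height * (25 * maxHeight K + 11 + D) := by gcongr; omega
    have e2 : r.height * (25 * maxHeight K + 11 + D) ≤
        max l.height r.height * (25 * maxHeight K + 11 + D) := by gcongr; omega
    rw [add_mul]
    omega

end Tree

namespace CTree

variable {K : Type}

/-! ### Chunks -/

theorem val_scanTail (isHead : K → Bool) (l : List K) :
    (scanTail isHead l).val = l.takeWhile fun x => !isHead x := by
  induction l with
  | nil => rfl
  | cons x l ih =>
    simp only [scanTail, val_bind, List.takeWhile_cons]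
    by_cases h : isHead x <;> simp [h, ih]

theorem depth_scanTail (isHead : K → Bool) (l : List K) :
    (scanTail isHead l).depth = (scanTail isHead l).work := by
  induction l with
  | nil => rfl
  | cons x l ih =>
    simp only [scanTail, work_bind, depth_bind]
    split_ifs <;> simp [ih]

theorem work_scanTail (isHead : K → Bool) (l : List K) :
    (scanTail isHead l).work = (l.takeWhile fun x => !isHead x).length + 1 := by
  induction l with
  | nil => rfl
  | cons x l ih =>
    simp only [scanTail, work_bind, List.takeWhile_cons]
    by_cases h : isHead x <;> simp [h, ih]
    omega

variable [LinearOrder K]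

theorem val_splitChunk (k : K) {l : List K} (hl : l.Pairwise (· < ·)) :
    (splitChunk k l).val = (l.filter (· < k), l.filter (k < ·)) := by
  induction l with
  | nil => rfl
  | cons x l ih =>
    rw [List.pairwise_cons] at hl
    have e (h : k ≤ x) : l.filter (· < k) = [] ∧ l.filter (k < ·) = l := by
      simp only [List.filter_eq_nil_iff, List.filter_eq_self, decide_eq_true_eq, not_lt]
      exact ⟨fun p hp => (h.trans_lt (hl.1 p hp)).le, fun p hp => h.trans_lt (hl.1 p hp)⟩
    simp only [splitChunk, val_bind]
    split_ifs with h1 h2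
    · simp [ih hl.2, h1, h1.le]
    · subst h2
      simp [e le_rfl]
    · have := lt_of_le_of_ne (not_lt.1 h1) (Ne.symm h2)
      simp [e this.le, this, this.le.not_gt]

theorem depth_splitChunk (k : K) (l : List K) :
    (splitChunk k l).depth = (splitChunk k l).work := by
  induction l with
  | nil => rfl
  | cons x l ih =>
    simp only [splitChunk, work_bind, depth_bind]
    split_ifs <;> simp [ih]

theorem work_splitChunk_le (k : K) (l : List K) : (splitChunk k l).work ≤ l.length + 1 := by
  induction l with
  | nil => simp [splitChunk]
  | cons x l ih =>
    simp only [splitChunk, work_bind, work_charge, List.length_cons]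
    split_ifs <;> simp <;> omega

theorem sublist_splitChunk (k : K) (l : List K) :
    (splitChunk k l).val.1.Sublist l ∧ (splitChunk k l).val.2.Sublist l := by
  induction l with
  | nil => simp [splitChunk]
  | cons x l ih =>
    simp only [splitChunk, val_bind]
    split_ifs
    · exact ⟨ih.1.cons_cons x, ih.2.cons x⟩
    · exact ⟨List.nil_sublist _, List.sublist_cons_self x l⟩
    · exact ⟨List.nil_sublist _, List.Sublist.refl _⟩

theorem depth_splitChunkAt (s : Option K) (l : List K) :
    (splitChunkAt s l).depth = (splitChunkAt s l).work := by
  cases s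
  · rfl
  · exact depth_splitChunk _ _

theorem work_splitChunkAt_le (s : Option K) (l : List K) :
    (splitChunkAt s l).work ≤ l.length + 1 := by
  cases s
  · simp [splitChunkAt]
  · exact work_splitChunk_le _ _

theorem sublist_splitChunkAt (s : Option K) (l : List K) :
    (splitChunkAt s l).val.1.Sublist l ∧ (splitChunkAt s l).val.2.Sublist l := by
  cases s
  · simp [splitChunkAt]
  · exact sublist_splitChunk _ _

theorem mem_splitChunkAt (s : Option K) {l : List K} (hl : l.Pairwise (· < ·)) (x : K) :
    (x ∈ (splitChunkAt s l).val.1 ↔ x ∈ l ∧ ∀ y ∈ s, x < y) ∧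
    (x ∈ (splitChunkAt s l).val.2 ↔ x ∈ l ∧ ∃ y ∈ s, y < x) := by
  cases s
  · simp [splitChunkAt]
  · simp [splitChunkAt, val_splitChunk _ hl]

/-- `op` computes, in linear time, the chunk whose elements are determined by `P`: `x` is in
`op v es` if `P (x ∈ v) (x ∈ es)`. -/
structure IsChunkOp (op : List K → List K → Cost (List K)) (P : Prop → Prop → Prop) : Prop where
  nil : ∀ v, (op v []).val = v
  right_false : ∀ a, P a False ↔ a
  mem : ∀ v es, v.Pairwise (· < ·) → es.Pairwise (· < ·) →
    ∀ x, x ∈ (op v es).val ↔ P (x ∈ v) (x ∈ es)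
  pairwise : ∀ v es, v.Pairwise (· < ·) → es.Pairwise (· < ·) → (op v es).val.Pairwise (· < ·)
  work_le : ∀ v es, (op v es).work ≤ v.length + es.length + 1
  depth_eq : ∀ v es, (op v es).depth = (op v es).work

theorem isChunkOp_union : IsChunkOp (K := K) unionChunk Or := by
  have hmem : ∀ v es : List K, v.Pairwise (· < ·) → es.Pairwise (· < ·) →
      ∀ x, x ∈ (unionChunk v es).val ↔ x ∈ v ∨ x ∈ es := by
    intro v es hv hes z
    fun_induction unionChunk v es with
    | case1 b => simp
    | case2 x a => simp
    | case3 x a y b ih1 ih2 ih3 =>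
      simp only [val_bind]
      split_ifs with e1 e2
      · simp only [val_bind, val_pure, List.mem_cons, ih1 (List.pairwise_cons.1 hv).2 hes, or_assoc]
      · simp only [val_bind, val_pure, List.mem_cons, ih2 hv (List.pairwise_cons.1 hes).2]
        exact or_left_comm
      · obtain rfl : x = y := le_antisymm (not_lt.1 e2) (not_lt.1 e1)
        simp only [val_bind, val_pure, List.mem_cons,
          ih3 (List.pairwise_cons.1 hv).2 (List.pairwise_cons.1 hes).2]
        exact or_or_distrib_left
  refine ⟨fun v => ?_, by simp, hmem, fun v es hv hes => ?_, fun v es => ?_, fun v es => ?_⟩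
  · cases v <;> simp [unionChunk]
  · fun_induction unionChunk v es with
    | case1 b => simpa using hes
    | case2 x a => simpa using hv
    | case3 x a y b ih1 ih2 ih3 =>
      have hv' := List.pairwise_cons.1 hv
      have hes' := List.pairwise_cons.1 hes
      have h1 := ih1 hv'.2 hes
      have h2 := ih2 hv hes'.2
      have h3 := ih3 hv'.2 hes'.2
      simp only [val_bind]
      split_ifs with e1 e2
      · simp only [val_bind, val_pure, List.pairwise_cons]
        refine ⟨fun z hz => ?_, h1⟩
        rcases (hmem _ _ hv'.2 hes z).1 hz with hz | hz
        · exact hv'.1 z hz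
        · rcases List.mem_cons.1 hz with rfl | hz
          · exact e1
          · exact e1.trans (hes'.1 z hz)
      · simp only [val_bind, val_pure, List.pairwise_cons]
        refine ⟨fun z hz => ?_, h2⟩
        rcases (hmem _ _ hv hes'.2 z).1 hz with hz | hz
        · rcases List.mem_cons.1 hz with rfl | hz
          · exact e2
          · exact e2.trans (hv'.1 z hz)
        · exact hes'.1 z hz
      · obtain rfl : x = y := le_antisymm (not_lt.1 e2) (not_lt.1 e1)
        simp only [val_bind, val_pure, List.pairwise_cons]
        refine ⟨fun z hz => ?_, h3⟩
        rcases (hmem _ _ hv'.2 hes'.2 z).1 hz with hz | hz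
        · exact hv'.1 z hz
        · exact hes'.1 z hz
  · fun_induction unionChunk v es with
    | case1 b => simp
    | case2 x a => simp
    | case3 x a y b ih1 ih2 ih3 =>
      simp only [List.length_cons] at *
      simp only [work_bind, work_charge]
      split_ifs <;> simp only [work_bind, work_pure] <;> omega
  · fun_induction unionChunk v es with
    | case1 b => simp
    | case2 x a => simp
    | case3 x a y b ih1 ih2 ih3 =>
      simp only [work_bind, depth_bind]
      split_ifs <;> simp [ih1, ih2, ih3]

theorem isChunkOp_diff : IsChunkOp (K := K) diffChunk fun a b => a ∧ ¬ b := by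
  have hmem : ∀ v es : List K, v.Pairwise (· < ·) → es.Pairwise (· < ·) →
      ∀ x, x ∈ (diffChunk v es).val ↔ x ∈ v ∧ x ∉ es := by
    intro v es hv hes z
    fun_induction diffChunk v es with
    | case1 b => simp
    | case2 x a => simp
    | case3 x a y b ih1 ih2 ih3 =>
      have hv' := List.pairwise_cons.1 hv
      have hes' := List.pairwise_cons.1 hes
      simp only [val_bind]
      split_ifs with e1 e2
      · have hx : x ∉ y :: b := by
          rintro hx
          rcases List.mem_cons.1 hx with rfl | hx
          · exact e1.false
          · exact (e1.trans (hes'.1 _ hx)).false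
        simp only [val_bind, val_pure, List.mem_cons (a := z) (b := x), ih1 hv'.2 hes]
        by_cases hz : z = x
        · simp [hz, hx]
        · simp [hz]
      · have hy : y ∉ x :: a := by
          rintro hy
          rcases List.mem_cons.1 hy with rfl | hy
          · exact e2.false
          · exact (e2.trans (hv'.1 _ hy)).false
        rw [ih2 hv hes'.2, List.mem_cons (a := z) (b := y)]
        by_cases hz : z = y
        · simp only [hz, hy, false_and]
        · simp [hz]
      · obtain rfl : x = y := le_antisymm (not_lt.1 e2) (not_lt.1 e1)
        rw [ih3 hv'.2 hes'.2]
        by_cases hz : z = x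
        · have : z ∉ a := fun h => (hv'.1 _ h).ne' hz
          simp [hz ▸ this, hz]
        · simp [hz]
  refine ⟨fun v => ?_, by simp, hmem, fun v es hv hes => ?_, fun v es => ?_, fun v es => ?_⟩
  · cases v <;> simp [diffChunk]
  · have hsub : ∀ v es : List K, (diffChunk v es).val.Sublist v := by
      intro v es
      fun_induction diffChunk v es with
      | case1 b => simp
      | case2 x a => simp
      | case3 x a y b ih1 ih2 ih3 =>
        simp only [val_bind]
        split_ifs with e1 e2
        · exact ih1.cons_cons x
        · exact ih2
        · exact ih3.cons x
    exact hv.sublist (hsub v es)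
  · fun_induction diffChunk v es with
    | case1 b => simp
    | case2 x a => simp
    | case3 x a y b ih1 ih2 ih3 =>
      simp only [List.length_cons] at *
      simp only [work_bind, work_charge]
      split_ifs <;> (try simp only [work_bind, work_pure]) <;> omega
  · fun_induction diffChunk v es with
    | case1 b => simp
    | case2 x a => simp
    | case3 x a y b ih1 ih2 ih3 =>
      simp only [work_bind, depth_bind]
      split_ifs <;> simp [ih1, ih2, ih3]

/-! ### Valid C-trees -/

/-- The elements in the entries of a tree of heads and tails. -/
def flat (l : List (K × List K)) : List K := l.flatMap fun p => p.1 :: p.2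

omit [LinearOrder K] in
@[simp] theorem flat_nil : flat ([] : List (K × List K)) = [] := rfl
omit [LinearOrder K] in
@[simp] theorem flat_cons (p : K × List K) (l : List (K × List K)) :
    flat (p :: l) = p.1 :: p.2 ++ flat l := rfl
omit [LinearOrder K] in
@[simp] theorem flat_append (l l' : List (K × List K)) : flat (l ++ l') = flat l ++ flat l' := by
  simp [flat]
omit [LinearOrder K] in
theorem elems_eq_append (c : CTree K) : c.elems = c.pre ++ flat c.tree.toList := rfl

omit [LinearOrder K] in
theorem mem_flat {l : List (K × List K)} {x : K} :
    x ∈ flat l ↔ ∃ p ∈ l, x = p.1 ∨ x ∈ p.2 := by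
  simp [flat]

/-- `c` is a C-tree over the set of its elements. -/
structure Valid (isHead : K → Bool) (c : CTree K) : Prop where
  balanced : c.tree.Balanced
  increasing : c.elems.Pairwise (· < ·)
  heads : ∀ p ∈ c.tree.toList, isHead p.1 = true ∧ ∀ x ∈ p.2, isHead x = false
  pre_tail : ∀ x ∈ c.pre, isHead x = false

variable {isHead : K → Bool}

theorem represents_iff {c : CTree K} {S : Finset K} :
    c.Represents isHead S ↔ Valid isHead c ∧ ∀ x, x ∈ c.elems ↔ x ∈ S :=
  ⟨fun h => ⟨⟨h.balanced, h.increasing, h.heads, h.pre_tail⟩, fun x => by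
    rw [← h.elems_eq, List.mem_toFinset]⟩,
  fun h => ⟨h.1.balanced, h.1.increasing, by ext x; rw [List.mem_toFinset, h.2], h.1.heads,
    h.1.pre_tail⟩⟩

theorem pairwise_flat {l : List (K × List K)} :
    (flat l).Pairwise (· < ·) ↔ (∀ p ∈ l, (p.1 :: p.2).Pairwise (· < ·)) ∧
      l.Pairwise fun p q => ∀ x ∈ p.1 :: p.2, ∀ y ∈ q.1 :: q.2, x < y :=
  List.pairwise_flatMap

theorem ordered_of_pairwise_flat {t : Tree K (List K)} (h : (flat t.toList).Pairwise (· < ·)) :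
    t.Ordered :=
  (pairwise_flat.1 h).2.imp fun h => h _ (by simp) _ (by simp)

/-- Tails stay below the following heads. -/
theorem lt_of_pairwise_flat {t : Tree K (List K)} (h : (flat t.toList).Pairwise (· < ·))
    {p q : K × List K} (hp : p ∈ t.toList) (hq : q ∈ t.toList) (hpq : p.1 < q.1) {x : K}
    (hx : x = p.1 ∨ x ∈ p.2) : x < q.1 := by
  obtain ⟨l1, l2, e⟩ := List.append_of_mem hp
  have h2 := (pairwise_flat.1 h).2
  rw [e, List.pairwise_append, List.pairwise_cons] at h2
  rw [e] at hq
  rcases List.mem_append.1 hq with hq | hq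
  · exact absurd (h2.2.2 q hq p (by simp) q.1 (by simp) p.1 (by simp)) hpq.not_gt
  · rcases List.mem_cons.1 hq with rfl | hq
    · exact absurd hpq (lt_irrefl _)
    · exact h2.2.1.1 q hq x (by simpa using hx) q.1 (by simp)

namespace Valid

variable {c : CTree K}

theorem pairwise_flat (h : Valid isHead c) : (flat c.tree.toList).Pairwise (· < ·) :=
  (List.pairwise_append.1 h.increasing).2.1

theorem ordered (h : Valid isHead c) : c.tree.Ordered := ordered_of_pairwise_flat h.pairwise_flat

theorem pairwise_pre (h : Valid isHead c) : c.pre.Pairwise (· < ·) :=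
  (List.pairwise_append.1 h.increasing).1

theorem pre_lt (h : Valid isHead c) {x : K} (hx : x ∈ c.pre) {p : K × List K}
    (hp : p ∈ c.tree.toList) : x < p.1 :=
  (List.pairwise_append.1 h.increasing).2.2 x hx p.1 (mem_flat.2 ⟨p, hp, .inl rfl⟩)

theorem pairwise_tail (h : Valid isHead c) {p : K × List K} (hp : p ∈ c.tree.toList) :
    p.2.Pairwise (· < ·) ∧ ∀ x ∈ p.2, p.1 < x :=
  (List.pairwise_cons.1 ((CTree.pairwise_flat.1 h.pairwise_flat).1 p hp)).symm

/-- An element below all heads can only be in the prefix. -/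
theorem mem_elems_of_lt (h : Valid isHead c) {x : K} (hx : ∀ p ∈ c.tree.toList, x < p.1) :
    x ∈ c.elems ↔ x ∈ c.pre := by
  rw [elems_eq_append, List.mem_append, or_iff_left]
  rw [mem_flat]
  rintro ⟨p, hp, rfl | hxp⟩
  · exact (hx p hp).false
  · exact ((h.pairwise_tail hp).2 x hxp).not_gt (hx p hp)

/-- An element can only be in the entry with the largest head that does not exceed it. -/
theorem mem_elems_of_floor (h : Valid isHead c) {x : K} {p : K × List K}
    (hp : p ∈ c.tree.toList) (hpx : p.1 ≤ x) (hmax : ∀ q ∈ c.tree.toList, q.1 ≤ x → q.1 ≤ p.1) :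
    x ∈ c.elems ↔ x = p.1 ∨ x ∈ p.2 := by
  rw [elems_eq_append, List.mem_append, or_iff_right (fun hx => (h.pre_lt hx hp).not_ge hpx),
    mem_flat]
  constructor
  · rintro ⟨q, hq, hxq⟩
    have hqx : q.1 ≤ x := by
      rcases hxq with rfl | hxq
      · rfl
      · exact ((h.pairwise_tail hq).2 x hxq).le
    rcases (hmax q hq hqx).lt_or_eq with hlt | heq
    · exact absurd (lt_of_pairwise_flat h.pairwise_flat hq hp hlt hxq) hpx.not_gt
    · have : q = p := Prod.ext heq (h.ordered.value_unique (k := p.1) (by rw [← heq]; exact hq) hp)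
      rwa [← this]
  · exact fun hx => ⟨p, hp, hx⟩

/-- There is no prefix if a head comes first. -/
theorem pre_eq_nil (h : Valid isHead c)
    (hx : ∀ x ∈ c.elems, ∃ y ∈ c.elems, isHead y = true ∧ y ≤ x) : c.pre = [] := by
  rw [List.eq_nil_iff_forall_not_mem]
  intro x hxp
  obtain ⟨y, hy, hyh, hyx⟩ := hx x (by rw [elems_eq_append]; simp [hxp])
  rw [elems_eq_append, List.mem_append] at hy
  rcases hy with hy | hy
  · rw [h.pre_tail y hy] at hyh; simp at hyh
  · exact ((List.pairwise_append.1 h.increasing).2.2 x hxp y hy).not_ge hyx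

end Valid

/-- All chunks of `c` have at most `L` elements. -/
def ChunksLE (L : ℕ) (c : CTree K) : Prop := c.pre.length ≤ L ∧ ∀ p ∈ c.tree.toList, p.2.length ≤ L

/-! ### Splitting C-trees -/

/-- Every entry of `t'` consists of a head in `t` and of a part of its tail. -/
def Refines (t' t : Tree K (List K)) : Prop :=
  ∀ p ∈ t'.toList, ∃ v, (p.1, v) ∈ t.toList ∧ p.2.Sublist v

theorem filter_gt_of_lt {l : List K} {k : K} (h : ∀ x ∈ l, x < k) :
    l.filter (· < k) = l ∧ l.filter (k < ·) = [] := by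
  simp only [List.filter_eq_nil_iff, List.filter_eq_self, decide_eq_true_eq, not_lt]
  exact ⟨h, fun x hx => (h x hx).le⟩

theorem filter_of_gt {l : List K} {k : K} (h : ∀ x ∈ l, k < x) :
    l.filter (· < k) = [] ∧ l.filter (k < ·) = l := by
  simp only [List.filter_eq_nil_iff, List.filter_eq_self, decide_eq_true_eq, not_lt]
  exact ⟨fun x hx => (h x hx).le, h⟩

/-- The test of `split` whether a chunk has to be cut. -/
theorem any_getLast?_ge {l : List K} (hl : l.Pairwise (· < ·)) (k : K) :
    l.getLast?.any (fun e => decide (k ≤ e)) = true ↔ ∃ x ∈ l, k ≤ x := by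
  rcases List.eq_nil_or_concat l with rfl | ⟨l', x, rfl⟩
  · simp
  · rw [List.concat_eq_append, List.pairwise_append] at hl
    simp only [List.concat_eq_append, List.getLast?_append, List.getLast?_singleton,
      Option.some_or, Option.any_some, decide_eq_true_eq]
    constructor
    · exact fun h => ⟨x, by simp, h⟩
    · rintro ⟨y, hy, h⟩
      rcases List.mem_append.1 hy with hy | hy
      · exact h.trans (hl.2.2 y hy x (by simp)).le
      · rw [List.mem_singleton] at hy; rwa [← hy]

theorem depth_splitTree (k : K) (t : Tree K (List K)) :
    (splitTree k t).depth = (splitTree k t).work := by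
  induction t with
  | leaf => rfl
  | node m s l h v r ihl ihr =>
    simp only [splitTree, work_bind, depth_bind]
    split_ifs <;> simp [ihl, ihr, Tree.depth_join, depth_splitChunk]

/-- `split` creates no heads: its entries are old entries or parts of them, and the new prefix is a part
of an old tail. -/
theorem splitTree_refines (k : K) (t : Tree K (List K)) :
    Refines (splitTree k t).val.1.tree t ∧ Refines (splitTree k t).val.2.tree t ∧
    (splitTree k t).val.1.pre = [] ∧
    ((splitTree k t).val.2.pre = [] ∨
      ∃ p ∈ t.toList, (splitTree k t).val.2.pre.Sublist p.2) := by
  induction t with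
  | leaf => simp [splitTree, Refines]
  | node m s l h v r ihl ihr =>
    obtain ⟨l1, l2, l3, l4⟩ := ihl
    obtain ⟨r1, r2, r3, r4⟩ := ihr
    have self {q : K × List K} {t' : Tree K (List K)} (hq : q ∈ t'.toList) :
        ∃ v, (q.1, v) ∈ t'.toList ∧ q.2.Sublist v := ⟨q.2, hq, List.Sublist.refl _⟩
    simp only [Refines] at *
    simp only [splitTree, val_bind, Tree.toList_node, List.mem_append, List.mem_cons]
    split_ifs <;> simp only [val_bind, val_pure, Tree.toList_join, List.mem_append, List.mem_cons,
      Tree.toList_leaf, List.not_mem_nil, or_false]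
    · refine ⟨fun p hp => ?_, fun p hp => ?_, l3, ?_⟩
      · obtain ⟨w, hw, hs⟩ := l1 p hp; exact ⟨w, .inl hw, hs⟩
      · rcases hp with hp | rfl | hp
        · obtain ⟨w, hw, hs⟩ := l2 p hp; exact ⟨w, .inl hw, hs⟩
        · exact ⟨v, .inr (.inl rfl), List.Sublist.refl _⟩
        · exact ⟨p.2, .inr (.inr hp), List.Sublist.refl _⟩
      · exact l4.imp_right fun ⟨p, hp, hs⟩ => ⟨p, .inl hp, hs⟩
    · refine ⟨fun p hp => ?_, fun p hp => ?_, trivial, ?_⟩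
      · rcases hp with hp | rfl
        · exact ⟨p.2, .inl hp, List.Sublist.refl _⟩
        · exact ⟨v, .inr (.inl rfl), (sublist_splitChunk k v).1⟩
      · exact ⟨p.2, .inr (.inr hp), List.Sublist.refl _⟩
      · exact .inr ⟨(h, v), .inr (.inl rfl), (sublist_splitChunk k v).2⟩
    · refine ⟨fun p hp => ?_, fun p hp => ?_, r3, ?_⟩
      · rcases hp with hp | rfl | hp
        · exact ⟨p.2, .inl hp, List.Sublist.refl _⟩
        · exact ⟨v, .inr (.inl rfl), List.Sublist.refl _⟩
        · obtain ⟨w, hw, hs⟩ := r1 p hp; exact ⟨w, .inr (.inr hw), hs⟩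
      · obtain ⟨w, hw, hs⟩ := r2 p hp; exact ⟨w, .inr (.inr hw), hs⟩
      · exact r4.imp_right fun ⟨p, hp, hs⟩ => ⟨p, .inr (.inr hp), hs⟩
    · exact ⟨fun p hp => ⟨p.2, .inl hp, List.Sublist.refl _⟩,
        fun p hp => ⟨p.2, .inr (.inr hp), List.Sublist.refl _⟩, trivial,
        .inr ⟨(h, v), .inr (.inl rfl), List.Sublist.refl _⟩⟩

theorem elems_splitTree (k : K) {t : Tree K (List K)} (ht : (flat t.toList).Pairwise (· < ·)) :
    (splitTree k t).val.1.elems = (flat t.toList).filter (· < k) ∧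
    (splitTree k t).val.2.elems = (flat t.toList).filter (k < ·) := by
  induction t with
  | leaf => simp [splitTree, elems_eq_append]
  | node m s l h v r ihl ihr =>
    simp only [Tree.toList_node, flat_append, flat_cons, List.cons_append] at ht
    rw [List.pairwise_append, List.pairwise_cons, List.pairwise_append] at ht
    obtain ⟨hl, ⟨hh, hv, hr, hvr⟩, hlr⟩ := ht
    obtain ⟨l1, l2⟩ := ihl hl
    obtain ⟨r1, r2⟩ := ihr hr
    have hpre := (splitTree_refines k r).2.2.1
    rw [elems_eq_append] at l1 l2 r1 r2
    simp only [splitTree, val_bind, Tree.toList_node, flat_append, flat_cons, List.cons_append,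
      List.filter_append, elems_eq_append]
    have hlh : ∀ x ∈ flat l.toList, x < h := fun x hx => hlr x hx h (by simp)
    have hhv : ∀ x ∈ v, h < x := fun x hx => hh x (by simp [hx])
    have hhr : ∀ x ∈ flat r.toList, h < x := fun x hx => hh x (by simp [hx])
    split_ifs with h1 h2 h3
    · have ev := filter_of_gt (l := v) (k := k) fun x hx => h1.trans (hhv x hx)
      have er := filter_of_gt (l := flat r.toList) (k := k) fun x hx => h1.trans (hhr x hx)
      simp only [val_bind, val_pure, Tree.toList_join, flat_append, flat_cons, l1, List.filter_cons,
        List.filter_append, ev, er]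
      rw [← List.append_assoc, l2]
      simp [h1, h1.le.not_gt]
    · obtain ⟨y, hy, hky⟩ := (any_getLast?_ge hv k).1 h3
      have el := filter_gt_of_lt (l := flat l.toList) (k := k) fun x hx => (hlh x hx).trans h2
      have er := filter_of_gt (l := flat r.toList) (k := k) fun x hx => hky.trans_lt (hvr y hy x hx)
      simp only [val_bind, val_pure, Tree.toList_join, flat_append, flat_cons, List.filter_cons,
        List.filter_append, el, er, val_splitChunk k hv]
      simp [h2, h2.le.not_gt]
    · have h3' : ∀ x ∈ v, x < k := fun x hx => not_le.1 fun hkx =>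
        h3 ((any_getLast?_ge hv k).2 ⟨x, hx, hkx⟩)
      have el := filter_gt_of_lt (l := flat l.toList) (k := k) fun x hx => (hlh x hx).trans h2
      have ev := filter_gt_of_lt h3'
      simp only [val_bind, val_pure, Tree.toList_join, flat_append, flat_cons, List.filter_cons,
        List.filter_append, el, ev, r2]
      rw [hpre] at r1 ⊢
      rw [List.nil_append] at r1
      simp [h2, h2.le.not_gt, r1]
    · obtain rfl : k = h := le_antisymm (not_lt.1 h2) (not_lt.1 h1)
      have el := filter_gt_of_lt hlh
      have ev := filter_of_gt hhv
      have er := filter_of_gt hhr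
      simp [el, ev, er]

/-- The bound on the work telescopes as for trees; one chunk is cut, at the end of the search. -/
theorem balanced_splitTree (k : K) {t : Tree K (List K)} (ht : t.Balanced) {L : ℕ}
    (hL : ∀ p ∈ t.toList, p.2.length ≤ L) :
    (splitTree k t).val.1.tree.Balanced ∧ (splitTree k t).val.2.tree.Balanced ∧
    (splitTree k t).val.1.tree.height ≤ t.height ∧ (splitTree k t).val.2.tree.height ≤ t.height ∧
    (splitTree k t).work ≤ 13 * t.height +
      4 * ((splitTree k t).val.1.tree.height + (splitTree k t).val.2.tree.height) + L + 2 := by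
  induction t with
  | leaf => simp [splitTree, Tree.balanced_leaf]
  | node m s l h v r ihl ihr =>
    obtain ⟨rfl, rfl, h1, h2, hl, hr⟩ := ht
    simp only [Tree.toList_node, List.mem_append, List.mem_cons] at hL
    obtain ⟨l1, l2, l3, l4, l5⟩ := ihl hl fun p hp => hL p (.inl hp)
    obtain ⟨r1, r2, r3, r4, r5⟩ := ihr hr fun p hp => hL p (.inr (.inr hp))
    have hv : v.length ≤ L := hL (h, v) (.inr (.inl rfl))
    simp only [splitTree, val_bind, work_bind, work_charge, Tree.height_node]
    split_ifs
    · obtain ⟨j1, j2, j3⟩ := Tree.balanced_join l2 h v hr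
      have j4 := Tree.work_join_le l2 h v hr
      simp only [val_bind, val_pure, work_bind, work_pure]
      refine ⟨l1, j1, ?_, ?_, ?_⟩ <;> omega
    · obtain ⟨j1, j2, j3⟩ :=
        Tree.balanced_join hl h (splitChunk k v).val.1 (Tree.balanced_leaf (K := K))
      have j4 := Tree.work_join_le hl h (splitChunk k v).val.1 (Tree.balanced_leaf (K := K))
      have j5 := work_splitChunk_le k v
      simp only [Tree.height_leaf] at j2 j3 j4
      simp only [val_bind, val_pure, work_bind, work_pure]
      refine ⟨j1, hr, ?_, ?_, ?_⟩ <;> omega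
    · obtain ⟨j1, j2, j3⟩ := Tree.balanced_join hl h v r1
      have j4 := Tree.work_join_le hl h v r1
      simp only [val_bind, val_pure, work_bind, work_pure]
      refine ⟨j1, r2, ?_, ?_, ?_⟩ <;> omega
    · simp only [val_pure, work_pure]
      refine ⟨hl, hr, ?_, ?_, ?_⟩ <;> omega

theorem depth_split (c : CTree K) (k : K) : (split c k).depth = (split c k).work := by
  simp only [split, work_bind, depth_bind]
  split_ifs <;> simp [depth_splitChunk, depth_splitTree]

theorem split_refines (c : CTree K) (k : K) :
    Refines (split c k).val.1.tree c.tree ∧ Refines (split c k).val.2.tree c.tree ∧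
    (split c k).val.1.pre.Sublist c.pre ∧
    ((split c k).val.2.pre.Sublist c.pre ∨
      ∃ p ∈ c.tree.toList, (split c k).val.2.pre.Sublist p.2) := by
  simp only [split, val_bind]
  split_ifs
  · exact ⟨by simp [Refines], fun p hp => ⟨p.2, hp, List.Sublist.refl _⟩,
      (sublist_splitChunk k _).1, .inl (sublist_splitChunk k _).2⟩
  · obtain ⟨h1, h2, h3, h4⟩ := splitTree_refines k c.tree
    refine ⟨h1, h2, List.Sublist.refl _, h4.imp_left fun h => ?_⟩
    simp only [val_bind, val_pure, h]
    exact List.nil_sublist _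

theorem elems_split {c : CTree K} (hc : c.elems.Pairwise (· < ·)) (k : K) :
    (split c k).val.1.elems = c.elems.filter (· < k) ∧
    (split c k).val.2.elems = c.elems.filter (k < ·) := by
  rw [elems_eq_append, List.pairwise_append] at hc
  obtain ⟨h1, h2, h3⟩ := hc
  rw [elems_eq_append c]
  simp only [split, val_bind, List.filter_append]
  split_ifs with h
  · obtain ⟨y, hy, hky⟩ := (any_getLast?_ge h1 k).1 h
    have e := filter_of_gt (l := flat c.tree.toList) (k := k) fun x hx => hky.trans_lt (h3 y hy x hx)
    simp [elems_eq_append, val_splitChunk k h1, e]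
  · have e := filter_gt_of_lt (l := c.pre) (k := k) fun x hx => not_le.1 fun hkx =>
      h ((any_getLast?_ge h1 k).2 ⟨x, hx, hkx⟩)
    obtain ⟨e1, e2⟩ := elems_splitTree k h2
    rw [elems_eq_append, (splitTree_refines k c.tree).2.2.1, List.nil_append] at e1
    simp only [val_bind, val_pure, e, e2, List.nil_append, and_true]
    rw [elems_eq_append, e1]

theorem split_spec [Fintype K] {c : CTree K} (hc : Valid isHead c) {L : ℕ} (hL : ChunksLE L c)
    (k : K) :
    Valid isHead (split c k).val.1 ∧ Valid isHead (split c k).val.2 ∧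
    ChunksLE L (split c k).val.1 ∧ ChunksLE L (split c k).val.2 ∧
    (∀ x, x ∈ (split c k).val.1.elems ↔ x ∈ c.elems ∧ x < k) ∧
    (∀ x, x ∈ (split c k).val.2.elems ↔ x ∈ c.elems ∧ k < x) ∧
    (split c k).work ≤ 21 * Tree.maxHeight K + L + 3 := by
  obtain ⟨e1, e2⟩ := elems_split hc.increasing k
  obtain ⟨r1, r2, r3, r4⟩ := split_refines c k
  obtain ⟨b1, b2, b3, b4, b5⟩ := balanced_splitTree k hc.balanced hL.2
  have hh := Tree.height_le_maxHeight hc.balanced hc.ordered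
  have hb : (split c k).val.1.tree.Balanced ∧ (split c k).val.2.tree.Balanced ∧
      (split c k).work ≤ 21 * Tree.maxHeight K + L + 3 := by
    simp only [split, val_bind, work_bind, work_charge]
    split_ifs
    · have := work_splitChunk_le k c.pre
      have := hL.1
      simp only [val_bind, val_pure, work_bind, work_pure]
      exact ⟨Tree.balanced_leaf, hc.balanced, by omega⟩
    · simp only [val_bind, val_pure, work_bind, work_pure]
      exact ⟨b1, b2, by omega⟩
  have heads {t : Tree K (List K)} (ht : Refines t c.tree) (p : K × List K) (hp : p ∈ t.toList) :
      isHead p.1 = true ∧ ∀ x ∈ p.2, isHead x = false := by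
    obtain ⟨v, hv, hs⟩ := ht p hp
    exact ⟨(hc.heads _ hv).1, fun x hx => (hc.heads _ hv).2 x (hs.subset hx)⟩
  have len {t : Tree K (List K)} (ht : Refines t c.tree) (p : K × List K) (hp : p ∈ t.toList) :
      p.2.length ≤ L := by
    obtain ⟨v, hv, hs⟩ := ht p hp
    exact hs.length_le.trans (hL.2 _ hv)
  refine ⟨⟨hb.1, ?_, heads r1, fun x hx => hc.pre_tail x (r3.subset hx)⟩,
    ⟨hb.2.1, ?_, heads r2, fun x hx => ?_⟩, ⟨r3.length_le.trans hL.1, len r1⟩, ⟨?_, len r2⟩,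
    by simp [e1], by simp [e2], hb.2.2⟩
  · rw [e1]; exact hc.increasing.filter _
  · rw [e2]; exact hc.increasing.filter _
  · rcases r4 with h | ⟨p, hp, h⟩
    · exact hc.pre_tail x (h.subset hx)
    · exact (hc.heads p hp).2 x (h.subset hx)
  · rcases r4 with h | ⟨p, hp, h⟩
    · exact h.length_le.trans hL.1
    · exact h.length_le.trans (hL.2 p hp)

/-! ### Updating the chunks of a C-tree -/

theorem work_keyRanges (g : K → K × List K) (es : List K) :
    (keyRanges (es.map fun e => (some (g e), e))).work = es.length + 1 ∧
    (keyRanges (es.map fun e => (some (g e), e))).depth = es.length + 1 := by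
  induction es with
  | nil => simp [keyRanges]
  | cons e es ih =>
    simp only [List.map_cons, keyRanges, work_bind, depth_bind, ih, work_charge, depth_charge,
      List.length_cons]
    split
    · simp only [work_pure, depth_pure]; omega
    · split_ifs <;> simp only [work_pure, depth_pure] <;> omega

theorem sum_length_keyRanges (g : K → K × List K) (es : List K) :
    ((keyRanges (es.map fun e => (some (g e), e))).val.map fun r => r.2.length).sum = es.length := by
  induction es with
  | nil => simp [keyRanges]
  | cons e es ih =>
    simp only [List.map_cons, keyRanges, val_bind, List.length_cons]
    split
    · rename_i h; rw [h] at ih; simp at ih; simp [← ih]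
    · rename_i h; rw [h] at ih; simp only [List.map_cons, List.sum_cons] at ih
      split_ifs <;> simp <;> omega

/-- If `g e` is the entry of the element `e`, then `keyRanges` forms one range for each entry that
occurs, and this range consists of the elements that belong to the entry. -/
theorem keyRanges_spec (g : K → K × List K) (es : List K)
    (hmono : es.Pairwise fun a b => (g a).1 ≤ (g b).1)
    (hinj : ∀ a ∈ es, ∀ b ∈ es, (g a).1 = (g b).1 → g a = g b) :
    let rs := (keyRanges (es.map fun e => (some (g e), e))).val
    rs.Pairwise (fun r r' => r.1.1 < r'.1.1) ∧
    (∀ r ∈ rs, r.2 = es.filter (fun e => (g e).1 = r.1.1) ∧ r.2 ≠ [] ∧ ∃ e ∈ es, r.1 = g e) ∧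
    ∀ e ∈ es, ∃ r ∈ rs, r.1 = g e := by
  induction es with
  | nil => simp [keyRanges]
  | cons e es ih =>
    rw [List.pairwise_cons] at hmono
    obtain ⟨h1, h2, h3⟩ := ih hmono.2 fun a ha b hb => hinj a (by simp [ha]) b (by simp [hb])
    simp only [List.map_cons, keyRanges, val_bind]
    generalize hrs : (keyRanges (es.map fun e => (some (g e), e))).val = rs at *
    match rs with
    | [] =>
      have : es = [] := List.eq_nil_iff_forall_not_mem.2 fun x hx => by
        obtain ⟨r, hr, -⟩ := h3 x hx
        simp at hr
      simp [this]
    | (g', es') :: rest =>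
      rw [List.pairwise_cons] at h1
      obtain ⟨hes', -, e', he', hg'⟩ := h2 (g', es') (by simp)
      simp only at hes' hg'
      have hge : ∀ r ∈ (g', es') :: rest, (g e).1 ≤ r.1.1 := fun r hr => by
        obtain ⟨-, -, a, ha, hra⟩ := h2 r hr
        rw [hra]; exact hmono.1 a ha
      simp only
      split_ifs with hk
      · simp only [val_pure]
        have hgg : g e = g' := by
          rw [hg'] at hk ⊢
          exact hinj e (by simp) e' (by simp [he']) hk
        refine ⟨List.pairwise_cons.2 ⟨fun r hr => ?_, h1.2⟩, ?_, ?_⟩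
        · rw [hk]; exact h1.1 r hr
        · intro r hr
          rcases List.mem_cons.1 hr with rfl | hr
          · refine ⟨?_, by simp, e, by simp, rfl⟩
            simp [hes', hk]
          · obtain ⟨a1, a2, a3, a4, a5⟩ := h2 r (by simp [hr])
            have : (g e).1 ≠ r.1.1 := by rw [hk]; exact (h1.1 r hr).ne
            exact ⟨by simp [this, ← a1], a2, a3, by simp [a4], a5⟩
        · intro a ha
          rcases List.mem_cons.1 ha with rfl | ha
          · exact ⟨_, List.mem_cons_self, rfl⟩
          · obtain ⟨r, hr, hra⟩ := h3 a ha
            rcases List.mem_cons.1 hr with rfl | hr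
            · exact ⟨_, List.mem_cons_self, by rw [hgg]; exact hra⟩
            · exact ⟨r, by simp [hr], hra⟩
      · simp only [val_pure]
        have hlt : ∀ r ∈ (g', es') :: rest, (g e).1 < r.1.1 := fun r hr => by
          have h0 : (g e).1 < g'.1 := lt_of_le_of_ne (hge (g', es') (by simp)) hk
          rcases List.mem_cons.1 hr with rfl | hr
          · exact h0
          · exact h0.trans (h1.1 r hr)
        refine ⟨List.pairwise_cons.2 ⟨hlt, List.pairwise_cons.2 h1⟩, ?_, ?_⟩
        · intro r hr
          rcases List.mem_cons.1 hr with rfl | hr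
          · have : es.filter (fun a => (g a).1 = (g e).1) = [] := by
              simp only [List.filter_eq_nil_iff, decide_eq_true_eq]
              intro a ha hae
              obtain ⟨r, hr, hra⟩ := h3 a ha
              have := hlt r hr
              rw [hra, hae] at this
              exact this.false
            exact ⟨by simp [this], by simp, e, by simp, rfl⟩
          · obtain ⟨a1, a2, a3, a4, a5⟩ := h2 r hr
            exact ⟨by simp [(hlt r hr).ne, ← a1], a2, a3, by simp [a4], a5⟩
        · intro a ha
          rcases List.mem_cons.1 ha with rfl | ha
          · exact ⟨_, List.mem_cons_self, rfl⟩
          · obtain ⟨r, hr, hra⟩ := h3 a ha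
            exact ⟨r, List.mem_cons_of_mem _ hr, hra⟩

theorem findLE_eq_some {V : Type} {t : Tree K V} (ht : t.Ordered) {x : K}
    (h : ∃ p ∈ t.toList, p.1 ≤ x) :
    ∃ p, (Tree.findLE x none t).val = some p ∧ p ∈ t.toList ∧ p.1 ≤ x ∧
      ∀ q ∈ t.toList, q.1 ≤ x → q.1 ≤ p.1 := by
  rw [Tree.val_findLE x none ht, Option.or_none]
  rcases List.eq_nil_or_concat (t.toList.filter fun p => p.1 ≤ x) with hf | ⟨l, p, hf⟩
  · obtain ⟨p, hp, hpx⟩ := h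
    exact absurd (List.filter_eq_nil_iff.1 hf p hp) (by simpa using hpx)
  · rw [List.concat_eq_append] at hf
    have hs : (t.toList.filter fun p => p.1 ≤ x).Pairwise fun p q => p.1 < q.1 := ht.filter _
    have hp : p ∈ t.toList.filter fun p => p.1 ≤ x := by rw [hf]; simp
    rw [hf, List.pairwise_append] at hs
    refine ⟨p, by rw [hf]; simp, (List.mem_filter.1 hp).1, by simpa using (List.mem_filter.1 hp).2,
      fun q hq hqx => ?_⟩
    have : q ∈ t.toList.filter fun p => p.1 ≤ x := List.mem_filter.2 ⟨hq, by simpa using hqx⟩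
    rw [hf, List.mem_append] at this
    rcases this with h | h
    · exact (hs.2.2 q h p (by simp)).le
    · rw [List.mem_singleton.1 h]

theorem mem_smallest {V : Type} {t : Tree K V} (ht : t.Ordered) :
    (∀ s ∈ (Tree.smallest none t).val,
      (∃ p ∈ t.toList, p.1 = s) ∧ ∀ p ∈ t.toList, s ≤ p.1) ∧
    ((Tree.smallest none t).val = none → t.toList = []) := by
  rw [Tree.val_smallest, Option.or_none]
  rw [Tree.Ordered] at ht
  cases h : t.toList with
  | nil => simp
  | cons p l =>
    rw [h, List.pairwise_cons] at ht
    refine ⟨?_, by simp⟩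
    rintro s hs
    obtain rfl : p.1 = s := by simpa using hs
    refine ⟨⟨p, by simp, rfl⟩, fun q hq => ?_⟩
    rcases List.mem_cons.1 hq with rfl | hq
    · rfl
    · exact (ht.1 q hq).le

/-- The entry of `t` with the largest key `≤ e`.  If there is none, then the value is arbitrary; it is
used only for elements above the smallest key. -/
def floorEntry (t : Tree K (List K)) (e : K) : K × List K :=
  ((Tree.findLE e none t).val).getD (e, [])

theorem floorEntry_spec {t : Tree K (List K)} (ht : t.Ordered) {x : K}
    (h : ∃ p ∈ t.toList, p.1 ≤ x) :
    (Tree.findLE x none t).val = some (floorEntry t x) ∧ floorEntry t x ∈ t.toList ∧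
      (floorEntry t x).1 ≤ x ∧ ∀ q ∈ t.toList, q.1 ≤ x → q.1 ≤ (floorEntry t x).1 := by
  obtain ⟨p, h1, h2⟩ := findLE_eq_some ht h
  rw [floorEntry, h1]
  exact ⟨rfl, h2⟩

/-- The outcome of `updateBC`, with its steps inlined: the range of an element is given by
`floorEntry`. -/
theorem updateBC_eq {op : List K → List K → Cost (List K)} {p : List K} {c : CTree K}
    (hp : p.Pairwise (· < ·)) (hc : c.tree.Ordered) :
    let s := Tree.smallest none c.tree
    let q := splitChunkAt s.val p
    let fm := parMap (fun e => do
      let h ← Tree.findLE e none c.tree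
      pure (h, e)) q.val.2
    let rs := keyRanges (q.val.2.map fun e => (some (floorEntry c.tree e), e))
    let up := parMap (fun r : (K × List K) × List K => do
      let v ← op r.1.2 r.2
      pure (r.1.1, v)) rs.val
    let t := Tree.multiInsert (fun _ v => pure v) c.tree up.val
    let pre := op c.pre q.val.1
    updateBC op p c = ⟨⟨t.val, pre.val⟩,
      s.work + (q.work + (fm.work + (rs.work + (up.work + (t.work + pre.work))))),
      s.depth + (q.depth + (fm.depth + (rs.depth + (up.depth + (t.depth + pre.depth)))))⟩ := by
  intro s q fm rs up t pre
  have hfm : fm.val = q.val.2.map fun e => (some (floorEntry c.tree e), e) := by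
    simp only [fm, val_parMap, val_bind, val_pure]
    refine List.map_congr_left fun e he => ?_
    obtain ⟨-, y, hy, hye⟩ := (mem_splitChunkAt s.val hp e).2.1 he
    obtain ⟨⟨p, hp, rfl⟩, -⟩ := (mem_smallest hc).1 y hy
    rw [(floorEntry_spec hc ⟨p, hp, hye.le⟩).1]
  have : updateBC op p c = (do
      let _ ← s
      let _ ← q
      let _ ← fm
      let ranges ← keyRanges fm.val
      let updates ← parMap (fun r : (K × List K) × List K => do
        let v ← op r.1.2 r.2
        pure (r.1.1, v)) ranges
      let t ← Tree.multiInsert (fun _ v => pure v) c.tree updates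
      let pre ← op c.pre q.val.1
      pure ⟨t, pre⟩) := rfl
  rw [this, hfm]
  rfl

section UpdateBC

variable {op : List K → List K → Cost (List K)} {P : Prop → Prop → Prop}

/-- Facts on the ranges that `updateBC` forms. -/
theorem ranges_spec {p : List K} {c : CTree K} (hp : p.Pairwise (· < ·)) (hc : c.tree.Ordered) :
    let q := splitChunkAt (Tree.smallest none c.tree).val p
    let rs := (keyRanges (q.val.2.map fun e => (some (floorEntry c.tree e), e))).val
    rs.Pairwise (fun r r' => r.1.1 < r'.1.1) ∧
    (∀ r ∈ rs, r.1 ∈ c.tree.toList ∧ r.2.Sublist p ∧ r.2 ≠ [] ∧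
      ∀ x, x ∈ r.2 ↔ x ∈ p ∧ (∃ h ∈ c.tree.toList, h.1 < x) ∧ (floorEntry c.tree x).1 = r.1.1) ∧
    ∀ x ∈ p, (∃ h ∈ c.tree.toList, h.1 < x) → ∃ r ∈ rs, r.1 = floorEntry c.tree x := by
  intro q rs
  have hmem : ∀ x, x ∈ q.val.2 ↔ x ∈ p ∧ ∃ h ∈ c.tree.toList, h.1 < x := fun x => by
    rw [(mem_splitChunkAt _ hp x).2]
    refine and_congr_right fun _ => ⟨?_, ?_⟩
    · rintro ⟨y, hy, hyx⟩
      obtain ⟨⟨h, hh, rfl⟩, -⟩ := (mem_smallest hc).1 y hy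
      exact ⟨h, hh, hyx⟩
    · rintro ⟨h, hh, hx⟩
      cases hs : (Tree.smallest none c.tree).val with
      | none => rw [(mem_smallest hc).2 hs] at hh; simp at hh
      | some y => exact ⟨y, rfl, (((mem_smallest hc).1 y hs).2 h hh).trans_lt hx⟩
  have hsub := (sublist_splitChunkAt (Tree.smallest none c.tree).val p).2
  have hfl : ∀ x ∈ q.val.2, _ := fun x hx =>
    floorEntry_spec hc (x := x) (((hmem x).1 hx).2.imp fun h hh => ⟨hh.1, hh.2.le⟩)
  obtain ⟨h1, h2, h3⟩ := keyRanges_spec (floorEntry c.tree) q.val.2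
    ((hp.sublist hsub).imp_of_mem fun {a b} ha hb hab =>
      (hfl b hb).2.2.2 _ (hfl a ha).2.1 ((hfl a ha).2.2.1.trans hab.le))
    fun a ha b hb hab => Prod.ext hab
      (hc.value_unique (k := (floorEntry c.tree a).1) (hfl a ha).2.1 (hab ▸ (hfl b hb).2.1))
  refine ⟨h1, fun r hr => ?_, fun x hx hh => h3 x ((hmem x).2 ⟨hx, hh⟩)⟩
  obtain ⟨a1, a2, a3, a4, a5⟩ := h2 r hr
  refine ⟨by rw [a5]; exact (hfl _ a4).2.1, by rw [a1]; exact List.filter_sublist.trans hsub, a2,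
    fun x => ?_⟩
  rw [a1, List.mem_filter, hmem, decide_eq_true_eq, and_assoc]

theorem updateBC_valid (hop : IsChunkOp op P) {p : List K} {c : CTree K}
    (hp : p.Pairwise (· < ·)) (hpn : ∀ x ∈ p, isHead x = false) (hc : Valid isHead c) :
    Valid isHead (updateBC op p c).val ∧
      ∀ x, x ∈ (updateBC op p c).val.elems ↔ P (x ∈ c.elems) (x ∈ p) := by
  rw [updateBC_eq hp hc.ordered]
  obtain ⟨h1, h2, h3⟩ := ranges_spec hp hc.ordered
  set q := splitChunkAt (Tree.smallest none c.tree).val p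
  set rs := (keyRanges (q.val.2.map fun e => (some (floorEntry c.tree e), e))).val
  set up := rs.map fun r => (r.1.1, (op r.1.2 r.2).val) with hup
  have hval : (parMap (fun r : (K × List K) × List K => do
      let v ← op r.1.2 r.2
      pure (r.1.1, v)) rs).val = up := rfl
  simp only [hval]
  obtain ⟨b1, b2, -⟩ := Tree.build_spec up
  have bo : (Tree.build up).val.Ordered := by
    rw [Tree.Ordered, b1, hup, List.pairwise_map]; exact h1
  obtain ⟨u1, u2, u3⟩ := Tree.unionWith_spec (fun _ v => pure v) hc.balanced hc.ordered b2 bo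
  have hm : (Tree.multiInsert (fun _ v => pure v) c.tree up).val =
    (Tree.unionWith (fun _ v => pure v) c.tree (Tree.build up).val).val := rfl
  rw [← hm] at u1 u2 u3
  rw [b1] at u3
  set t := (Tree.multiInsert (fun _ v => pure v) c.tree up).val
  -- every entry of `t` arises from an entry of `c` and the elements of `p` in its range
  have key : ∀ k w, (k, w) ∈ t.toList ↔ ∃ v es, (k, v) ∈ c.tree.toList ∧ w = (op v es).val ∧
      es.Sublist p ∧ ∀ x, x ∈ es ↔
        x ∈ p ∧ (∃ h ∈ c.tree.toList, h.1 < x) ∧ (floorEntry c.tree x).1 = k := by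
    have old (k v) (hk : (k, v) ∈ c.tree.toList) (hn : ∀ v, (k, v) ∉ up) :
        ∀ x, x ∈ p → (∃ h ∈ c.tree.toList, h.1 < x) → (floorEntry c.tree x).1 ≠ k := by
      rintro x hx hx' rfl
      obtain ⟨r, hr, hrx⟩ := h3 x hx hx'
      exact hn (op r.1.2 r.2).val (List.mem_map.2 ⟨r, hr, by rw [hrx]⟩)
    intro k w
    rw [u3]
    constructor
    · rintro (⟨hk, hn⟩ | ⟨hk, hn⟩ | ⟨v, v', hk, hk', hw⟩)
      · refine ⟨w, [], hk, (hop.nil w).symm, List.nil_sublist _, fun x => ?_⟩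
        simp only [List.not_mem_nil, false_iff]
        rintro ⟨h1, h2, h3⟩
        exact old k w hk hn x h1 h2 h3
      · obtain ⟨r, hr, he⟩ := List.mem_map.1 hk
        obtain ⟨rfl, rfl⟩ := Prod.mk.inj he
        exact absurd (h2 r hr).1 (hn r.1.2)
      · obtain ⟨r, hr, he⟩ := List.mem_map.1 hk'
        obtain ⟨rfl, rfl⟩ := Prod.mk.inj he
        obtain ⟨a1, a2, -, a3⟩ := h2 r hr
        exact ⟨r.1.2, r.2, a1, hw, a2, a3⟩
    · rintro ⟨v, es, hk, rfl, hes, hmem⟩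
      by_cases hn : ∀ v, (k, v) ∉ up
      · left
        have : es = [] := List.eq_nil_iff_forall_not_mem.2 fun x hx => by
          obtain ⟨a1, a2, a3⟩ := (hmem x).1 hx
          exact old k v hk hn x a1 a2 a3
        rw [this, hop.nil]
        exact ⟨hk, hn⟩
      · push Not at hn
        obtain ⟨w, hw⟩ := hn
        refine .inr (.inr ⟨v, w, hk, hw, ?_⟩)
        obtain ⟨r, hr, he⟩ := List.mem_map.1 hw
        obtain ⟨rfl, rfl⟩ := Prod.mk.inj he
        obtain ⟨a1, a2, -, a3⟩ := h2 r hr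
        have e1 : v = r.1.2 := hc.ordered.value_unique hk a1
        have e2 : es = r.2 := List.Pairwise.eq_of_mem_iff (r := (· < ·)) (hp.sublist hes)
          (hp.sublist a2) fun {x} => by rw [hmem, a3]
        rw [e1, e2]
        rfl
  have hpre : (q.val.1).Pairwise (· < ·) := hp.sublist (sublist_splitChunkAt _ p).1
  have pmem : ∀ x, x ∈ q.val.1 ↔ x ∈ p ∧ ∀ h ∈ c.tree.toList, x < h.1 := fun x => by
    rw [(mem_splitChunkAt _ hp x).1]
    refine and_congr_right fun _ => ⟨fun hx h hh => ?_, fun hx y hy => ?_⟩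
    · cases hs : (Tree.smallest none c.tree).val with
      | none => rw [(mem_smallest hc.ordered).2 hs] at hh; simp at hh
      | some y => exact (hx y hs).trans_le (((mem_smallest hc.ordered).1 y hs).2 h hh)
    · obtain ⟨⟨h, hh, rfl⟩, -⟩ := (mem_smallest hc.ordered).1 y hy
      exact hx h hh
  have hPF : ¬ P False False := by rw [hop.right_false]; exact id
  have premem := hop.mem _ _ hc.pairwise_pre hpre
  -- elements of an updated tail are old elements or elements of `p` with this floor
  have tail : ∀ k w x, (k, w) ∈ t.toList → x ∈ w → isHead x = false ∧ k < x ∧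
      ∀ h ∈ c.tree.toList, k < h.1 → x < h.1 := by
    intro k w x hk hx
    obtain ⟨v, es, hv, rfl, hes, hmem⟩ := (key k w).1 hk
    have hvp := hc.pairwise_tail hv
    rw [hop.mem _ _ hvp.1 (hp.sublist hes)] at hx
    by_cases hxv : x ∈ v
    · exact ⟨(hc.heads _ hv).2 x hxv, hvp.2 x hxv,
        fun h hh hkh => lt_of_pairwise_flat hc.pairwise_flat hv hh hkh (.inr hxv)⟩
    · by_cases hxe : x ∈ es
      · obtain ⟨a1, ⟨h, hh, hhx⟩, a3⟩ := (hmem x).1 hxe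
        obtain ⟨-, f1, f2, f3⟩ := floorEntry_spec hc.ordered (x := x) ⟨h, hh, hhx.le⟩
        rw [a3] at f2 f3
        refine ⟨hpn x a1, lt_of_le_of_ne f2 ?_, fun h hh hkh => ?_⟩
        · rintro rfl
          have := (hc.heads _ hv).1
          rw [hpn _ a1] at this
          simp at this
        · exact not_le.1 fun hle => (f3 h hh hle).not_gt hkh
      · simp only [hxv, hxe] at hx
        exact absurd hx hPF
  have hvalid : Valid isHead ⟨t, (op c.pre q.val.1).val⟩ := by
    refine ⟨u1, ?_, ?_, ?_⟩
    · rw [elems_eq_append, List.pairwise_append]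
      refine ⟨hop.pairwise _ _ hc.pairwise_pre hpre, ?_, ?_⟩
      · rw [pairwise_flat]
        refine ⟨?_, ?_⟩
        · rintro ⟨k, w⟩ hk
          refine List.pairwise_cons.2 ⟨fun x hx => (tail k w x hk hx).2.1, ?_⟩
          obtain ⟨v, es, hv, rfl, hes, -⟩ := (key k w).1 hk
          exact hop.pairwise _ _ (hc.pairwise_tail hv).1 (hp.sublist hes)
        · refine List.Pairwise.imp_of_mem ?_ u2
          rintro ⟨k, w⟩ ⟨k', w'⟩ hk hk' hlt x hx y hy
          obtain ⟨v', es', hv', -⟩ := (key k' w').1 hk'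
          have hy' : k' ≤ y := by
            rcases List.mem_cons.1 hy with rfl | hy
            · rfl
            · exact (tail k' w' y hk' hy).2.1.le
          refine lt_of_lt_of_le ?_ hy'
          rcases List.mem_cons.1 hx with rfl | hx
          · exact hlt
          · exact (tail k w x hk hx).2.2 _ hv' hlt
      · intro x hx y hy
        obtain ⟨⟨k, w⟩, hk, hyk⟩ := mem_flat.1 hy
        obtain ⟨v, es, hv, -⟩ := (key k w).1 hk
        have hky : k ≤ y := by
          rcases hyk with rfl | hyk
          · rfl
          · exact (tail k w y hk hyk).2.1.le
        refine lt_of_lt_of_le ?_ hky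
        rw [premem] at hx
        by_cases hxp : x ∈ c.pre
        · exact hc.pre_lt hxp hv
        · by_cases hxq : x ∈ q.val.1
          · exact ((pmem x).1 hxq).2 _ hv
          · simp only [hxp, hxq] at hx
            exact absurd hx hPF
    · rintro ⟨k, w⟩ hk
      obtain ⟨v, es, hv, -⟩ := (key k w).1 hk
      exact ⟨(hc.heads _ hv).1, fun x hx => (tail k w x hk hx).1⟩
    · intro x hx
      rw [premem] at hx
      by_cases hxp : x ∈ c.pre
      · exact hc.pre_tail x hxp
      · by_cases hxq : x ∈ q.val.1
        · exact hpn x ((pmem x).1 hxq).1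
        · simp only [hxp, hxq] at hx
          exact absurd hx hPF
  refine ⟨hvalid, fun x => ?_⟩
  by_cases hx : ∃ h ∈ c.tree.toList, h.1 ≤ x
  · obtain ⟨-, f1, f2, f3⟩ := floorEntry_spec hc.ordered hx
    generalize hfe : floorEntry c.tree x = e at f1 f2 f3
    classical
    obtain ⟨es, hes⟩ : ∃ es, es = p.filter fun y =>
      (∃ h ∈ c.tree.toList, h.1 < y) ∧ (floorEntry c.tree y).1 = e.1 := ⟨_, rfl⟩
    have hsub : es.Sublist p := by rw [hes]; exact List.filter_sublist
    have hmem : ∀ y, y ∈ es ↔ y ∈ p ∧ (∃ h ∈ c.tree.toList, h.1 < y) ∧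
        (floorEntry c.tree y).1 = e.1 := by simp [hes]
    have ht : (e.1, (op e.2 es).val) ∈ t.toList := (key _ _).2 ⟨e.2, es, f1, rfl, hsub, hmem⟩
    rw [hc.mem_elems_of_floor f1 f2 f3, hvalid.mem_elems_of_floor ht f2 (fun ⟨k, w⟩ hk hkx => by
      obtain ⟨v, es, hv, -⟩ := (key k w).1 hk
      exact f3 (k, v) hv hkx), hop.mem _ _ (hc.pairwise_tail f1).1 (hp.sublist hsub), hmem]
    by_cases hxe : x = e.1
    · have : x ∉ p := fun hx => by
        have h1 := hpn x hx
        rw [hxe, (hc.heads _ f1).1] at h1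
        simp at h1
      simp only [this, false_and, hop.right_false]
    · have : ∃ h ∈ c.tree.toList, h.1 < x := ⟨e, f1, lt_of_le_of_ne f2 (Ne.symm hxe)⟩
      simp only [hxe, false_or, this, hfe, and_true]
  · push Not at hx
    rw [hc.mem_elems_of_lt hx, hvalid.mem_elems_of_lt (fun ⟨k, w⟩ hk => by
      obtain ⟨v, es, hv, -⟩ := (key k w).1 hk
      exact hx (k, v) hv), premem, pmem]
    simp only [and_iff_left hx]

/-- Here `r` is the number of chunks that are updated.  It is bounded both by the number of elements of
`p` and by the number of entries of `c`; for union with a C-tree without heads the second bound is the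
one that matters. -/
theorem updateBC_cost [Fintype K] (hop : IsChunkOp op P) {p : List K} {c : CTree K}
    (hp : p.Pairwise (· < ·)) (hc : Valid isHead c) {L : ℕ}
    (hL : ∀ q ∈ c.tree.toList, q.2.length ≤ L) :
    (∃ r, r ≤ p.length ∧ r ≤ c.tree.toList.length ∧
      (updateBC op p c).work ≤ (p.length + 1) * (c.tree.height + 8) +
        r * (L + 25 * Tree.maxHeight K + 19) + c.pre.length) ∧
    (updateBC op p c).depth ≤ 2 * c.tree.height + 5 * p.length + L + c.pre.length +
      Tree.maxHeight K * (25 * Tree.maxHeight K + 15) + 10 := by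
  rw [updateBC_eq hp hc.ordered]
  obtain ⟨h1, h2, -⟩ := ranges_spec hp hc.ordered
  have hsum := sum_length_keyRanges (floorEntry c.tree)
    (splitChunkAt (Tree.smallest none c.tree).val p).val.2
  have hrs := work_keyRanges (floorEntry c.tree)
    (splitChunkAt (Tree.smallest none c.tree).val p).val.2
  set q := splitChunkAt (Tree.smallest none c.tree).val p with hq
  set rs := keyRanges (q.val.2.map fun e => (some (floorEntry c.tree e), e))
  have hq1 : q.val.1.length ≤ p.length := (sublist_splitChunkAt _ p).1.length_le
  have hq2 : q.val.2.length ≤ p.length := (sublist_splitChunkAt _ p).2.length_le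
  have hqw : q.work ≤ p.length + 1 := work_splitChunkAt_le _ p
  have hqd : q.depth = q.work := depth_splitChunkAt _ p
  have hr1 : rs.val.length ≤ p.length := by
    have := List.card_nsmul_le_sum (rs.val.map fun r => r.2.length) 1 (by
      intro m hm
      obtain ⟨r, hr, rfl⟩ := List.mem_map.1 hm
      exact List.length_pos_iff.2 (h2 r hr).2.2.1)
    rw [hsum] at this
    simp at this
    omega
  have hr2 : rs.val.length ≤ c.tree.toList.length := by
    have hnd : (rs.val.map fun r => r.1).Nodup := List.pairwise_map.2 (h1.imp fun h he =>
      h.ne (congrArg Prod.fst he))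
    have := (List.subperm_of_subset hnd (l₂ := c.tree.toList) (by
      intro e he
      obtain ⟨r, hr, rfl⟩ := List.mem_map.1 he
      exact (h2 r hr).1)).length_le
    simpa using this
  have hsize : rs.val.length.size ≤ Tree.maxHeight K := by
    have := Nat.size_le_size (hr2.trans hc.ordered.length_le_card)
    rw [Tree.maxHeight]
    omega
  have hs := Tree.work_smallest_le none hc.balanced
  have hsd := Tree.depth_smallest none c.tree
  -- the binary searches for the heads
  have hfw := work_parMap_le (f := fun e => do
      let h ← Tree.findLE e none c.tree
      pure (h, e)) (l := q.val.2) (m := c.tree.height + 1) (fun x _ => by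
    simpa using Tree.work_findLE_le x none hc.balanced)
  have hfd := depth_parMap_le (f := fun e => do
      let h ← Tree.findLE e none c.tree
      pure (h, e)) (l := q.val.2) (m := c.tree.height + 1) (fun x _ => by
    simpa [Tree.depth_findLE] using Tree.work_findLE_le x none hc.balanced)
  -- the updates of the chunks
  have hop' : ∀ r ∈ rs.val, (op r.1.2 r.2).work ≤ L + r.2.length + 1 := fun r hr =>
    (hop.work_le _ _).trans (by have := hL _ (h2 r hr).1; omega)
  have huw : (parMap (fun r : (K × List K) × List K => do
      let v ← op r.1.2 r.2
      pure (r.1.1, v)) rs.val).work ≤ rs.val.length * (L + 3) + q.val.2.length := by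
    rw [work_parMap, ← hsum]
    generalize rs.val = l at hop'
    clear * - hop'
    induction l with
    | nil => simp
    | cons r l ih =>
      have e1 := ih fun r hr => hop' r (by simp [hr])
      have e2 := hop' r (by simp)
      simp only [work_bind, work_pure, List.map_cons, List.sum_cons, List.length_cons] at e1 ⊢
      rw [Nat.succ_mul]
      omega
  have hud := depth_parMap_le (f := fun r : (K × List K) × List K => do
      let v ← op r.1.2 r.2
      pure (r.1.1, v)) (l := rs.val) (m := L + p.length + 1) (fun r hr => by
    have e1 := hop' r hr
    have e2 := (h2 r hr).2.1.length_le
    simp only [depth_bind, depth_pure, hop.depth_eq]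
    omega)
  -- the insertion of the new chunks
  set up := (parMap (fun r : (K × List K) × List K => do
      let v ← op r.1.2 r.2
      pure (r.1.1, v)) rs.val).val with hup
  have hlen : up.length = rs.val.length := by rw [hup, val_parMap, List.length_map]
  obtain ⟨b1, b2, b3, b4, b5⟩ := Tree.build_spec up
  have bo : (Tree.build up).val.Ordered := by
    rw [Tree.Ordered, b1, hup, val_parMap, List.pairwise_map]; exact h1
  obtain ⟨u1, u2⟩ := Tree.unionWith_cost (fun _ v => pure v) (fun _ => 0) 0 hc.balanced hc.ordered
    b2 bo (by simp)
  rw [b1] at u1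
  simp only [zero_add, List.map_const', List.sum_replicate, smul_eq_mul] at u1
  rw [b3] at u2
  rw [hlen] at u1 u2 b4 b5
  have hmw : (Tree.multiInsert (fun _ v => pure v) c.tree up).work =
    (Tree.build up).work + (Tree.unionWith (fun _ v => pure v) c.tree (Tree.build up).val).work := rfl
  have hmd : (Tree.multiInsert (fun _ v => pure v) c.tree up).depth =
    (Tree.build up).depth + (Tree.unionWith (fun _ v => pure v) c.tree (Tree.build up).val).depth :=
    rfl
  have hpw := hop.work_le c.pre q.val.1
  have hpd := hop.depth_eq c.pre q.val.1
  refine ⟨⟨rs.val.length, hr1, hr2, ?_⟩, ?_⟩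
  · simp only [hmw]
    have e1 : q.val.2.length * (c.tree.height + 1 + 2) ≤ p.length * (c.tree.height + 1 + 2) := by
      gcongr
    have e2 : (p.length + 1) * (c.tree.height + 8) =
      p.length * (c.tree.height + 1 + 2) + 5 * p.length + c.tree.height + 8 := by ring
    have e3 : rs.val.length * (L + 25 * Tree.maxHeight K + 19) = rs.val.length * (L + 3) +
      rs.val.length * (25 * Tree.maxHeight K + 12) + 4 * rs.val.length := by ring
    omega
  · simp only [hmd]
    have e1 : rs.val.length.size * (25 * Tree.maxHeight K + 11 + 0) ≤
      Tree.maxHeight K * (25 * Tree.maxHeight K + 11) := by gcongr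
    have e2 : Tree.maxHeight K * (25 * Tree.maxHeight K + 15) =
      Tree.maxHeight K * (25 * Tree.maxHeight K + 11) + 4 * Tree.maxHeight K := by ring
    have e3 := (size_le_self q.val.2.length)
    omega

end UpdateBC

/-! ### Union and difference of C-trees -/

/-- The common form of `unionBC` and `diffBC`. -/
def chunkUpdate (op : List K → List K → Cost (List K)) (p : List K) (c : CTree K) :
    Cost (CTree K) := do
  charge 1
  if p.isEmpty then pure c else updateBC op p c

theorem unionBC_eq (p : List K) (c : CTree K) : unionBC p c = chunkUpdate unionChunk p c := rfl

theorem diffBC_eq (p : List K) (c : CTree K) : diffBC c p = chunkUpdate diffChunk p c := rfl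

section ChunkUpdate

variable {op : List K → List K → Cost (List K)} {P : Prop → Prop → Prop}

theorem chunkUpdate_valid (hop : IsChunkOp op P) {p : List K} {c : CTree K}
    (hp : p.Pairwise (· < ·)) (hpn : ∀ x ∈ p, isHead x = false) (hc : Valid isHead c) :
    Valid isHead (chunkUpdate op p c).val ∧
      ∀ x, x ∈ (chunkUpdate op p c).val.elems ↔ P (x ∈ c.elems) (x ∈ p) := by
  simp only [chunkUpdate, val_bind]
  split_ifs with h
  · rw [List.isEmpty_iff] at h
    subst h
    exact ⟨hc, fun x => by simp [hop.right_false]⟩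
  · exact updateBC_valid hop hp hpn hc

theorem chunkUpdate_cost [Fintype K] (hop : IsChunkOp op P) {p : List K} {c : CTree K}
    (hp : p.Pairwise (· < ·)) (hc : Valid isHead c) {L : ℕ}
    (hL : ∀ q ∈ c.tree.toList, q.2.length ≤ L) :
    (∃ r, r ≤ p.length ∧ r ≤ c.tree.toList.length ∧
      (chunkUpdate op p c).work ≤ (p.length + 1) * (c.tree.height + 8) +
        r * (L + 25 * Tree.maxHeight K + 19) + c.pre.length + 1) ∧
    (chunkUpdate op p c).depth ≤ 2 * c.tree.height + 5 * p.length + L + c.pre.length +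
      Tree.maxHeight K * (25 * Tree.maxHeight K + 15) + 11 := by
  simp only [chunkUpdate, work_bind, depth_bind, work_charge, depth_charge]
  split_ifs with h
  · simp only [work_pure, depth_pure]
    exact ⟨⟨0, by omega, by omega, by omega⟩, by omega⟩
  · obtain ⟨⟨r, h1, h2, h3⟩, h4⟩ := updateBC_cost hop hp hc hL
    exact ⟨⟨r, h1, h2, by omega⟩, by omega⟩

end ChunkUpdate

/-- The quantity to which the work of union with, and difference by, the C-tree that consists of `t`
and `p` is charged.  It is linear in the number of elements, and it is additive in the recursion with
one unit left at every node. -/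
def potential (t : Tree K (List K)) (p : List K) : ℕ :=
  2 * t.toList.length + (t.toList.map fun q => q.2.length).sum + p.length + 1

omit [LinearOrder K] in
theorem potential_node (h s : ℕ) (l : Tree K (List K)) (k : K) (v : List K) (r : Tree K (List K))
    (p : List K) : potential (.node h s l k v r) p = potential l p + potential r v + 1 := by
  simp only [potential, Tree.toList_node, List.length_append, List.length_cons, List.map_append,
    List.map_cons, List.sum_append, List.sum_cons]
  ring

omit [LinearOrder K] in
theorem potential_mono (t : Tree K (List K)) {p q : List K} (h : p.length ≤ q.length) :
    potential t p ≤ potential t q := by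
  simp only [potential]; omega

theorem smallest_flat {c : CTree K} (hc : Valid isHead c) :
    ((Tree.smallest none c.tree).val = none ∧ flat c.tree.toList = []) ∨
    ∃ s, (Tree.smallest none c.tree).val = some s ∧ isHead s = true ∧ s ∈ flat c.tree.toList ∧
      ∀ y ∈ flat c.tree.toList, s ≤ y := by
  obtain ⟨h1, h2⟩ := mem_smallest hc.ordered
  cases hs : (Tree.smallest none c.tree).val with
  | none => exact .inl ⟨rfl, by rw [h2 hs]; rfl⟩
  | some s =>
    obtain ⟨⟨p, hp, rfl⟩, hle⟩ := h1 s hs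
    refine .inr ⟨_, rfl, (hc.heads p hp).1, mem_flat.2 ⟨p, hp, .inl rfl⟩, fun y hy => ?_⟩
    obtain ⟨q, hq, hyq⟩ := mem_flat.1 hy
    rcases hyq with rfl | hyq
    · exact hle q hq
    · exact (hle q hq).trans ((hc.pairwise_tail hq).2 y hyq).le

/-- The pieces of the C-tree with root `k2`. -/
theorem valid_node {h s : ℕ} {l2 r2 : Tree K (List K)} {k2 : K} {v2 p2 : List K}
    (hc : Valid isHead ⟨.node h s l2 k2 v2 r2, p2⟩) :
    Valid isHead ⟨l2, p2⟩ ∧ Valid isHead ⟨r2, v2⟩ ∧ isHead k2 = true ∧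
    (∀ x ∈ (⟨l2, p2⟩ : CTree K).elems, x < k2) ∧ (∀ x ∈ (⟨r2, v2⟩ : CTree K).elems, k2 < x) ∧
    ∀ x, x ∈ (⟨.node h s l2 k2 v2 r2, p2⟩ : CTree K).elems ↔
      x ∈ (⟨l2, p2⟩ : CTree K).elems ∨ x = k2 ∨ x ∈ (⟨r2, v2⟩ : CTree K).elems := by
  have hb := hc.balanced
  obtain ⟨-, -, -, -, hbl, hbr⟩ := hb
  have hi := hc.increasing
  have he : (⟨.node h s l2 k2 v2 r2, p2⟩ : CTree K).elems =
      (⟨l2, p2⟩ : CTree K).elems ++ k2 :: (⟨r2, v2⟩ : CTree K).elems := by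
    simp [elems_eq_append]
  rw [he, List.pairwise_append, List.pairwise_cons] at hi
  refine ⟨⟨hbl, hi.1, fun p hp => hc.heads p (by simp [hp]), hc.pre_tail⟩,
    ⟨hbr, hi.2.1.2, fun p hp => hc.heads p (by simp [hp]), (hc.heads (k2, v2) (by simp)).2⟩,
    (hc.heads (k2, v2) (by simp)).1, fun x hx => hi.2.2 x hx k2 (by simp), hi.2.1.1,
    fun x => by rw [he]; simp⟩

theorem Valid.of_pre_sublist {t : Tree K (List K)} {p p' : List K} (hc : Valid isHead ⟨t, p⟩)
    (h : p'.Sublist p) : Valid isHead ⟨t, p'⟩ :=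
  ⟨hc.balanced, hc.increasing.sublist (h.append (List.Sublist.refl _)), hc.heads,
    fun x hx => hc.pre_tail x (h.subset hx)⟩

omit [LinearOrder K] in
theorem ChunksLE.of_node {L h s : ℕ} {l2 r2 : Tree K (List K)} {k2 : K} {v2 p2 : List K}
    (hL : ChunksLE L (⟨.node h s l2 k2 v2 r2, p2⟩ : CTree K)) :
    ChunksLE L (⟨l2, p2⟩ : CTree K) ∧ ChunksLE L (⟨r2, v2⟩ : CTree K) :=
  ⟨⟨hL.1, fun p hp => hL.2 p (by simp [hp])⟩,
    ⟨hL.2 (k2, v2) (by simp), fun p hp => hL.2 p (by simp [hp])⟩⟩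

/-- Joining the results for the parts below and above `k2`. -/
theorem valid_join {c1 c2 : CTree K} {k2 : K} {w : List K} (h1 : Valid isHead c1)
    (h2 : Valid isHead c2) (hpre : c2.pre = []) (hk : isHead k2 = true)
    (hw : ∀ x ∈ w, isHead x = false) (hwp : w.Pairwise (· < ·)) (hlt1 : ∀ x ∈ c1.elems, x < k2)
    (hltw : ∀ x ∈ w, k2 < x) (hlt2 : ∀ y ∈ c2.elems, k2 < y)
    (hlt : ∀ x ∈ w, ∀ y ∈ c2.elems, x < y) :
    Valid isHead ⟨(Tree.join c1.tree k2 w c2.tree).val, c1.pre⟩ ∧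
    ∀ x, x ∈ (⟨(Tree.join c1.tree k2 w c2.tree).val, c1.pre⟩ : CTree K).elems ↔
      x ∈ c1.elems ∨ x = k2 ∨ x ∈ w ∨ x ∈ c2.elems := by
  have he : (⟨(Tree.join c1.tree k2 w c2.tree).val, c1.pre⟩ : CTree K).elems =
      c1.elems ++ k2 :: (w ++ c2.elems) := by
    simp [elems_eq_append, hpre]
  refine ⟨⟨(Tree.balanced_join h1.balanced k2 w h2.balanced).1, ?_, ?_, h1.pre_tail⟩,
    fun x => by rw [he]; simp⟩
  · rw [he, List.pairwise_append, List.pairwise_cons, List.pairwise_append]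
    refine ⟨h1.increasing, ⟨fun x hx => ?_, hwp, h2.increasing, hlt⟩, fun x hx y hy => ?_⟩
    · rcases List.mem_append.1 hx with hx | hx
      · exact hltw x hx
      · exact hlt2 x hx
    · have hxk := hlt1 x hx
      rcases List.mem_cons.1 hy with rfl | hy
      · exact hxk
      · rcases List.mem_append.1 hy with hy | hy
        · exact hxk.trans (hltw y hy)
        · exact hxk.trans (hlt2 y hy)
  · intro p hp
    rw [Tree.toList_join, List.mem_append, List.mem_cons] at hp
    rcases hp with hp | rfl | hp
    · exact h1.heads p hp
    · exact ⟨hk, hw⟩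
    · exact h2.heads p hp

/-- Work per unit of potential, and depth per level, of union and difference. -/
def stepCost (K : Type) [Fintype K] (L : ℕ) : ℕ := 50 * (L + Tree.maxHeight K + 1)

/-- Depth of the update of a C-tree by a chunk. -/
def leafDepth (K : Type) [Fintype K] (L : ℕ) : ℕ :=
  Tree.maxHeight K * (25 * Tree.maxHeight K + 15) + 2 * Tree.maxHeight K + 7 * L + 12

/-- The outcome of one step of `unionAux`, apart from costs.  Here `t1`, `p1` is the part of the first
C-tree above `k2`, and `t2`, `p2` that of the second one. -/
theorem union_step {t1 t2 : Tree K (List K)} {p1 p2 : List K} {k2 : K}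
    (h1 : Valid isHead ⟨t1, p1⟩) (h2 : Valid isHead ⟨t2, p2⟩)
    (hk1 : ∀ x ∈ (⟨t1, p1⟩ : CTree K).elems, k2 < x)
    (hk2 : ∀ x ∈ (⟨t2, p2⟩ : CTree K).elems, k2 < x) :
    let v := (splitChunkAt (Tree.smallest none t1).val p2).val
    let p := (splitChunkAt (Tree.smallest none t2).val p1).val
    let w := (unionChunk v.1 p.1).val
    (∀ x ∈ w, isHead x = false) ∧ w.Pairwise (· < ·) ∧ (∀ x ∈ w, k2 < x) ∧
    ∀ c : CTree K, Valid isHead c →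
      (∀ x, x ∈ c.elems ↔ x ∈ (⟨t1, p.2⟩ : CTree K).elems ∨ x ∈ (⟨t2, v.2⟩ : CTree K).elems) →
      c.pre = [] ∧ (∀ y ∈ c.elems, k2 < y) ∧ (∀ x ∈ w, ∀ y ∈ c.elems, x < y) ∧
      ∀ x, x ∈ w ∨ x ∈ c.elems ↔
        x ∈ (⟨t1, p1⟩ : CTree K).elems ∨ x ∈ (⟨t2, p2⟩ : CTree K).elems := by
  intro v p w
  have mv : ∀ x, (x ∈ v.1 ↔ _) ∧ (x ∈ v.2 ↔ _) := mem_splitChunkAt _ h2.pairwise_pre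
  have mp : ∀ x, (x ∈ p.1 ↔ _) ∧ (x ∈ p.2 ↔ _) := mem_splitChunkAt _ h1.pairwise_pre
  have sv1 : v.1.Sublist p2 := (sublist_splitChunkAt _ _).1
  have sp1 : p.1.Sublist p1 := (sublist_splitChunkAt _ _).1
  have pv1 := h2.pairwise_pre.sublist sv1
  have pp1 := h1.pairwise_pre.sublist sp1
  have mw : ∀ x, x ∈ w ↔ x ∈ v.1 ∨ x ∈ p.1 := isChunkOp_union.mem _ _ pv1 pp1
  have i1 : ∀ a ∈ p1, ∀ b ∈ flat t1.toList, a < b := (List.pairwise_append.1 h1.increasing).2.2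
  have i2 : ∀ a ∈ p2, ∀ b ∈ flat t2.toList, a < b := (List.pairwise_append.1 h2.increasing).2.2
  have n1 := h1.pre_tail
  have n2 := h2.pre_tail
  have s1 := smallest_flat h1
  have s2 := smallest_flat h2
  simp only [elems_eq_append, List.mem_append] at *
  generalize (Tree.smallest none t1).val = o1 at *
  generalize (Tree.smallest none t2).val = o2 at *
  generalize flat t1.toList = f1 at *
  generalize flat t2.toList = f2 at *
  refine ⟨?_, isChunkOp_union.pairwise _ _ pv1 pp1, ?_, ?_⟩
  · intro x hx
    rcases (mw x).1 hx with h | h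
    · exact n2 x (sv1.subset h)
    · exact n1 x (sp1.subset h)
  · intro x hx
    rcases (mw x).1 hx with h | h
    · exact hk2 x (.inl (sv1.subset h))
    · exact hk1 x (.inl (sp1.subset h))
  · intro c hc hmem
    refine ⟨hc.pre_eq_nil fun x hx => ?_, fun y hy => ?_, fun x hx y hy => ?_, fun x => ?_⟩
    · simp only [elems_eq_append, List.mem_append] at hx ⊢
      rw [hmem] at hx
      simp only [hmem]
      rw [(mp x).2, (mv x).2] at hx
      grind
    · rw [hmem, (mp y).2, (mv y).2] at hy
      grind
    · rw [hmem, (mp y).2, (mv y).2] at hy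
      rw [mw, (mv x).1, (mp x).1] at hx
      grind
    · rw [hmem, (mp x).2, (mv x).2, mw, (mv x).1, (mp x).1]
      grind

/-- Union with a C-tree `c` that has no heads.  The height of `t2` is bounded by its number of nodes
here, so that the work is linear in the potential although `c.pre` may be longer than `t2`. -/
theorem unionBC_pre_spec [Fintype K] {L : ℕ} {c : CTree K} {t2 : Tree K (List K)} {p2 : List K}
    (hc : Valid isHead c) (hleaf : c.tree = .leaf) (hc2 : Valid isHead ⟨t2, p2⟩)
    (hL : ChunksLE L c) (hL2 : ChunksLE L ⟨t2, p2⟩) :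
    Valid isHead (unionBC c.pre ⟨t2, p2⟩).val ∧
    (∀ x, x ∈ (unionBC c.pre ⟨t2, p2⟩).val.elems ↔
      x ∈ c.elems ∨ x ∈ (⟨t2, p2⟩ : CTree K).elems) ∧
    (unionBC c.pre ⟨t2, p2⟩).work + 1 ≤ stepCost K L * potential t2 p2 ∧
    (unionBC c.pre ⟨t2, p2⟩).depth + 1 ≤ leafDepth K L := by
  rw [unionBC_eq]
  obtain ⟨h1, h2⟩ := chunkUpdate_valid isChunkOp_union hc.pairwise_pre hc.pre_tail hc2
  obtain ⟨⟨r, h3, h4, h5⟩, h6⟩ := chunkUpdate_cost isChunkOp_union hc.pairwise_pre hc2 hL2.2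
  have hh := Tree.height_le_maxHeight hc2.balanced hc2.ordered
  have hh' := hc2.balanced.height_le_length
  have hpre := hL.1
  have hp2 : p2.length ≤ L := hL2.1
  simp only at h4 h5 h6 hh hh'
  refine ⟨h1, fun x => ?_, ?_, ?_⟩
  · rw [h2, elems_eq_append c, hleaf]
    simp [or_comm]
  · set B := L + Tree.maxHeight K + 1 with hB
    set m := t2.toList.length
    have e1 : (c.pre.length + 1) * (t2.height + 8) ≤ B * (m + 8) := by gcongr; omega
    have e2 : r * (L + 25 * Tree.maxHeight K + 19) ≤ m * (25 * B) := by gcongr; omega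
    have e3 : p2.length ≤ B * p2.length := Nat.le_mul_of_pos_left _ (by omega)
    have e4 : stepCost K L * potential t2 p2 = 100 * (B * m) +
        50 * B * (t2.toList.map fun q => q.2.length).sum + 50 * (B * p2.length) + 50 * B := by
      simp only [stepCost, potential]; ring
    have e5 : B * (m + 8) + m * (25 * B) = 26 * (B * m) + 8 * B := by ring
    omega
  · simp only [leafDepth]; omega

/-- Correctness and cost of union.  All pieces that occur in the recursion are parts of the two C-trees,
so their chunks are no longer than `L`. -/
theorem unionAux_spec [Fintype K] {L : ℕ} {c : CTree K} {t2 : Tree K (List K)} {p2 : List K}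
    (hc : Valid isHead c) (hc2 : Valid isHead ⟨t2, p2⟩) (hL : ChunksLE L c)
    (hL2 : ChunksLE L ⟨t2, p2⟩) :
    Valid isHead (unionAux c t2 p2).val ∧
    (∀ x, x ∈ (unionAux c t2 p2).val.elems ↔ x ∈ c.elems ∨ x ∈ (⟨t2, p2⟩ : CTree K).elems) ∧
    (unionAux c t2 p2).work ≤ stepCost K L * potential t2 p2 ∧
    (unionAux c t2 p2).depth ≤ t2.height * stepCost K L + leafDepth K L := by
  induction t2 generalizing c p2 with
  | leaf =>
    simp only [unionAux, val_bind, work_bind, depth_bind, work_charge, depth_charge]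
    split_ifs with hleaf
    · obtain ⟨h1, h2, h3, h4⟩ := unionBC_pre_spec hc (Tree.isLeaf_iff.1 hleaf) hc2 hL hL2
      exact ⟨h1, h2, by omega, by omega⟩
    · rw [unionBC_eq]
      obtain ⟨h1, h2⟩ := chunkUpdate_valid isChunkOp_union hc2.pairwise_pre hc2.pre_tail hc
      obtain ⟨⟨r, h3, h4, h5⟩, h6⟩ := chunkUpdate_cost isChunkOp_union hc2.pairwise_pre hc hL.2
      have hh := Tree.height_le_maxHeight hc.balanced hc.ordered
      have hpre := hL.1
      have hp2 : p2.length ≤ L := hL2.1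
      simp only at h3 h5 h6
      refine ⟨h1, fun x => by rw [h2]; simp [elems_eq_append], ?_, ?_⟩
      · have e1 : (p2.length + 1) * (c.tree.height + 8) ≤
            (p2.length + 1) * (Tree.maxHeight K + 8) := by gcongr
        have e2 : r * (L + 25 * Tree.maxHeight K + 19) ≤
            (p2.length + 1) * (L + 25 * Tree.maxHeight K + 19) := by gcongr; omega
        have e3 : (p2.length + 1) * (Tree.maxHeight K + 8) +
            (p2.length + 1) * (L + 25 * Tree.maxHeight K + 19) + (p2.length + 1) * (L + 3) ≤
            stepCost K L * potential .leaf p2 := by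
          simp only [stepCost, potential, Tree.toList_leaf, List.length_nil, List.map_nil,
            List.sum_nil, mul_zero, zero_add]
          rw [← mul_add, ← mul_add, mul_comm]
          gcongr
          omega
        have e4 : L + 3 ≤ (p2.length + 1) * (L + 3) := Nat.le_mul_of_pos_left _ (by omega)
        omega
      · simp only [leafDepth, Tree.height_leaf]; omega
  | node m s l2 k2 v2 r2 ihl ihr =>
    simp only [unionAux, val_bind, work_bind, depth_bind, work_charge, depth_charge]
    split_ifs with hleaf
    · obtain ⟨h1, h2, h3, h4⟩ := unionBC_pre_spec hc (Tree.isLeaf_iff.1 hleaf) hc2 hL hL2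
      exact ⟨h1, h2, by omega, by omega⟩
    obtain ⟨vl, vr, hk, hlk, hrk, hmem2⟩ := valid_node hc2
    obtain ⟨cl, cr⟩ := hL2.of_node
    obtain ⟨b1, b2, L1, L2, m1, m2, bw⟩ := split_spec hc hL k2
    simp only [val_bind, work_bind, depth_bind, val_par, work_par, depth_par, val_pure, work_pure,
      depth_pure]
    set b := (split c k2).val with hb
    set v := splitChunkAt (Tree.smallest none b.2.tree).val v2
    set p := splitChunkAt (Tree.smallest none r2).val b.2.pre
    obtain ⟨w1, w2, w3, hstep⟩ := union_step b2 vr (fun x hx => ((m2 x).1 hx).2) hrk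
    have sv1 : v.val.1.Sublist v2 := (sublist_splitChunkAt _ _).1
    have sv2 : v.val.2.Sublist v2 := (sublist_splitChunkAt _ _).2
    have sp1 : p.val.1.Sublist b.2.pre := (sublist_splitChunkAt _ _).1
    have sp2 : p.val.2.Sublist b.2.pre := (sublist_splitChunkAt _ _).2
    obtain ⟨lv, lm, lw, ld⟩ := ihl b1 vl L1 cl
    obtain ⟨rv, rm, rw', rd⟩ := ihr
      (show Valid isHead ⟨b.2.tree, p.val.2⟩ from b2.of_pre_sublist sp2) (vr.of_pre_sublist sv2)
      ⟨sp2.length_le.trans L2.1, L2.2⟩ ⟨sv2.length_le.trans cr.1, cr.2⟩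
    obtain ⟨hpre, hlt2, hltw, hm⟩ := hstep _ rv rm
    obtain ⟨jv, jm⟩ := valid_join lv rv hpre hk w1 w2 (fun x hx => by
      rcases (lm x).1 hx with h | h
      · exact ((m1 x).1 h).2
      · exact hlk x h) w3 hlt2 hltw
    refine ⟨jv, fun x => ?_, ?_⟩
    · rw [jm, lm, hm, m1, m2, hmem2]
      rcases lt_trichotomy x k2 with h | h | h
      · have := h.ne; have := h.not_gt; tauto
      · simp [h]
      · have := h.ne'; have := h.not_gt; tauto
    · -- the costs of the steps apart from the recursive calls
      have g1 := Tree.work_smallest_le none b2.balanced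
      have g2 := Tree.work_smallest_le none vr.balanced
      have g3 : v.work ≤ v2.length + 1 := work_splitChunkAt_le _ _
      have g4 : p.work ≤ b.2.pre.length + 1 := work_splitChunkAt_le _ _
      have g5 := isChunkOp_union.work_le v.val.1 p.val.1
      have g6 := Tree.work_join_le lv.balanced k2 (unionChunk v.val.1 p.val.1).val rv.balanced
      have d3 : v.depth = v.work := depth_splitChunkAt _ _
      have d4 : p.depth = p.work := depth_splitChunkAt _ _
      have k1 := Tree.height_le_maxHeight b2.balanced b2.ordered
      have k2' := Tree.height_le_maxHeight vr.balanced vr.ordered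
      have k3 := Tree.height_le_maxHeight lv.balanced lv.ordered
      have k4 := Tree.height_le_maxHeight rv.balanced rv.ordered
      have i1 := sv1.length_le
      have i2 := sp1.length_le
      have i3 : v2.length ≤ L := cr.1
      have i4 := L2.1
      have pn := potential_node m s l2 k2 v2 r2 p2
      have pm := potential_mono r2 sv2.length_le
      simp only at k2' g2
      have hB : stepCost K L = 50 * (L + Tree.maxHeight K + 1) := rfl
      constructor
      · have e1 : stepCost K L * potential r2 v.val.2 ≤ stepCost K L * potential r2 v2 := by gcongr
        have e2 : stepCost K L * potential (.node m s l2 k2 v2 r2) p2 =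
          stepCost K L * potential l2 p2 + stepCost K L * potential r2 v2 + stepCost K L := by
          rw [pn]; ring
        omega
      · have hh : (Tree.node m s l2 k2 v2 r2).height = max l2.height r2.height + 1 :=
          hc2.balanced.1
        have e1 : l2.height * stepCost K L ≤ max l2.height r2.height * stepCost K L := by
          gcongr; omega
        have e2 : r2.height * stepCost K L ≤ max l2.height r2.height * stepCost K L := by
          gcongr; omega
        rw [hh, add_mul, one_mul, depth_split, Tree.depth_smallest, Tree.depth_smallest, d3, d4,
          isChunkOp_union.depth_eq, Tree.depth_join]
        omega

omit [LinearOrder K] in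
theorem depth_join2 (c1 c2 : CTree K) : (join2 c1 c2).depth = (join2 c1 c2).work := by
  unfold join2
  split <;> simp [appendChunk, Tree.depth_splitLast, Tree.depth_join]

/-- The work for the concatenated chunk is bounded by the length of chunks in the outcome, not by that of
the two given ones. -/
theorem join2_spec [Fintype K] {L : ℕ} {c1 c2 : CTree K} (h1 : Valid isHead c1)
    (h2 : Valid isHead c2) (hlt : ∀ x ∈ c1.elems, ∀ y ∈ c2.elems, x < y) :
    Valid isHead (join2 c1 c2).val ∧
    (∀ x, x ∈ (join2 c1 c2).val.elems ↔ x ∈ c1.elems ∨ x ∈ c2.elems) ∧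
    (ChunksLE L (join2 c1 c2).val → (join2 c1 c2).work ≤ 21 * Tree.maxHeight K + L + 9) := by
  obtain ⟨t1, p1⟩ := c1
  have hpw : ((⟨t1, p1⟩ : CTree K).elems ++ c2.elems).Pairwise (· < ·) :=
    List.pairwise_append.2 ⟨h1.increasing, h2.increasing, hlt⟩
  cases t1 with
  | leaf =>
    have he : (join2 ⟨.leaf, p1⟩ c2).val.elems = (⟨.leaf, p1⟩ : CTree K).elems ++ c2.elems := by
      simp [join2, elems_eq_append, appendChunk]
    refine ⟨⟨h2.balanced, he ▸ hpw, h2.heads, fun x hx => ?_⟩, fun x => by simp [he], fun hL => ?_⟩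
    · rcases List.mem_append.1 (show x ∈ p1 ++ c2.pre from hx) with hx | hx
      · exact h1.pre_tail x hx
      · exact h2.pre_tail x hx
    · have : (p1 ++ c2.pre).length ≤ L := hL.1
      rw [List.length_append] at this
      simp only [join2, appendChunk, work_bind, work_charge, work_pure]
      omega
  | node m s l k v r =>
    have hh1 := Tree.height_le_maxHeight h1.balanced h1.ordered
    have hh2 := Tree.height_le_maxHeight h2.balanced h2.ordered
    obtain ⟨hm, -, e1, e2, hl, hr⟩ := h1.balanced
    simp only at hh1 hh2 hm e1 e2 hl hr
    obtain ⟨s1, s2, s3⟩ := Tree.balanced_splitLast k v hl hr e2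
    have hlist := Tree.toList_splitLast l k v r
    obtain ⟨q, hq⟩ : ∃ q, (Tree.splitLast l k v r).val = q := ⟨_, rfl⟩
    rw [hq] at s1 s2 s3 hlist
    have hval : (join2 ⟨.node m s l k v r, p1⟩ c2).val =
        ⟨(Tree.join q.1 q.2.1 (q.2.2 ++ c2.pre) c2.tree).val, p1⟩ := by
      simp [join2, appendChunk, hq]
    have he : (join2 ⟨.node m s l k v r, p1⟩ c2).val.elems =
        (⟨.node m s l k v r, p1⟩ : CTree K).elems ++ c2.elems := by
      rw [hval]
      simp only [elems_eq_append, Tree.toList_join, flat_append, flat_cons, Tree.toList_node]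
      have := congrArg (fun e => p1 ++ (flat e ++ (c2.pre ++ flat c2.tree.toList))) hlist
      simpa using this
    refine ⟨⟨?_, he ▸ hpw, ?_, ?_⟩, fun x => by simp [he], fun hL => ?_⟩
    · rw [hval]; exact (Tree.balanced_join s1 q.2.1 _ h2.balanced).1
    · rw [hval]
      have hq2 := h1.heads (q.2.1, q.2.2) (by
        rw [Tree.toList_node, ← hlist]; simp)
      intro p hp
      rw [Tree.toList_join, List.mem_append, List.mem_cons] at hp
      rcases hp with hp | rfl | hp
      · exact h1.heads p (by rw [Tree.toList_node, ← hlist]; simp [hp])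
      · refine ⟨hq2.1, fun x hx => ?_⟩
        rcases List.mem_append.1 hx with hx | hx
        · exact hq2.2 x hx
        · exact h2.pre_tail x hx
      · exact h2.heads p hp
    · rw [hval]; exact h1.pre_tail
    · rw [hval] at hL
      have hw : (q.2.2 ++ c2.pre).length ≤ L := hL.2 (q.2.1, q.2.2 ++ c2.pre) (by simp)
      rw [List.length_append] at hw
      have hj := Tree.work_join_le s1 q.2.1 (q.2.2 ++ c2.pre) h2.balanced
      have hwork : (join2 ⟨.node m s l k v r, p1⟩ c2).work = (Tree.splitLast l k v r).work +
          (q.2.2.length + c2.pre.length + 1 +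
            (Tree.join q.1 q.2.1 (q.2.2 ++ c2.pre) c2.tree).work) := by
        simp [join2, appendChunk, hq]
      rw [Tree.height_node] at hh1
      omega

/-! ### Runs of elements that are not heads -/

/-- In `S`, at most `L` elements in a row are not heads.  The condition is stated for the elements in
an interval with arbitrary ends `x`, `y`. -/
def RunsLE (isHead : K → Bool) (L : ℕ) (S : Finset K) : Prop :=
  ∀ x y, (∀ z ∈ S, x ≤ z → z ≤ y → isHead z = false) → #{z ∈ S | x ≤ z ∧ z ≤ y} ≤ L

/-- `D` is a part of `S` that contains all elements of `S` between two elements of `D`. -/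
def ConvexIn (D : K → Prop) (S : Finset K) : Prop :=
  (∀ x, D x → x ∈ S) ∧ ∀ x y z, D x → D z → y ∈ S → x ≤ y → y ≤ z → D y

/-- A sequence of elements that are not heads is a run of `S`, if nothing of `S` is missing in it. -/
theorem length_le_of_runsLE {L : ℕ} {S : Finset K} (hS : RunsLE isHead L S) {a ch b : List K}
    (hl : (a ++ ch ++ b).Pairwise (· < ·)) (hn : ∀ x ∈ ch, isHead x = false)
    (hc : ConvexIn (fun x => x ∈ a ++ ch ++ b) S) : ch.length ≤ L := by
  rcases ch.eq_nil_or_concat with rfl | ⟨ch', z, hz⟩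
  · simp
  cases ch with
  | nil => simp
  | cons x ch =>
    have hzm : z ∈ x :: ch := by rw [hz]; simp
    have hsort := (List.pairwise_append.1 (List.pairwise_append.1 hl).1).2.1
    have hxle : ∀ y ∈ x :: ch, x ≤ y := by
      intro y hy
      rcases List.mem_cons.1 hy with rfl | hy
      · rfl
      · exact ((List.pairwise_cons.1 hsort).1 y hy).le
    have hzle : ∀ y ∈ x :: ch, y ≤ z := by
      intro y hy
      rw [hz, List.concat_eq_append] at hy hsort
      rcases List.mem_append.1 hy with hy | hy
      · exact ((List.pairwise_append.1 hsort).2.2 y hy z (by simp)).le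
      · rw [List.mem_singleton.1 hy]
    have hin : ∀ y ∈ S, x ≤ y → y ≤ z → y ∈ x :: ch := by
      intro y hy hxy hyz
      have := hc.2 x y z (by simp) (List.mem_append_left _ (List.mem_append_right _ hzm)) hy hxy hyz
      rw [List.pairwise_append, List.pairwise_append] at hl
      rcases List.mem_append.1 this with h | h
      · rcases List.mem_append.1 h with h | h
        · exact absurd (hl.1.2.2 y h x (by simp)) hxy.not_gt
        · exact h
      · exact absurd (hl.2.2 z (List.mem_append_right _ hzm) y h) hyz.not_gt
    have hnd : (x :: ch).Nodup := hsort.imp ne_of_lt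
    calc (x :: ch).length = #(x :: ch).toFinset := (List.toFinset_card_of_nodup hnd).symm
      _ ≤ #{y ∈ S | x ≤ y ∧ y ≤ z} := by
        refine Finset.card_le_card fun y hy => ?_
        rw [List.mem_toFinset] at hy
        exact Finset.mem_filter.2 ⟨hc.1 y (List.mem_append_left _ (List.mem_append_right _ hy)),
          hxle y hy, hzle y hy⟩
      _ ≤ L := hS x z fun y hy h1 h2 => hn y (hin y hy h1 h2)

theorem chunksLE_of_runsLE {L : ℕ} {S : Finset K} (hS : RunsLE isHead L S) {c : CTree K}
    (hc : Valid isHead c) (hD : ConvexIn (fun x => x ∈ c.elems) S) : ChunksLE L c := by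
  constructor
  · exact length_le_of_runsLE hS (a := []) (ch := c.pre) (b := flat c.tree.toList)
      hc.increasing hc.pre_tail hD
  · intro p hp
    obtain ⟨l1, l2, e⟩ := List.append_of_mem hp
    have he : c.elems = (c.pre ++ flat l1 ++ [p.1]) ++ p.2 ++ flat l2 := by
      simp [elems_eq_append, e]
    have := hc.increasing
    rw [he] at this hD
    exact length_le_of_runsLE hS this (hc.heads p hp).2 hD

/-- Correctness and cost of difference.  `join2` concatenates chunks, so chunks can grow in the course
of the recursion; but every intermediate result is an interval of the final result `S`, and therefore
its chunks are runs of `S`. -/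
theorem diffAux_spec [Fintype K] {L : ℕ} {S : Finset K} (hS : RunsLE isHead L S) {c : CTree K}
    {t2 : Tree K (List K)} {p2 : List K} (hc : Valid isHead c) (hc2 : Valid isHead ⟨t2, p2⟩)
    (hL : ChunksLE L c) (hL2 : ChunksLE L ⟨t2, p2⟩)
    (hD : ConvexIn (fun x => x ∈ c.elems ∧ x ∉ (⟨t2, p2⟩ : CTree K).elems) S) :
    Valid isHead (diffAux c t2 p2).val ∧
    (∀ x, x ∈ (diffAux c t2 p2).val.elems ↔ x ∈ c.elems ∧ x ∉ (⟨t2, p2⟩ : CTree K).elems) ∧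
    (diffAux c t2 p2).work ≤ stepCost K L * potential t2 p2 ∧
    (diffAux c t2 p2).depth ≤ t2.height * stepCost K L + leafDepth K L := by
  induction t2 generalizing c p2 with
  | leaf =>
    rw [diffAux, diffBC_eq]
    obtain ⟨h1, h2⟩ := chunkUpdate_valid isChunkOp_diff hc2.pairwise_pre hc2.pre_tail hc
    obtain ⟨⟨r, h3, h4, h5⟩, h6⟩ := chunkUpdate_cost isChunkOp_diff hc2.pairwise_pre hc hL.2
    have hh := Tree.height_le_maxHeight hc.balanced hc.ordered
    have hpre := hL.1
    have hp2 : p2.length ≤ L := hL2.1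
    simp only at h3 h5 h6
    refine ⟨h1, fun x => by rw [h2]; simp [elems_eq_append], ?_, ?_⟩
    · have e1 : (p2.length + 1) * (c.tree.height + 8) ≤
          (p2.length + 1) * (Tree.maxHeight K + 8) := by gcongr
      have e2 : r * (L + 25 * Tree.maxHeight K + 19) ≤
          (p2.length + 1) * (L + 25 * Tree.maxHeight K + 19) := by gcongr; omega
      have e3 : (p2.length + 1) * (Tree.maxHeight K + 8) +
          (p2.length + 1) * (L + 25 * Tree.maxHeight K + 19) + (p2.length + 1) * (L + 3) ≤
          stepCost K L * potential .leaf p2 := by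
        simp only [stepCost, potential, Tree.toList_leaf, List.length_nil, List.map_nil,
          List.sum_nil, mul_zero, zero_add]
        rw [← mul_add, ← mul_add, mul_comm]
        gcongr
        omega
      have e4 : L + 3 ≤ (p2.length + 1) * (L + 3) := Nat.le_mul_of_pos_left _ (by omega)
      omega
    · simp only [leafDepth, Tree.height_leaf]; omega
  | node m s l2 k2 v2 r2 ihl ihr =>
    have hB : stepCost K L = 50 * (L + Tree.maxHeight K + 1) := rfl
    have pn := potential_node m s l2 k2 v2 r2 p2
    simp only [diffAux, val_bind, work_bind, depth_bind, work_charge, depth_charge]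
    split_ifs with hempty
    · rw [Bool.and_eq_true, Tree.isLeaf_iff, List.isEmpty_iff] at hempty
      have he : c.elems = [] := by simp [elems_eq_append, hempty]
      simp only [val_pure, work_pure, depth_pure]
      refine ⟨hc, by simp [he], ?_, by simp only [leafDepth]; omega⟩
      have : 1 ≤ stepCost K L * potential (.node m s l2 k2 v2 r2) p2 :=
        Nat.mul_pos (by omega) (by omega)
      omega
    obtain ⟨vl, vr, hk, hlk, hrk, hmem2⟩ := valid_node hc2
    obtain ⟨cl, cr⟩ := hL2.of_node
    obtain ⟨b1, b2, L1, L2, m1, m2, bw⟩ := split_spec hc hL k2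
    simp only [val_bind, work_bind, depth_bind, val_par, work_par, depth_par]
    set b := (split c k2).val with hb
    have hl : ∀ x, x ∈ b.1.elems ∧ x ∉ (⟨l2, p2⟩ : CTree K).elems ↔
        (x ∈ c.elems ∧ x ∉ (⟨.node m s l2 k2 v2 r2, p2⟩ : CTree K).elems) ∧ x < k2 := fun x => by
      rw [m1, hmem2]
      constructor
      · rintro ⟨⟨h1, h2⟩, h3⟩
        refine ⟨⟨h1, ?_⟩, h2⟩
        rintro (h | h | h)
        · exact h3 h
        · exact h2.ne h
        · exact h2.not_gt (hrk x h)
      · exact fun ⟨⟨h1, h2⟩, h3⟩ => ⟨⟨h1, h3⟩, fun h => h2 (.inl h)⟩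
    have hr : ∀ x, x ∈ b.2.elems ∧ x ∉ (⟨r2, v2⟩ : CTree K).elems ↔
        (x ∈ c.elems ∧ x ∉ (⟨.node m s l2 k2 v2 r2, p2⟩ : CTree K).elems) ∧ k2 < x := fun x => by
      rw [m2, hmem2]
      constructor
      · rintro ⟨⟨h1, h2⟩, h3⟩
        refine ⟨⟨h1, ?_⟩, h2⟩
        rintro (h | h | h)
        · exact h2.not_gt (hlk x h)
        · exact h2.ne' h
        · exact h3 h
      · exact fun ⟨⟨h1, h2⟩, h3⟩ => ⟨⟨h1, h3⟩, fun h => h2 (.inr (.inr h))⟩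
    obtain ⟨lv, lm, lw, ld⟩ := ihl b1 vl L1 cl (by
      simp only [hl]
      exact ⟨fun x hx => hD.1 x hx.1, fun x y z hx hz hy hxy hyz =>
        ⟨hD.2 x y z hx.1 hz.1 hy hxy hyz, hyz.trans_lt hz.2⟩⟩)
    obtain ⟨rv, rm, rw', rd⟩ := ihr b2 vr L2 cr (by
      simp only [hr]
      exact ⟨fun x hx => hD.1 x hx.1, fun x y z hx hz hy hxy hyz =>
        ⟨hD.2 x y z hx.1 hz.1 hy hxy hyz, hx.2.trans_le hxy⟩⟩)
    obtain ⟨jv, jm, jw⟩ := join2_spec (L := L) lv rv fun x hx y hy =>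
      ((hl x).1 ((lm x).1 hx)).2.trans ((hr y).1 ((rm y).1 hy)).2
    have hmem : ∀ x, x ∈ (join2 (diffAux b.1 l2 p2).val (diffAux b.2 r2 v2).val).val.elems ↔
        x ∈ c.elems ∧ x ∉ (⟨.node m s l2 k2 v2 r2, p2⟩ : CTree K).elems := fun x => by
      rw [jm, lm, rm, hl, hr, ← and_or_left, and_iff_left_of_imp]
      intro h
      refine lt_or_gt_of_ne fun hx => h.2 ?_
      rw [hmem2]
      exact .inr (.inl hx)
    have hw := jw (chunksLE_of_runsLE hS jv (by simpa only [hmem] using hD))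
    refine ⟨jv, hmem, ?_, ?_⟩
    · have e2 : stepCost K L * potential (.node m s l2 k2 v2 r2) p2 =
        stepCost K L * potential l2 p2 + stepCost K L * potential r2 v2 + stepCost K L := by
        rw [pn]; ring
      omega
    · have hh : (Tree.node m s l2 k2 v2 r2).height = max l2.height r2.height + 1 :=
        hc2.balanced.1
      have e1 : l2.height * stepCost K L ≤ max l2.height r2.height * stepCost K L := by
        gcongr; omega
      have e2 : r2.height * stepCost K L ≤ max l2.height r2.height * stepCost K L := by
        gcongr; omega
      rw [hh, add_mul, one_mul, depth_split, depth_join2]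
      omega

end CTree

namespace CTree

/-! ### Building C-trees -/

section Build

variable {K : Type}

/-- The heads in an array, with their tails. -/
def headEntries (isHead : K → Bool) : List K → List (K × List K)
  | [] => []
  | x :: l =>
    if isHead x then (x, l.takeWhile fun y => !isHead y) :: headEntries isHead l
    else headEntries isHead l

variable (isHead : K → Bool)

/-- The heads with their indices, and the scans that start behind them, yield the entries. -/
theorem map_filter_zipIdx (m l : List K) (i : ℕ) (h : m.drop i = l) :
    ((l.zipIdx i).filter fun p => isHead p.1).map
      (fun p => (p.1, (m.drop (p.2 + 1)).takeWhile fun y => !isHead y)) = headEntries isHead l := by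
  induction l generalizing i with
  | nil => rfl
  | cons x l ih =>
    have h1 : m.drop (i + 1) = l := by rw [← List.drop_drop, h, List.drop_one, List.tail_cons]
    rw [List.zipIdx_cons, List.filter_cons, headEntries]
    split_ifs with hx
    · rw [List.map_cons, ih _ h1, h1]
    · exact ih _ h1

/-- The prefix and the entries make up the whole array. -/
theorem takeWhile_append_flat (l : List K) :
    (l.takeWhile fun y => !isHead y) ++ flat (headEntries isHead l) = l := by
  induction l with
  | nil => rfl
  | cons x l ih =>
    by_cases hx : isHead x
    · simp [headEntries, hx, ih]
    · simp [headEntries, hx, ih]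

theorem headEntries_heads (l : List K) :
    ∀ p ∈ headEntries isHead l, isHead p.1 = true ∧ ∀ x ∈ p.2, isHead x = false := by
  induction l with
  | nil => simp [headEntries]
  | cons x l ih =>
    rw [headEntries]
    split_ifs with hx
    · intro p hp
      rcases List.mem_cons.1 hp with rfl | hp
      · exact ⟨hx, fun y hy => by simpa using List.mem_takeWhile_imp hy⟩
      · exact ih p hp
    · exact ih

theorem length_flat (l : List (K × List K)) :
    (flat l).length = l.length + (l.map fun p => p.2.length).sum := by
  induction l with
  | nil => rfl
  | cons p l ih => simp [ih]; omega

/-- Up to one unit, twice the number of elements bounds the potential. -/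
theorem potential_le (c : CTree K) : potential c.tree c.pre ≤ 2 * c.elems.length + 1 := by
  rw [elems_eq_append, List.length_append, length_flat, potential]
  omega

theorem build_val (l : List K) :
    (build isHead l).val = ⟨(Tree.build (headEntries isHead l)).val,
      l.takeWhile fun y => !isHead y⟩ := by
  simp only [build, val_bind, val_parMap, val_pure, val_filterPar, val_scanTail]
  rw [← map_filter_zipIdx isHead l l 0 rfl]
  simp

variable [LinearOrder K]

theorem build_valid {l : List K} (hl : l.Pairwise (· < ·)) :
    Valid isHead (build isHead l).val ∧ (build isHead l).val.elems = l := by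
  have he : (build isHead l).val.elems = l := by
    rw [build_val, elems_eq_append, (Tree.build_spec _).1]
    exact takeWhile_append_flat isHead l
  refine ⟨⟨?_, by rwa [he], ?_, ?_⟩, he⟩
  · rw [build_val]; exact (Tree.build_spec _).2.1
  · rw [build_val]; simp only [(Tree.build_spec _).1]; exact headEntries_heads isHead l
  · rw [build_val]; exact fun y hy => by simpa using List.mem_takeWhile_imp hy

omit [LinearOrder K] in
theorem build_cost (l : List K) {L : ℕ} (hL : ChunksLE L (build isHead l).val) :
    (build isHead l).work ≤ 14 * l.length + 4 ∧
    (build isHead l).depth ≤ 8 * l.length.size + 2 * L + 8 := by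
  rw [build_val] at hL
  obtain ⟨hL1, hL2⟩ := hL
  simp only [(Tree.build_spec _).1] at hL1 hL2
  obtain ⟨-, -, -, t1, t2⟩ := Tree.build_spec (headEntries isHead l)
  have hlen := congrArg List.length (takeWhile_append_flat isHead l)
  rw [List.length_append, length_flat] at hlen
  have hmap := map_filter_zipIdx isHead l l 0 rfl
  set hs := (l.zipIdx.filter fun p => isHead p.1) with hhs
  have hm : hs.length = (headEntries isHead l).length := by rw [← hmap, List.length_map]
  have p1 := work_pack_le (fun _ (p : K × ℕ) => isHead p.1) none l.zipIdx
  have p2 := depth_pack_le (fun _ (p : K × ℕ) => isHead p.1) none l.zipIdx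
  have p3 := clog_le_size l.length
  rw [List.length_zipIdx] at p1 p2
  have q1 := work_scanTail isHead l
  have r1 : (parMap (fun p : K × ℕ => (pure p : Cost (K × ℕ))) l.zipIdx).work ≤ l.length * (0 + 2) := by
    have := work_parMap_le (f := fun p : K × ℕ => (pure p : Cost (K × ℕ))) (l := l.zipIdx) (m := 0)
      (fun _ _ => le_rfl)
    rwa [List.length_zipIdx] at this
  have r2 : (parMap (fun p : K × ℕ => (pure p : Cost (K × ℕ))) l.zipIdx).depth ≤
      0 + l.length.size + 1 := by
    have := depth_parMap_le (f := fun p : K × ℕ => (pure p : Cost (K × ℕ))) (l := l.zipIdx) (m := 0)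
      (fun _ _ => le_rfl)
    rwa [List.length_zipIdx] at this
  have s1 : (parMap (fun p : K × ℕ => do
      let t ← scanTail isHead (l.drop (p.2 + 1))
      pure (p.1, t)) hs).work =
      ((headEntries isHead l).map fun p => p.2.length).sum + 3 * (headEntries isHead l).length := by
    rw [← hmap, List.length_map, work_parMap, List.map_map]
    clear_value hs
    clear * -
    simp only [work_bind, work_pure, Function.comp_def, work_scanTail]
    induction hs with
    | nil => rfl
    | cons p hs ih =>
      simp only [List.map_cons, List.sum_cons, List.length_cons] at ih ⊢
      omega
  have s2 : (parMap (fun p : K × ℕ => do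
      let t ← scanTail isHead (l.drop (p.2 + 1))
      pure (p.1, t)) hs).depth ≤ (L + 1) + hs.length.size + 1 := by
    refine depth_parMap_le fun p hp => ?_
    rw [depth_bind, depth_scanTail, work_scanTail, depth_pure]
    have := hL2 (p.1, (l.drop (p.2 + 1)).takeWhile fun y => !isHead y)
      (by rw [← hmap]; exact List.mem_map.2 ⟨p, hp, rfl⟩)
    simp only at this
    omega
  have hsz : (headEntries isHead l).length.size ≤ l.length.size := Nat.size_le_size (by omega)
  have hent : (parMap (fun p : K × ℕ => do
      let t ← scanTail isHead (l.drop (p.2 + 1))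
      pure (p.1, t)) hs).val = headEntries isHead l := by
    rw [← hmap]; simp [val_scanTail]
  have hix : (parMap (fun p : K × ℕ => (pure p : Cost (K × ℕ))) l.zipIdx).val = l.zipIdx := by simp
  have hfil : (filterPar (fun p : K × ℕ => isHead p.1) l.zipIdx).val = hs := val_filterPar _ _
  have dq := depth_scanTail isHead l
  rw [hm] at s2
  constructor
  · simp only [build, work_bind, hix, hfil, hent, work_pure]
    simp only [filterPar]
    omega
  · simp only [build, depth_bind, hix, hfil, hent, depth_pure]
    simp only [filterPar]
    omega

end Build

end CTree

/-! ### Batches -/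

section Batch

variable {n : ℕ}

/-- The batch as a sorted array without repetitions. -/
def sortedBatch (A : List (Fin n × Fin n)) : List (Lex (Fin n × Fin n)) :=
  (dedupPar (mergeSort (A.map fun e => toLex e)).val).val

/-- The sources in a batch, in increasing order. -/
def batchSources (A : List (Fin n × Fin n)) : List (Fin n) :=
  (dedupPar ((sortedBatch A).map fun e => (ofLex e).1)).val

/-- The targets of the edges with source `u` in a batch, in increasing order. -/
def batchTargets (A : List (Fin n × Fin n)) (u : Fin n) : List (Fin n) :=
  ((sortedBatch A).filter fun e => decide ((ofLex e).1 = u)).map fun e => (ofLex e).2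

variable (A : List (Fin n × Fin n))

theorem mem_sortedBatch {e : Lex (Fin n × Fin n)} : e ∈ sortedBatch A ↔ ofLex e ∈ A := by
  rw [sortedBatch, mem_dedupPar, (perm_mergeSort _).mem_iff, List.mem_map]
  exact ⟨by rintro ⟨x, hx, rfl⟩; exact hx, fun h => ⟨_, h, rfl⟩⟩

theorem pairwise_sortedBatch : (sortedBatch A).Pairwise (· < ·) :=
  pairwise_dedupPar (pairwise_mergeSort _)

theorem length_dedupPar_le {α : Type} [DecidableEq α] (l : List α) :
    (dedupPar l).val.length ≤ l.length := by
  rw [dedupPar, val_pack]; exact length_packList_le _ _ _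

theorem length_sortedBatch_le : (sortedBatch A).length ≤ A.length := by
  refine (length_dedupPar_le _).trans ?_
  rw [(perm_mergeSort _).length_eq, List.length_map]

theorem fst_le_of_lt {e e' : Lex (Fin n × Fin n)} (h : e < e') : (ofLex e).1 ≤ (ofLex e').1 := by
  rcases Prod.Lex.lt_iff.1 h with h | h
  · exact h.le
  · exact h.1.le

theorem pairwise_batchSources : (batchSources A).Pairwise (· < ·) :=
  pairwise_dedupPar (List.pairwise_map.2 ((pairwise_sortedBatch A).imp fst_le_of_lt))

theorem mem_batchSources {u : Fin n} : u ∈ batchSources A ↔ ∃ v, (u, v) ∈ A := by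
  rw [batchSources, mem_dedupPar, List.mem_map]
  constructor
  · rintro ⟨e, he, rfl⟩
    exact ⟨_, (mem_sortedBatch A).1 he⟩
  · rintro ⟨v, hv⟩
    exact ⟨toLex (u, v), (mem_sortedBatch A).2 hv, rfl⟩

theorem length_batchSources_le : (batchSources A).length ≤ A.length := by
  refine (length_dedupPar_le _).trans ?_
  rw [List.length_map]
  exact length_sortedBatch_le A

theorem mem_batchTargets {u v : Fin n} : v ∈ batchTargets A u ↔ (u, v) ∈ A := by
  simp only [batchTargets, List.mem_map, List.mem_filter, decide_eq_true_eq, mem_sortedBatch]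
  constructor
  · rintro ⟨e, ⟨he, rfl⟩, rfl⟩
    exact he
  · exact fun h => ⟨toLex (u, v), ⟨h, rfl⟩, rfl⟩

theorem pairwise_batchTargets (u : Fin n) : (batchTargets A u).Pairwise (· < ·) := by
  refine List.pairwise_map.2 (List.Pairwise.imp_of_mem ?_ ((pairwise_sortedBatch A).filter _))
  intro e e' he he' h
  rw [List.mem_filter, decide_eq_true_eq] at he he'
  rcases Prod.Lex.lt_iff.1 h with h | h
  · rw [he.2, he'.2] at h
    exact absurd h (lt_irrefl _)
  · exact h.2

/-- The entries of `l` are distributed to different classes. -/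
theorem sum_length_filter_le {α β : Type} [DecidableEq β] (f : α → β) {ids : List β}
    (hids : ids.Nodup) (l : List α) :
    (ids.map fun u => (l.filter fun x => decide (f x = u)).length).sum ≤ l.length := by
  induction l with
  | nil => simp
  | cons x l ih =>
    have h : ∀ ids : List β, (ids.map fun u =>
        ((x :: l).filter fun x => decide (f x = u)).length).sum =
        (ids.map fun u => (l.filter fun x => decide (f x = u)).length).sum + ids.count (f x) := by
      intro ids
      clear ih hids
      induction ids with
      | nil => rfl
      | cons u ids ih =>
        have hu : ((x :: l).filter fun x => decide (f x = u)).length =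
            (l.filter fun x => decide (f x = u)).length + if u = f x then 1 else 0 := by
          by_cases hx : f x = u
          · simp [hx]
          · simp [hx, Ne.symm hx]
        simp only [List.map_cons, List.sum_cons, ih, hu, List.count_cons, beq_iff_eq]
        omega
    have := List.nodup_iff_count_le_one.1 hids (f x)
    rw [h, List.length_cons]
    omega

theorem sum_length_batchTargets_le :
    ((batchSources A).map fun u => (batchTargets A u).length).sum ≤ A.length := by
  simp only [batchTargets, List.length_map]
  exact (sum_length_filter_le _ ((pairwise_batchSources A).imp ne_of_lt) _).trans
    (length_sortedBatch_le A)

theorem pairwise_lt_source (u : Fin n) : (sortedBatch A).Pairwise fun x y =>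
    decide ((ofLex y).1 < u) = true → decide ((ofLex x).1 < u) = true :=
  (pairwise_sortedBatch A).imp fun h h' => by
    rw [decide_eq_true_eq] at h' ⊢
    exact (fst_le_of_lt h).trans_lt h'

theorem pairwise_le_source (u : Fin n) : (sortedBatch A).Pairwise fun x y =>
    decide ((ofLex y).1 ≤ u) = true → decide ((ofLex x).1 ≤ u) = true :=
  (pairwise_sortedBatch A).imp fun h h' => by
    rw [decide_eq_true_eq] at h' ⊢
    exact (fst_le_of_lt h).trans h'

/-- The two binary searches delimit the edges with source `u`. -/
theorem slice_eq (u : Fin n) :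
    ((sortedBatch A).drop (search (fun e => decide ((ofLex e).1 < u)) (sortedBatch A)).val).take
      ((search (fun e => decide ((ofLex e).1 ≤ u)) (sortedBatch A)).val -
        (search (fun e => decide ((ofLex e).1 < u)) (sortedBatch A)).val) =
    (sortedBatch A).filter fun e => decide ((ofLex e).1 = u) := by
  obtain ⟨a1, a2⟩ := take_search (pairwise_lt_source A u)
  obtain ⟨b1, -⟩ := take_search (pairwise_le_source A u)
  have hi : (search (fun e => decide ((ofLex e).1 < u)) (sortedBatch A)).val =
      ((sortedBatch A).filter fun e => decide ((ofLex e).1 < u)).length := by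
    rw [← a1, List.length_take, val_search (pairwise_lt_source A u),
      min_eq_left (List.takeWhile_sublist _).length_le]
  rw [← List.drop_take, b1, hi]
  conv_lhs =>
    rw [← List.take_append_drop
      (search (fun e => decide ((ofLex e).1 < u)) (sortedBatch A)).val (sortedBatch A), a1, a2]
  rw [List.filter_append, List.filter_filter, List.filter_filter, List.filter_append,
    List.filter_filter, List.filter_filter]
  have e1 : ∀ e : Lex (Fin n × Fin n), (decide ((ofLex e).1 ≤ u) && decide ((ofLex e).1 < u)) =
      decide ((ofLex e).1 < u) := fun e => by
    rw [← Bool.decide_and, decide_eq_decide]; exact ⟨fun h => h.2, fun h => ⟨h.le, h⟩⟩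
  have e2 : ∀ e : Lex (Fin n × Fin n), (decide ((ofLex e).1 ≤ u) && !decide ((ofLex e).1 < u)) =
      decide ((ofLex e).1 = u) := fun e => by
    rw [← decide_not, ← Bool.decide_and, decide_eq_decide, not_lt, ← le_antisymm_iff]
  have e3 : ∀ e : Lex (Fin n × Fin n), (decide ((ofLex e).1 < u) && !decide ((ofLex e).1 < u)) =
      false := fun e => by simp
  simp only [e1, e2, e3, Bool.and_self, List.filter_false, List.append_nil]
  rw [List.drop_left]

variable (isHead : Fin n → Bool)

theorem val_batchTrees : (batchTrees isHead A).val =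
    (batchSources A).map fun u => (u, (CTree.build isHead (batchTargets A u)).val) := by
  simp only [batchTrees, val_bind, val_parMap, val_pure]
  refine List.map_congr_left fun u _ => ?_
  rw [batchTargets, ← slice_eq]
  rfl

/-- Sorting dominates.  The C-trees have linear size altogether, and are built in parallel. -/
theorem batchTrees_cost (hA : A ≠ []) {L : ℕ}
    (hL : ∀ u, CTree.ChunksLE L (CTree.build isHead (batchTargets A u)).val) :
    (batchTrees isHead A).work ≤ 60 * (A.length * (A.length.size + 1)) ∧
    (batchTrees isHead A).depth ≤ 30 * (A.length.size + 1) ^ 3 + 2 * L := by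
  have hk : 0 < A.length := List.length_pos_iff.2 hA
  set s := A.length.size with hs
  have hB := length_sortedBatch_le A
  have hBs : (sortedBatch A).length.size ≤ s := Nat.size_le_size hB
  have hids := length_batchSources_le A
  -- the work for one source
  set task : Fin n → Cost (Fin n × CTree (Fin n)) := fun u => do
    let i ← search (fun e => decide ((ofLex e).1 < u)) (sortedBatch A)
    let j ← search (fun e => decide ((ofLex e).1 ≤ u)) (sortedBatch A)
    let targets ← parMap (fun e : Lex (Fin n × Fin n) => (pure (ofLex e).2 : Cost (Fin n)))
      (((sortedBatch A).drop i).take (j - i))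
    let c ← CTree.build isHead targets
    pure (u, c) with htask
  have hmap : ∀ u, (parMap (fun e : Lex (Fin n × Fin n) => (pure (ofLex e).2 : Cost (Fin n)))
      ((sortedBatch A).filter fun e => decide ((ofLex e).1 = u))).val = batchTargets A u :=
    fun u => rfl
  have hlen : ∀ u, ((sortedBatch A).filter fun e => decide ((ofLex e).1 = u)).length =
      (batchTargets A u).length := fun u => by rw [batchTargets, List.length_map]
  have hlenk : ∀ u, (batchTargets A u).length.size ≤ s := fun u => by
    refine Nat.size_le_size (le_trans ?_ hB)
    rw [← hlen]
    exact List.length_filter_le _ _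
  have hw : ∀ u, (task u).work + 2 ≤ 2 * s + 8 + 16 * (batchTargets A u).length := fun u => by
    have h1 := work_search_le (fun e => decide ((ofLex e).1 < u)) (sortedBatch A)
    have h2 := work_search_le (fun e => decide ((ofLex e).1 ≤ u)) (sortedBatch A)
    have h3 := work_parMap_le (f := fun e : Lex (Fin n × Fin n) => (pure (ofLex e).2 : Cost (Fin n)))
      (l := (sortedBatch A).filter fun e => decide ((ofLex e).1 = u)) (m := 0) fun _ _ => le_rfl
    have h4 := (CTree.build_cost isHead _ (hL u)).1
    rw [hlen] at h3
    simp only [htask, work_bind, slice_eq, hmap, work_pure]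
    omega
  have hd : ∀ u, (task u).depth ≤ 11 * s + 2 * L + 11 := fun u => by
    have h1 := work_search_le (fun e => decide ((ofLex e).1 < u)) (sortedBatch A)
    have h2 := work_search_le (fun e => decide ((ofLex e).1 ≤ u)) (sortedBatch A)
    have h3 := depth_parMap_le (f := fun e : Lex (Fin n × Fin n) => (pure (ofLex e).2 : Cost (Fin n)))
      (l := (sortedBatch A).filter fun e => decide ((ofLex e).1 = u)) (m := 0) fun _ _ => le_rfl
    have h4 := (CTree.build_cost isHead _ (hL u)).2
    have h5 := hlenk u
    rw [hlen] at h3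
    simp only [htask, depth_bind, slice_eq, hmap, depth_pure, depth_search]
    omega
  have tw : (parMap task (batchSources A)).work ≤ A.length * (2 * s + 24) := by
    rw [work_parMap]
    calc ((batchSources A).map fun u => (task u).work + 2).sum
        ≤ ((batchSources A).map fun u => 2 * s + 8 + 16 * (batchTargets A u).length).sum :=
          List.sum_le_sum fun u _ => hw u
      _ = (batchSources A).length * (2 * s + 8) +
          16 * ((batchSources A).map fun u => (batchTargets A u).length).sum := by
          rw [List.sum_map_add, List.sum_map_mul_left]; simp
      _ ≤ A.length * (2 * s + 8) + 16 * A.length := by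
          gcongr
          exact sum_length_batchTargets_le A
      _ = A.length * (2 * s + 24) := by ring
  have td := depth_parMap_le (f := task) (l := batchSources A) fun u _ => hd u
  have tds : (batchSources A).length.size ≤ s := Nat.size_le_size hids
  -- sorting and packing
  have a1 := work_parMap_le (f := fun e : Fin n × Fin n =>
    (pure (toLex e) : Cost (Lex (Fin n × Fin n)))) (l := A) (m := 0) fun _ _ => le_rfl
  have a2 := depth_parMap_le (f := fun e : Fin n × Fin n =>
    (pure (toLex e) : Cost (Lex (Fin n × Fin n)))) (l := A) (m := 0) fun _ _ => le_rfl
  have b1 := work_mergeSort_le (A.map fun e => toLex e)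
  have b2 := depth_mergeSort_le (A.map fun e => toLex e)
  have hsort : (mergeSort (A.map fun e => toLex e)).val.length = A.length := by
    rw [(perm_mergeSort _).length_eq, List.length_map]
  have c1 : (dedupPar (mergeSort (A.map fun e => toLex e)).val).work ≤ 5 * A.length + 2 := by
    rw [← hsort]; exact work_pack_le _ _ _
  have c2 : (dedupPar (mergeSort (A.map fun e => toLex e)).val).depth ≤ 3 * s + 2 := by
    have := depth_pack_le (fun p x => decide (p ≠ some x)) none
      (mergeSort (A.map fun e => toLex e)).val
    rw [hsort] at this
    exact this.trans (by have := clog_le_size A.length; omega)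
  have d1 := work_parMap_le (f := fun e : Lex (Fin n × Fin n) => (pure (ofLex e).1 : Cost (Fin n)))
    (l := sortedBatch A) (m := 0) fun _ _ => le_rfl
  have d2 := depth_parMap_le (f := fun e : Lex (Fin n × Fin n) => (pure (ofLex e).1 : Cost (Fin n)))
    (l := sortedBatch A) (m := 0) fun _ _ => le_rfl
  have e1 : (dedupPar ((sortedBatch A).map fun e => (ofLex e).1)).work ≤
      5 * (sortedBatch A).length + 2 := by
    have := work_pack_le (fun p x => decide (p ≠ some x)) none
      ((sortedBatch A).map fun e => (ofLex e).1)
    rwa [List.length_map] at this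
  have e2 : (dedupPar ((sortedBatch A).map fun e => (ofLex e).1)).depth ≤ 3 * s + 2 := by
    have := depth_pack_le (fun p x => decide (p ≠ some x)) none
      ((sortedBatch A).map fun e => (ofLex e).1)
    rw [List.length_map] at this
    exact this.trans (by have := clog_le_size (sortedBatch A).length; omega)
  have hclog := clog_le_size A.length
  rw [List.length_map] at b1 b2
  rw [← hs] at b2
  have hval1 : (parMap (fun e : Fin n × Fin n => (pure (toLex e) : Cost (Lex (Fin n × Fin n))))
      A).val = A.map fun e => toLex e := rfl
  have hval2 : (dedupPar (mergeSort (A.map fun e => toLex e)).val).val = sortedBatch A := rfl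
  have hval3 : (parMap (fun e : Lex (Fin n × Fin n) => (pure (ofLex e).1 : Cost (Fin n)))
      (sortedBatch A)).val = (sortedBatch A).map fun e => (ofLex e).1 := rfl
  have hval4 : (dedupPar ((sortedBatch A).map fun e => (ofLex e).1)).val = batchSources A := rfl
  constructor
  · have f1 : A.length * (Nat.clog 2 A.length + 1) ≤ A.length * (s + 1) := by gcongr
    have f2 : A.length * (2 * s + 24) = 2 * (A.length * (s + 1)) + 22 * A.length := by ring
    have f3 : A.length ≤ A.length * (s + 1) := Nat.le_mul_of_pos_right _ (by omega)
    simp only [batchTrees, work_bind, hval1, hval2, hval3, hval4]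
    change _ + (_ + (_ + (_ + (_ + (parMap task (batchSources A)).work)))) ≤ _
    omega
  · have f1 : Nat.clog 2 A.length * (2 * s * (s + 3) + 2) ≤ s * (2 * s * (s + 3) + 2) := by gcongr
    have f2 : s * (2 * s * (s + 3) + 2) + 22 * s + 30 ≤ 30 * (s + 1) ^ 3 := by
      ring_nf
      nlinarith [Nat.zero_le s, sq_nonneg s]
    simp only [batchTrees, depth_bind, hval1, hval2, hval3, hval4]
    change _ + (_ + (_ + (_ + (_ + (parMap task (batchSources A)).depth)))) ≤ _
    omega

end Batch

/-! ### Updates of graphs -/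

section Update

variable {n : ℕ} {isHead : Fin n → Bool} {A : List (Fin n × Fin n)}

/-- The out-neighbours of `u`. -/
abbrev outNbrs (E : Finset (Fin n × Fin n)) (u : Fin n) : Finset (Fin n) := {v | (u, v) ∈ E}

theorem represents_build_batchTargets (isHead : Fin n → Bool) (A : List (Fin n × Fin n))
    (u : Fin n) : (CTree.build isHead (batchTargets A u)).val.Represents isHead
      (outNbrs A.toFinset u) := by
  obtain ⟨h1, h2⟩ := CTree.build_valid isHead (pairwise_batchTargets A u)
  refine CTree.represents_iff.2 ⟨h1, fun v => ?_⟩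
  rw [h2, mem_batchTargets]
  simp

theorem mem_val_batchTrees {u : Fin n} {c : CTree (Fin n)} :
    (u, c) ∈ (batchTrees isHead A).val ↔
      (∃ v, (u, v) ∈ A) ∧ c = (CTree.build isHead (batchTargets A u)).val := by
  rw [val_batchTrees, List.mem_map, ← mem_batchSources]
  constructor
  · rintro ⟨u', h, e⟩
    obtain ⟨rfl, rfl⟩ := Prod.ext_iff.1 e
    exact ⟨h, rfl⟩
  · rintro ⟨h, rfl⟩
    exact ⟨u, h, rfl⟩

theorem ordered_build_batchTrees :
    (Tree.build (batchTrees isHead A).val).val.Ordered := by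
  rw [Tree.Ordered, (Tree.build_spec _).1, val_batchTrees]
  exact List.pairwise_map.2 (pairwise_batchSources A)

theorem GraphTree.Represents.ordered {T : GraphTree n} {E : Finset (Fin n × Fin n)}
    (hT : T.Represents isHead E) : Tree.Ordered T := List.pairwise_map.1 hT.increasing

/-- The union of the vertex-trees is correct if the operation on edge-trees is; `hR` accounts for the
vertices that are not a source in the batch. -/
theorem represents_multiInsert {op : CTree (Fin n) → CTree (Fin n) → Cost (CTree (Fin n))}
    {T : GraphTree n} {E R : Finset (Fin n × Fin n)} (hT : T.Represents isHead E)
    (hop : ∀ u c c', c.Represents isHead (outNbrs E u) →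
      c'.Represents isHead (outNbrs A.toFinset u) → (op c c').val.Represents isHead (outNbrs R u))
    (hR : ∀ u, (∀ v, (u, v) ∉ A) → outNbrs E u = outNbrs R u) :
    GraphTree.Represents isHead (Tree.multiInsert op T (batchTrees isHead A).val).val R := by
  obtain ⟨b1, b2, -⟩ := Tree.build_spec (batchTrees isHead A).val
  obtain ⟨h1, h2, h3⟩ := Tree.unionWith_spec op hT.balanced hT.ordered b2
    (ordered_build_batchTrees (isHead := isHead) (A := A))
  have hv : ∀ u, ∃ c, (u, c) ∈ Tree.toList T := fun u => by
    obtain ⟨p, hp, rfl⟩ := List.mem_map.1 (hT.vertices u)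
    exact ⟨_, hp⟩
  simp only [b1, mem_val_batchTrees] at h3
  refine ⟨h1, List.pairwise_map.2 h2, fun u => ?_, fun p hp => ?_⟩
  · obtain ⟨c, hc⟩ := hv u
    by_cases hu : ∃ v, (u, v) ∈ A
    · exact List.mem_map.2 ⟨_, (h3 u _).2 (.inr (.inr ⟨c, _, hc, ⟨hu, rfl⟩, rfl⟩)), rfl⟩
    · exact List.mem_map.2 ⟨_, (h3 u c).2 (.inl ⟨hc, fun v h => hu h.1⟩), rfl⟩
  · rcases (h3 p.1 p.2).1 hp with ⟨h, h'⟩ | ⟨-, h⟩ | ⟨c, c', hc, ⟨-, rfl⟩, e⟩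
    · have := hT.edges _ h
      rw [← outNbrs, hR p.1 fun v hv => h' _ ⟨⟨v, hv⟩, rfl⟩] at this
      exact this
    · obtain ⟨c, hc⟩ := hv p.1
      exact absurd hc (h c)
    · rw [e]
      exact hop p.1 c _ (hT.edges _ hc) (represents_build_batchTargets isHead A p.1)

/-- In none of the sets of targets that occur in an update there are more than `L` elements in a row
that are not heads. -/
def ShortRuns (isHead : Fin n → Bool) (L : ℕ) (E : Finset (Fin n × Fin n))
    (A : List (Fin n × Fin n)) : Prop :=
  ∀ u, CTree.RunsLE isHead L (outNbrs E u) ∧ CTree.RunsLE isHead L (outNbrs A.toFinset u) ∧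
    CTree.RunsLE isHead L (outNbrs (E \ A.toFinset) u)

theorem chunksLE_of_represents {c : CTree (Fin n)} {S : Finset (Fin n)} {L : ℕ}
    (hc : c.Represents isHead S) (hS : CTree.RunsLE isHead L S) : CTree.ChunksLE L c := by
  obtain ⟨h1, h2⟩ := CTree.represents_iff.1 hc
  exact CTree.chunksLE_of_runsLE hS h1 ⟨fun x => (h2 x).1, fun x y z _ _ hy _ _ => (h2 y).2 hy⟩

theorem represents_union {c c' : CTree (Fin n)} {S S' : Finset (Fin n)}
    (hc : c.Represents isHead S) (hc' : c'.Represents isHead S') {L : ℕ}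
    (hS : CTree.RunsLE isHead L S) (hS' : CTree.RunsLE isHead L S') :
    (c.union c').val.Represents isHead (S ∪ S') ∧
    (c.union c').work ≤ CTree.stepCost (Fin n) L * CTree.potential c'.tree c'.pre ∧
    (c.union c').depth ≤ Tree.maxHeight (Fin n) * CTree.stepCost (Fin n) L +
      CTree.leafDepth (Fin n) L := by
  obtain ⟨h1, h2⟩ := CTree.represents_iff.1 hc
  obtain ⟨h1', h2'⟩ := CTree.represents_iff.1 hc'
  obtain ⟨k1, k2, k3, k4⟩ := CTree.unionAux_spec h1 h1' (chunksLE_of_represents hc hS)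
    (chunksLE_of_represents hc' hS')
  refine ⟨CTree.represents_iff.2 ⟨k1, fun x => ?_⟩, k3, k4.trans ?_⟩
  · rw [Finset.mem_union, ← h2, ← h2']
    exact k2 x
  · gcongr
    exact Tree.height_le_maxHeight h1'.balanced h1'.ordered

theorem represents_diff {c c' : CTree (Fin n)} {S S' : Finset (Fin n)}
    (hc : c.Represents isHead S) (hc' : c'.Represents isHead S') {L : ℕ}
    (hS : CTree.RunsLE isHead L S) (hS' : CTree.RunsLE isHead L S')
    (hD : CTree.RunsLE isHead L (S \ S')) :
    (c.diff c').val.Represents isHead (S \ S') ∧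
    (c.diff c').work ≤ CTree.stepCost (Fin n) L * CTree.potential c'.tree c'.pre ∧
    (c.diff c').depth ≤ Tree.maxHeight (Fin n) * CTree.stepCost (Fin n) L +
      CTree.leafDepth (Fin n) L := by
  obtain ⟨h1, h2⟩ := CTree.represents_iff.1 hc
  obtain ⟨h1', h2'⟩ := CTree.represents_iff.1 hc'
  have hm : ∀ x, x ∈ c.elems ∧ x ∉ c'.elems ↔ x ∈ S \ S' := fun x => by
    rw [Finset.mem_sdiff, h2, h2']
  obtain ⟨k1, k2, k3, k4⟩ := CTree.diffAux_spec hD h1 h1' (chunksLE_of_represents hc hS)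
    (chunksLE_of_represents hc' hS') ⟨fun x => (hm x).1, fun x y z _ _ hy _ _ => (hm y).2 hy⟩
  refine ⟨CTree.represents_iff.2 ⟨k1, fun x => ?_⟩, k3, k4.trans ?_⟩
  · rw [← hm]
    exact k2 x
  · gcongr
    exact Tree.height_le_maxHeight h1'.balanced h1'.ordered

/-- A bound for all runs that needs no assumption on the heads. -/
theorem runsLE_card (isHead : Fin n → Bool) (S : Finset (Fin n)) : CTree.RunsLE isHead n S :=
  fun _ _ _ => (Finset.card_le_univ _).trans (Fintype.card_fin n).le

theorem shortRuns_card (isHead : Fin n → Bool) (E : Finset (Fin n × Fin n))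
    (A : List (Fin n × Fin n)) : ShortRuns isHead n E A :=
  fun _ => ⟨runsLE_card _ _, runsLE_card _ _, runsLE_card _ _⟩

theorem outNbrs_sdiff (E F : Finset (Fin n × Fin n)) (u : Fin n) :
    outNbrs (E \ F) u = outNbrs E u \ outNbrs F u := by
  ext v; simp

theorem outNbrs_union (E F : Finset (Fin n × Fin n)) (u : Fin n) :
    outNbrs (E ∪ F) u = outNbrs E u ∪ outNbrs F u := by
  ext v; simp

theorem represents_insertEdges {T : GraphTree n} {E : Finset (Fin n × Fin n)}
    (hT : T.Represents isHead E) :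
    (insertEdges isHead T A).val.Represents isHead (E ∪ A.toFinset) := by
  refine represents_multiInsert hT (fun u c c' hc hc' => ?_) fun u hu => ?_
  · rw [outNbrs_union]
    exact (represents_union hc hc' (runsLE_card _ _) (runsLE_card _ _)).1
  · ext v; simp [hu]

theorem represents_deleteEdges {T : GraphTree n} {E : Finset (Fin n × Fin n)}
    (hT : T.Represents isHead E) :
    (deleteEdges isHead T A).val.Represents isHead (E \ A.toFinset) := by
  refine represents_multiInsert hT (fun u c c' hc hc' => ?_) fun u hu => ?_
  · rw [outNbrs_sdiff]
    exact (represents_diff hc hc' (runsLE_card _ _) (runsLE_card _ _) (runsLE_card _ _)).1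
  · ext v; simp [hu]

/-- The potentials of the new edge-trees add up to `O(k)`, since each of them is linear in the number of
edges with this source. -/
theorem multiInsert_cost {op : CTree (Fin n) → CTree (Fin n) → Cost (CTree (Fin n))}
    {T : GraphTree n} {E : Finset (Fin n × Fin n)} (hT : T.Represents isHead E) (hA : A ≠ []) {L : ℕ}
    (hop : ∀ u c c', c.Represents isHead (outNbrs E u) →
      c'.Represents isHead (outNbrs A.toFinset u) →
      (op c c').work ≤ CTree.stepCost (Fin n) L * CTree.potential c'.tree c'.pre ∧
      (op c c').depth ≤ Tree.maxHeight (Fin n) * CTree.stepCost (Fin n) L +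
        CTree.leafDepth (Fin n) L) :
    (Tree.multiInsert op T (batchTrees isHead A).val).work ≤
      200 * (A.length * (L + Tree.maxHeight (Fin n) + 1)) ∧
    (Tree.multiInsert op T (batchTrees isHead A).val).depth ≤
      110 * ((A.length.size + 1) *
        ((Tree.maxHeight (Fin n) + 1) * (L + Tree.maxHeight (Fin n) + 1))) := by
  obtain ⟨b1, b2, b3, b4, b5⟩ := Tree.build_spec (batchTrees isHead A).val
  have hk : 0 < A.length := List.length_pos_iff.2 hA
  have hlen : (batchTrees isHead A).val.length ≤ A.length := by
    rw [val_batchTrees, List.length_map]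
    exact length_batchSources_le A
  have hsize : (batchTrees isHead A).val.length.size ≤ A.length.size := Nat.size_le_size hlen
  obtain ⟨h1, h2⟩ := Tree.unionWith_cost op
    (fun u => CTree.stepCost (Fin n) L * (3 * (batchTargets A u).length))
    (Tree.maxHeight (Fin n) * CTree.stepCost (Fin n) L + CTree.leafDepth (Fin n) L)
    hT.balanced hT.ordered b2 (ordered_build_batchTrees (isHead := isHead) (A := A))
    (fun u c c' hc hc' => by
      rw [b1, mem_val_batchTrees] at hc'
      obtain ⟨⟨v, hv⟩, rfl⟩ := hc'
      obtain ⟨w1, w2⟩ := hop u c _ (hT.edges _ hc) (represents_build_batchTargets isHead A u)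
      refine ⟨w1.trans (Nat.mul_le_mul_left _ ((CTree.potential_le _).trans ?_)), w2⟩
      rw [(CTree.build_valid isHead (pairwise_batchTargets A u)).2]
      have : 0 < (batchTargets A u).length :=
        List.length_pos_of_mem ((mem_batchTargets A).2 hv)
      omega)
  set H := Tree.maxHeight (Fin n) with hH
  have hsum : ((Tree.build (batchTrees isHead A).val).val.toList.map fun p =>
      CTree.stepCost (Fin n) L * (3 * (batchTargets A p.1).length) + (25 * H + 12)).sum ≤
      CTree.stepCost (Fin n) L * (3 * A.length) + A.length * (25 * H + 12) := by
    rw [b1, val_batchTrees, List.map_map]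
    simp only [Function.comp_def]
    rw [List.sum_map_add, List.sum_map_mul_left, List.sum_map_mul_left]
    simp only [List.map_const', List.sum_replicate, smul_eq_mul]
    gcongr
    · exact sum_length_batchTargets_le A
    · exact length_batchSources_le A
  have hB : CTree.stepCost (Fin n) L = 50 * (L + H + 1) := rfl
  have hD : CTree.leafDepth (Fin n) L = H * (25 * H + 15) + 2 * H + 7 * L + 12 := rfl
  constructor
  · simp only [Tree.multiInsert, work_bind]
    have e : CTree.stepCost (Fin n) L * (3 * A.length) + A.length * (25 * H + 12) +
        20 * A.length ≤ 200 * (A.length * (L + H + 1)) := by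
      rw [hB]; ring_nf; nlinarith [Nat.zero_le (A.length * L), Nat.zero_le (A.length * H)]
    omega
  · simp only [Tree.multiInsert, depth_bind]
    rw [b3] at h2
    have e : (batchTrees isHead A).val.length.size *
        (25 * H + 11 + (H * CTree.stepCost (Fin n) L + CTree.leafDepth (Fin n) L)) ≤
        A.length.size * (100 * ((H + 1) * (L + H + 1))) := by
      refine Nat.mul_le_mul hsize ?_
      rw [hB, hD]; ring_nf; nlinarith [Nat.zero_le (L * H), Nat.zero_le (H ^ 2)]
    have e2 : A.length.size * (100 * ((H + 1) * (L + H + 1))) + 3 * A.length.size + 10 ≤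
        110 * ((A.length.size + 1) * ((H + 1) * (L + H + 1))) := by
      have : 1 ≤ (H + 1) * (L + H + 1) := Nat.mul_pos (by omega) (by omega)
      generalize (H + 1) * (L + H + 1) = X at this ⊢
      nlinarith [Nat.mul_le_mul_left A.length.size this]
    omega

/-- A bound for the work of an update of a batch of size `k`. -/
def workBound (n L k : ℕ) : ℕ := 200 * (k * (L + Tree.maxHeight (Fin n) + k.size + 2))

/-- A bound for the depth of an update of a batch of size `k`. -/
def depthBound (n L k : ℕ) : ℕ :=
  200 * ((k.size + 1) ^ 3 + (k.size + 1) *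
    ((Tree.maxHeight (Fin n) + 1) * (L + Tree.maxHeight (Fin n) + 1)))

theorem update_cost {op : CTree (Fin n) → CTree (Fin n) → Cost (CTree (Fin n))}
    {T : GraphTree n} {E : Finset (Fin n × Fin n)} (hT : T.Represents isHead E) (hA : A ≠ []) {L : ℕ}
    (hS : ShortRuns isHead L E A)
    (hop : ∀ u c c', c.Represents isHead (outNbrs E u) →
      c'.Represents isHead (outNbrs A.toFinset u) →
      (op c c').work ≤ CTree.stepCost (Fin n) L * CTree.potential c'.tree c'.pre ∧
      (op c c').depth ≤ Tree.maxHeight (Fin n) * CTree.stepCost (Fin n) L +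
        CTree.leafDepth (Fin n) L) :
    (batchTrees isHead A >>= fun l => Tree.multiInsert op T l).work ≤ workBound n L A.length ∧
    (batchTrees isHead A >>= fun l => Tree.multiInsert op T l).depth ≤
      depthBound n L A.length := by
  obtain ⟨h1, h2⟩ := batchTrees_cost A isHead hA fun u =>
    chunksLE_of_represents (represents_build_batchTargets isHead A u) (hS u).2.1
  obtain ⟨h3, h4⟩ := multiInsert_cost hT hA hop
  simp only [work_bind, depth_bind, workBound, depthBound]
  generalize Tree.maxHeight (Fin n) = H at *
  constructor
  · have : A.length * (L + H + A.length.size + 2) =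
        A.length * (L + H + 1) + A.length * (A.length.size + 1) := by ring
    omega
  · have e : L + 1 ≤ (A.length.size + 1) * ((H + 1) * (L + H + 1)) := by
      have : 1 ≤ H + 1 := by omega
      calc L + 1 ≤ 1 * (1 * (L + H + 1)) := by omega
        _ ≤ _ := by gcongr; omega
    omega

theorem insertEdges_cost {T : GraphTree n} {E : Finset (Fin n × Fin n)}
    (hT : T.Represents isHead E) (hA : A ≠ []) {L : ℕ} (hS : ShortRuns isHead L E A) :
    (insertEdges isHead T A).work ≤ workBound n L A.length ∧
    (insertEdges isHead T A).depth ≤ depthBound n L A.length :=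
  update_cost hT hA hS fun u _ _ hc hc' => (represents_union hc hc' (hS u).1 (hS u).2.1).2

theorem deleteEdges_cost {T : GraphTree n} {E : Finset (Fin n × Fin n)}
    (hT : T.Represents isHead E) (hA : A ≠ []) {L : ℕ} (hS : ShortRuns isHead L E A) :
    (deleteEdges isHead T A).work ≤ workBound n L A.length ∧
    (deleteEdges isHead T A).depth ≤ depthBound n L A.length :=
  update_cost hT hA hS fun u _ _ hc hc' =>
    (represents_diff hc hc' (hS u).1 (hS u).2.1 (by
      have := (hS u).2.2
      rwa [outNbrs_sdiff] at this)).2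

end Update

/-! ### Random hash functions -/

section Random

variable {n N : ℕ}

theorem card_hash_pos (hN : 1 ≤ N) : (0 : ℝ) < Fintype.card (Hash n N) := by
  have : Nonempty (Finset.Icc 1 N) := ⟨⟨1, Finset.mem_Icc.2 ⟨le_rfl, hN⟩⟩⟩
  exact_mod_cast Fintype.card_pos

theorem hashProb_mono {P Q : Hash n N → Prop} (h : ∀ x, P x → Q x) : hashProb P ≤ hashProb Q := by
  classical
  refine div_le_div_of_nonneg_right (Nat.cast_le.2 (Finset.card_le_card fun x hx => ?_))
    (Nat.cast_nonneg _)
  rw [Finset.mem_filter] at hx ⊢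
  exact ⟨hx.1, h x hx.2⟩

theorem hashProb_compl (hN : 1 ≤ N) (P : Hash n N → Prop) :
    hashProb P = 1 - hashProb fun h => ¬ P h := by
  classical
  rw [eq_sub_iff_add_eq, hashProb, hashProb, ← add_div, div_eq_one_iff_eq (card_hash_pos hN).ne']
  have := Finset.card_filter_add_card_filter_not (s := (Finset.univ : Finset (Hash n N))) P
  rw [Finset.card_univ] at this
  rw [← this]
  push_cast
  congr

theorem hashProb_exists_le {ι : Type} [Fintype ι] {P : ι → Hash n N → Prop} {p : ℝ}
    (h : ∀ i, hashProb (P i) ≤ p) : hashProb (fun x => ∃ i, P i x) ≤ Fintype.card ι * p := by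
  classical
  have h1 : (#{x : Hash n N | ∃ i, P i x} : ℝ) ≤ ∑ i, (#{x : Hash n N | P i x} : ℝ) := by
    have : ({x : Hash n N | ∃ i, P i x} : Finset (Hash n N)) =
        Finset.univ.biUnion fun i => {x : Hash n N | P i x} := by ext; simp
    rw [this]
    exact_mod_cast Finset.card_biUnion_le
  calc hashProb (fun x => ∃ i, P i x) ≤ ∑ i, hashProb (P i) := by
        simp only [hashProb]
        rw [← Finset.sum_div]
        gcongr
    _ ≤ ∑ _i : ι, p := Finset.sum_le_sum fun i _ => h i
    _ = Fintype.card ι * p := by simp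

/-- Among `1, …, N` there are `N / b` multiples of `b`. -/
theorem card_nonheads (b N : ℕ) : #{x ∈ Finset.Icc 1 N | ¬ x % b = 0} = N - N / b := by
  have h1 := Finset.card_filter_add_card_filter_not (s := Finset.Icc 1 N) fun x => x % b = 0
  have h2 : #{x ∈ Finset.Icc 1 N | x % b = 0} = N / b := by
    rw [← Nat.Ioc_filter_dvd_card_eq_div]
    congr 1
    ext x
    simp [Nat.dvd_iff_mod_eq_zero, Nat.lt_iff_add_one_le]
  rw [Nat.card_Icc] at h1
  omega

/-- The values of a random hash function are independent, and each of them fails to be a head with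
probability at most `1 - 1 / (2 * b)`. -/
theorem hashProb_nonheads_le {b : ℕ} (hb : 1 ≤ b) (hN : b ≤ N) (R : Finset (Fin n)) :
    hashProb (fun h : Hash n N => ∀ v ∈ R, h.isHead b v = false) ≤
      (1 - 1 / (2 * b : ℝ)) ^ #R := by
  classical
  have hN0 : (0 : ℝ) < N := by exact_mod_cast (by omega : 0 < N)
  set Q : Finset (Finset.Icc 1 N) := {x | ¬ (x : ℕ) % b = 0} with hQ
  have hQc : #Q = N - N / b := by
    rw [← card_nonheads b N, hQ]
    refine Finset.card_bij (fun x _ => (x : ℕ)) ?_ ?_ ?_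
    · intro x hx
      rw [Finset.mem_filter] at hx ⊢
      exact ⟨x.2, hx.2⟩
    · intro x _ y _ e
      exact Subtype.ext e
    · intro x hx
      rw [Finset.mem_filter] at hx
      exact ⟨⟨x, hx.1⟩, by simpa using hx.2, rfl⟩
  have hset : ({h : Hash n N | ∀ v ∈ R, h.isHead b v = false} : Finset (Hash n N)) =
      Fintype.piFinset fun v => if v ∈ R then Q else Finset.univ := by
    ext h
    rw [Finset.mem_filter, Fintype.mem_piFinset]
    simp only [Finset.mem_univ, true_and, Hash.isHead, decide_eq_false_iff_not]
    refine forall_congr' fun v => ?_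
    by_cases hv : v ∈ R <;> simp [hv, hQ]
  have hq : ((#Q : ℕ) : ℝ) / N ≤ 1 - 1 / (2 * b : ℝ) := by
    have h1 : 1 ≤ N / b := Nat.div_pos hN (by omega)
    have h2 : N ≤ 2 * b * (N / b) := by
      have := Nat.lt_mul_div_succ N (show 0 < b by omega)
      nlinarith
    have h3 : (N : ℝ) ≤ 2 * b * ((N / b : ℕ) : ℝ) := by exact_mod_cast h2
    have hb0 : (0 : ℝ) < 2 * b := by positivity
    rw [hQc, Nat.cast_sub (Nat.div_le_self _ _), sub_div, div_self hN0.ne']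
    refine sub_le_sub_left ?_ _
    rw [div_le_div_iff₀ hb0 hN0]
    linarith
  have hcard : (Fintype.card (Hash n N) : ℝ) = ∏ _v : Fin n, (N : ℝ) := by
    simp [Fintype.card_pi]
  unfold hashProb
  have e : (#{h : Hash n N | ∀ v ∈ R, h.isHead b v = false} : ℝ) =
      ∏ v : Fin n, if v ∈ R then ((#Q : ℕ) : ℝ) else N := by
    rw [hset, Fintype.card_piFinset]
    push_cast
    refine Finset.prod_congr rfl fun v _ => ?_
    split_ifs <;> simp
  calc _ = (#{h : Hash n N | ∀ v ∈ R, h.isHead b v = false} : ℝ) / Fintype.card (Hash n N) := by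
        congr
    _ = ∏ v : Fin n, if v ∈ R then ((#Q : ℕ) : ℝ) / N else 1 := by
        rw [e, hcard, ← Finset.prod_div_distrib]
        refine Finset.prod_congr rfl fun v _ => ?_
        split_ifs
        · rfl
        · exact div_self hN0.ne'
    _ = (((#Q : ℕ) : ℝ) / N) ^ #R := by
        rw [Finset.prod_ite_mem, Finset.univ_inter, Finset.prod_const]
    _ ≤ _ := by gcongr

theorem hashProb_nonheads_le_exp {b : ℕ} (hb : 1 ≤ b) (hN : b ≤ N) {R : Finset (Fin n)} {x : ℝ}
    (hx : x ≤ #R) : hashProb (fun h : Hash n N => ∀ v ∈ R, h.isHead b v = false) ≤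
      Real.exp (-(x / (2 * b))) := by
  have hb1 : (1 : ℝ) ≤ b := by exact_mod_cast hb
  have h0 : (0 : ℝ) ≤ 1 - 1 / (2 * b) := by
    rw [sub_nonneg, div_le_one (by positivity)]
    linarith
  calc _ ≤ (1 - 1 / (2 * b : ℝ)) ^ #R := hashProb_nonheads_le hb hN R
    _ ≤ Real.exp (-(1 / (2 * b))) ^ #R := by
        gcongr
        exact Real.one_sub_le_exp_neg _
    _ = Real.exp (-(#R / (2 * b))) := by
        rw [← Real.exp_nat_mul]
        congr 1
        ring
    _ ≤ _ := by gcongr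

theorem hashProb_not_runsLE_le {b : ℕ} (hb : 1 ≤ b) (hN : b ≤ N) (L : ℕ) (S : Finset (Fin n)) :
    hashProb (fun h : Hash n N => ¬ CTree.RunsLE (h.isHead b) L S) ≤
      (n * n : ℕ) * Real.exp (-(L / (2 * b : ℝ))) := by
  -- the event for one interval; it is empty if the interval has at most `L` elements
  have h1 : ∀ p : Fin n × Fin n, hashProb (fun h : Hash n N =>
      (∀ z ∈ S, p.1 ≤ z → z ≤ p.2 → h.isHead b z = false) ∧
        ¬ #{z ∈ S | p.1 ≤ z ∧ z ≤ p.2} ≤ L) ≤ Real.exp (-(L / (2 * b : ℝ))) := fun p => by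
    by_cases hc : #{z ∈ S | p.1 ≤ z ∧ z ≤ p.2} ≤ L
    · simp only [hc, not_true, and_false]
      simpa [hashProb] using (Real.exp_pos _).le
    · refine (hashProb_mono fun h hh => ?_).trans
        (hashProb_nonheads_le_exp hb hN (R := {z ∈ S | p.1 ≤ z ∧ z ≤ p.2}) (x := L) ?_)
      · intro v hv
        rw [Finset.mem_filter] at hv
        exact hh.1 v hv.1 hv.2.1 hv.2.2
      · exact_mod_cast (not_le.1 hc).le
  refine (hashProb_mono fun h hh => ?_).trans ((hashProb_exists_le h1).trans_eq ?_)
  · simp only [CTree.RunsLE, not_forall] at hh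
    obtain ⟨x, y, h2, h3⟩ := hh
    exact ⟨(x, y), h2, h3⟩
  · simp

/-- Long runs of non-heads are unlikely: there are `3 * n` sets and `n * n` intervals in each of
them. -/
theorem hashProb_not_shortRuns_le {b : ℕ} (hb : 1 ≤ b) (hN : b ≤ N) (L : ℕ)
    (E : Finset (Fin n × Fin n)) (A : List (Fin n × Fin n)) :
    hashProb (fun h : Hash n N => ¬ ShortRuns (h.isHead b) L E A) ≤
      3 * (n : ℝ) ^ 3 * Real.exp (-(L / (2 * b : ℝ))) := by
  have h1 : ∀ p : Fin n × Fin 3, hashProb (fun h : Hash n N => ¬ CTree.RunsLE (h.isHead b) L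
      (![outNbrs E p.1, outNbrs A.toFinset p.1, outNbrs (E \ A.toFinset) p.1] p.2)) ≤
      (n * n : ℕ) * Real.exp (-(L / (2 * b : ℝ))) := fun p => hashProb_not_runsLE_le hb hN L _
  refine (hashProb_mono fun h hh => ?_).trans ((hashProb_exists_le h1).trans_eq ?_)
  · simp only [ShortRuns, not_forall] at hh
    obtain ⟨u, hu⟩ := hh
    by_contra hcon
    push Not at hcon
    exact hu ⟨hcon (u, 0), hcon (u, 1), hcon (u, 2)⟩
  · simp only [Fintype.card_prod, Fintype.card_fin]
    push_cast
    ring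

/-- The run length that is exceeded with probability at most `n ^ (-(c + 1))`.  Of the summand `6` in
the factor, five units pay for the union bound over at most `3 * n ^ 3 ≤ n ^ 5` events; the last one
makes the exceptional hash functions negligible for the expected work, which is at most `n` times
larger there. -/
noncomputable def runBound (b c n : ℕ) : ℕ := ⌈2 * b * (c + 6) * Real.log n⌉₊

theorem hashProb_not_shortRuns_runBound_le {b : ℕ} (hb : 1 ≤ b) (hN : b ≤ N) (hn : 2 ≤ n) (c : ℕ)
    (E : Finset (Fin n × Fin n)) (A : List (Fin n × Fin n)) :
    hashProb (fun h : Hash n N => ¬ ShortRuns (h.isHead b) (runBound b c n) E A) ≤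
      1 / (n : ℝ) ^ (c + 1) := by
  have hn2 : (2 : ℝ) ≤ n := by exact_mod_cast hn
  have hn0 : (0 : ℝ) < n := by linarith
  have hb0 : (0 : ℝ) < 2 * b := by positivity
  have h1 : (c + 6 : ℝ) * Real.log n ≤ runBound b c n / (2 * b : ℝ) := by
    rw [le_div_iff₀ hb0]
    refine le_trans (le_of_eq ?_) (Nat.le_ceil _)
    ring
  have h2 : Real.exp (-(runBound b c n / (2 * b : ℝ))) ≤ 1 / (n : ℝ) ^ (c + 6) := by
    calc _ ≤ Real.exp (-((c + 6 : ℝ) * Real.log n)) := by gcongr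
      _ = _ := by
        rw [Real.exp_neg, one_div, show (c + 6 : ℝ) = ((c + 6 : ℕ) : ℝ) by push_cast; rfl,
          Real.exp_nat_mul, Real.exp_log hn0]
  calc _ ≤ 3 * (n : ℝ) ^ 3 * Real.exp (-(runBound b c n / (2 * b : ℝ))) :=
        hashProb_not_shortRuns_le hb hN _ E A
    -- `3 ≤ n ^ 2`
    _ ≤ (n : ℝ) ^ 2 * (n : ℝ) ^ 3 * (1 / (n : ℝ) ^ (c + 6)) := by gcongr; nlinarith
    _ = _ := by
        field_simp
        ring

/-- A random variable that is at most `w` on `P`, and at most `w + v` in any case. -/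
theorem hashExp_le (hN : 1 ≤ N) {X : Hash n N → ℝ} {P : Hash n N → Prop} {w v : ℝ}
    (h : ∀ x, P x → X x ≤ w) (h' : ∀ x, X x ≤ w + v) :
    hashExp X ≤ w + v * hashProb fun x => ¬ P x := by
  classical
  have hpos := card_hash_pos (n := n) hN
  have h1 : ∑ x : Hash n N, X x ≤ ∑ x : Hash n N, (w + v * if ¬ P x then 1 else 0) := by
    refine Finset.sum_le_sum fun x _ => ?_
    by_cases hx : P x
    · simpa [hx] using h x hx
    · simpa [hx] using h' x
  rw [Finset.sum_add_distrib, ← Finset.mul_sum, Finset.sum_boole] at h1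
  rw [hashExp, hashProb, div_le_iff₀ hpos, add_mul, mul_assoc, div_mul_cancel₀ _ hpos.ne']
  refine h1.trans (le_of_eq ?_)
  simp only [Finset.sum_const, Finset.card_univ, nsmul_eq_mul]
  rw [mul_comm w]
  congr

end Random

/-! ### Bounds in terms of the logarithm -/

section Log

theorem one_le_two_mul_log {n : ℕ} (hn : 2 ≤ n) : 1 ≤ 2 * Real.log n := by
  have h1 : Real.log 2 ≤ Real.log n := Real.log_le_log (by norm_num) (by exact_mod_cast hn)
  have := Real.log_two_gt_d9
  linarith

theorem size_le_log {n : ℕ} (hn : 2 ≤ n) : (n.size : ℝ) ≤ 3 * Real.log n := by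
  have h0 : 0 < n.size := Nat.size_pos.2 (by omega)
  have h1 : 2 ^ (n.size - 1) ≤ n := Nat.lt_size.1 (by omega)
  have h2 : ((n.size - 1 : ℕ) : ℝ) * Real.log 2 ≤ Real.log n := by
    rw [← Real.log_pow]
    exact Real.log_le_log (by positivity) (by exact_mod_cast h1)
  have h3 : Real.log 2 ≤ Real.log n := Real.log_le_log (by norm_num) (by exact_mod_cast hn)
  rw [Nat.cast_sub h0] at h2
  have := Real.log_two_gt_d9
  push_cast at h2
  have h4 : (1 : ℝ) ≤ n.size := by exact_mod_cast h0
  nlinarith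

/-- The factor between `log n` and the quantities that enter the costs. -/
def logFactor (a b c : ℕ) : ℕ := 2 * b * (c + 6) + 3 * a + 16

variable {a b c n k : ℕ}

theorem workBound_le (hn : 2 ≤ n) (hk : k ≤ n ^ a) :
    (workBound n (runBound b c n) k : ℝ) + 200 * k ≤
      200 * logFactor a b c * (k * Real.log n) := by
  have h1 := one_le_two_mul_log hn
  have h2 := size_le_log hn
  have h3 : (k.size : ℝ) ≤ a * n.size + 1 := by exact_mod_cast size_le_of_le_pow hk
  have h4 : (runBound b c n : ℝ) ≤ 2 * b * (c + 6) * Real.log n + 1 :=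
    (Nat.ceil_lt_add_one (by positivity)).le
  have h5 : (a : ℝ) * n.size ≤ a * (3 * Real.log n) := by gcongr
  have h6 : (runBound b c n : ℝ) + 2 * n.size + k.size + 3 ≤ logFactor a b c * Real.log n := by
    rw [logFactor]
    push_cast
    nlinarith
  have h7 : (k : ℝ) * (runBound b c n + 2 * n.size + k.size + 3) ≤
      k * (logFactor a b c * Real.log n) := by gcongr
  rw [workBound, Tree.maxHeight, Fintype.card_fin]
  push_cast
  linarith

theorem depthBound_le (hn : 2 ≤ n) (hk : k ≤ n ^ a) :
    (depthBound n (runBound b c n) k : ℝ) ≤ 400 * logFactor a b c ^ 3 * Real.log n ^ 3 := by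
  have h1 := one_le_two_mul_log hn
  have h2 := size_le_log hn
  have h3 : (k.size : ℝ) ≤ a * n.size + 1 := by exact_mod_cast size_le_of_le_pow hk
  have h4 : (runBound b c n : ℝ) ≤ 2 * b * (c + 6) * Real.log n + 1 :=
    (Nat.ceil_lt_add_one (by positivity)).le
  have h5 : (a : ℝ) * n.size ≤ a * (3 * Real.log n) := by gcongr
  have h0 : 0 ≤ Real.log n := by linarith
  have h6 : 0 ≤ 2 * b * (c + 6) * Real.log n := by positivity
  have h7 : 0 ≤ (a : ℝ) * Real.log n := by positivity
  set M := (logFactor a b c : ℝ) * Real.log n with hM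
  have hMe : M = 2 * b * (c + 6) * Real.log n + 3 * (a * Real.log n) + 16 * Real.log n := by
    rw [hM, logFactor]
    push_cast
    ring
  have e1 : (k.size : ℝ) + 1 ≤ M := by linarith
  have e2 : 2 * (n.size : ℝ) + 1 ≤ M := by linarith
  have e3 : (runBound b c n : ℝ) + 2 * n.size + 1 ≤ M := by linarith
  have hM0 : 0 ≤ M := by positivity
  calc (depthBound n (runBound b c n) k : ℝ)
      = 200 * (((k.size : ℝ) + 1) ^ 3 + (k.size + 1) *
          ((2 * n.size + 1) * (runBound b c n + 2 * n.size + 1))) := by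
        rw [depthBound, Tree.maxHeight, Fintype.card_fin]
        push_cast
        ring
    _ ≤ 200 * (M ^ 3 + M * (M * M)) := by gcongr
    _ = _ := by rw [hM]; ring

end Log

/-- The cost of an update is within the bounds if it is at most `workBound` and `depthBound` whenever
the runs of elements that are not heads are short.  All runs have length at most `n`, so the
exceptional hash functions contribute at most `200 * k` to the expected work. -/
theorem withinBounds_of_shortRuns {b n N a c : ℕ} (hb : 1 ≤ b) (hN : b ≤ N) (hn : 2 ≤ n)
    {E : Finset (Fin n × Fin n)} {A : List (Fin n × Fin n)} (hk : A.length ≤ n ^ a) {α : Type}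
    {R : Hash n N → Cost α}
    (hR : ∀ h L, ShortRuns (h.isHead b) L E A →
      (R h).work ≤ workBound n L A.length ∧ (R h).depth ≤ depthBound n L A.length) :
    WithinBounds (400 * logFactor a b c ^ 3 : ℝ) c A.length R := by
  have hn2 : (2 : ℝ) ≤ n := by exact_mod_cast hn
  have hn0 : (0 : ℝ) < n := by linarith
  have hlog := one_le_two_mul_log hn
  have hfail := hashProb_not_shortRuns_runBound_le (N := N) hb hN hn c E A
  have hw := workBound_le (b := b) (c := c) hn hk
  have hd := depthBound_le (b := b) (c := c) hn hk
  have hM : 200 * (logFactor a b c : ℝ) * (A.length * Real.log n) ≤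
      400 * logFactor a b c ^ 3 * (A.length * Real.log n) := by
    have h1 : (1 : ℝ) ≤ logFactor a b c := by
      exact_mod_cast (by rw [logFactor]; omega : 1 ≤ logFactor a b c)
    have h2 : (logFactor a b c : ℝ) ≤ logFactor a b c ^ 3 := le_self_pow₀ h1 (by norm_num)
    have : 0 ≤ Real.log n := by linarith
    gcongr
    norm_num
  constructor
  · refine (hashExp_le (by omega) (P := fun h => ShortRuns (h.isHead b) (runBound b c n) E A)
      (w := workBound n (runBound b c n) A.length) (v := 200 * A.length * n)
      (fun h hh => by exact_mod_cast (hR h _ hh).1) fun h => ?_).trans ?_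
    · have := (hR h n (shortRuns_card _ _ _)).1
      have h2 : workBound n n A.length ≤
          workBound n (runBound b c n) A.length + 200 * A.length * n := by
        rw [workBound, workBound]
        linarith [Nat.zero_le (A.length * runBound b c n)]
      exact_mod_cast this.trans h2
    · have h1 : (n : ℝ) * hashProb (fun h : Hash n N =>
          ¬ ShortRuns (h.isHead b) (runBound b c n) E A) ≤ 1 := by
        calc _ ≤ (n : ℝ) * (1 / (n : ℝ) ^ (c + 1)) := by gcongr
          _ = 1 / (n : ℝ) ^ c := by field_simp; ring
          _ ≤ 1 := by
            rw [div_le_one (by positivity)]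
            exact one_le_pow₀ (by linarith)
      have h2 : 200 * (A.length : ℝ) * n * hashProb (fun h : Hash n N =>
          ¬ ShortRuns (h.isHead b) (runBound b c n) E A) ≤ 200 * A.length := by
        rw [mul_assoc]
        exact mul_le_of_le_one_right (by positivity) h1
      linarith
  · have h1 : 1 / (n : ℝ) ^ (c + 1) ≤ 1 / (n : ℝ) ^ c := by
      gcongr
      · linarith
      · omega
    calc 1 - 1 / (n : ℝ) ^ c ≤ 1 - hashProb (fun h : Hash n N =>
          ¬ ShortRuns (h.isHead b) (runBound b c n) E A) := by linarith
      _ = hashProb fun h : Hash n N => ShortRuns (h.isHead b) (runBound b c n) E A :=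
          (hashProb_compl (by omega) _).symm
      _ ≤ _ := hashProb_mono fun h hh => by
          obtain ⟨h2, h3⟩ := hR h _ hh
          have h2' : ((R h).work : ℝ) ≤ workBound n (runBound b c n) A.length := by
            exact_mod_cast h2
          have h3' : ((R h).depth : ℝ) ≤ depthBound n (runBound b c n) A.length := by
            exact_mod_cast h3
          have : (0 : ℝ) ≤ 200 * A.length := by positivity
          exact ⟨by linarith, h3'.trans hd⟩

end CTreeGraph

theorem mainTheorem7 (b : ℕ) (hb : 1 ≤ b) (a c : ℕ) :
    ∃ C : ℝ, 0 < C ∧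
      ∀ (n N : ℕ), 2 ≤ n → b ≤ N →
      ∀ (E : Finset (Fin n × Fin n)) (A : List (Fin n × Fin n)),
        A ≠ [] → A.length ≤ n ^ a →
      ∀ T : CTreeGraph.Hash n N → CTreeGraph.GraphTree n,
        (∀ h, (T h).Represents (h.isHead b) E) →
        (∀ h, (CTreeGraph.insertEdges (h.isHead b) (T h) A).val.Represents (h.isHead b)
          (E ∪ A.toFinset)) ∧
        (∀ h, (CTreeGraph.deleteEdges (h.isHead b) (T h) A).val.Represents (h.isHead b)
          (E \ A.toFinset)) ∧
        CTreeGraph.WithinBounds C c A.length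
          (fun h => CTreeGraph.insertEdges (h.isHead b) (T h) A) ∧
        CTreeGraph.WithinBounds C c A.length
          (fun h => CTreeGraph.deleteEdges (h.isHead b) (T h) A) := by
  refine ⟨400 * CTreeGraph.logFactor a b c ^ 3, ?_, fun n N hn hN E A hA hk T hT =>
    ⟨fun h => CTreeGraph.represents_insertEdges (hT h),
      fun h => CTreeGraph.represents_deleteEdges (hT h),
      CTreeGraph.withinBounds_of_shortRuns hb hN hn hk fun h _ hS =>
        CTreeGraph.insertEdges_cost (hT h) hA hS,
      CTreeGraph.withinBounds_of_shortRuns hb hN hn hk fun h _ hS =>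
        CTreeGraph.deleteEdges_cost (hT h) hA hS⟩⟩
  have : 0 < CTreeGraph.logFactor a b c := by rw [CTreeGraph.logFactor]; omega
  positivity
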